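/- Let $\lambda_0\in(0,1)$, $k_0=2\sqrt{1-\lambda_0^2}$, $\sigma_0=\lambda_0k_0$, $L=2\pi/k_0$, and let $$\hat u_0(x,t)=-1+\frac{2(1-\lambda_0^2)\cosh(\sigma_0t)+i\sigma_0\sinh(\sigma_0t)}{\cosh(\sigma_0t)-\lambda_0\cos(k_0x)}$$ be the Akhmediev breather, a solution of $iu_t+\tfrac12u_{xx}+(|u|^2-1)u=0$. The Lax system is $\varphi_x=U\varphi$, $\varphi_t=V\varphi$ with $$U=\begin{pmatrix}\lambda&u\\-\bar u&-\lambda\end{pmatrix},\quad V=i\begin{pmatrix}\lambda^2+\frac12(|u|^2-1)&\lambda u+\frac12u_x\\-\lambda\bar u+\frac12\bar u_x&-\lambda^2-\frac12(|u|^2-1)\end{pmatrix},$$ and the linearized NLS equation at $u$ is $iv_t+\tfrac12v_{xx}+(2|u|^2-1)v+u^2\bar v=0$. For $\mathbb C^2$-valued functions put $$M(\varphi,\phi)=\varphi_1\phi_1-\bar\varphi_2\bar\phi_2,\qquad P(\varphi,\phi)=i\varphi_1\phi_1+i\bar\varphi_2\bar\phi_2 .$$ With principal square roots let $$p_\pm=\sqrt{\lambda_0-\tfrac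 i2k_0}\,e^{\frac12(-ik_0x+\sigma_0t)}\pm\sqrt{\lambda_0+\tfrac i2k_0}\,e^{\frac12(ik_0x-\sigma_0t)},$$ $$q_\pm=-\sqrt{\lambda_0+\tfrac i2k_0}\,e^{\frac12(-ik_0x+\sigma_0t)}\mp\sqrt{\lambda_0-\tfrac i2k_0}\,e^{\frac12(ik_0x-\sigma_0t)},$$ $p_0=p_-$, $q_0=q_-$, $\theta=\sigma_0t-ik_0x$, $\ell=i\lambda_0x+(1-2\lambda_0^2)t$, and $$\varphi_0=\frac{2\lambda_0}{|p_0|^2+|q_0|^2}\binom{-\bar q_0}{\bar p_0},\qquad \hat\varphi=\binom1{-1}-\frac{p_0+q_0}{1-\lambda_0}\varphi_0,$$ $$\hat\phi=\binom{x+it+1}{-x-it}-\frac{(x+it)(p_0+q_0)+q_0}{1-\lambda_0}\varphi_0,$$ $$\varphi_1=\frac1{2ik_0}\binom{p_+}{q_+}+\frac2{k_0^2}(\cosh\theta-\lambda_0)\varphi_0,$$ $$\phi_0=\binom{p_0}{q_0}+4\Big[-\lambda_0x+i(1-2\lambda_0^2)t+\tfrac i{k_0}\sinh\theta\Big]\varphi_0,$$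 $$\phi_1=\frac{2\ell}{k_0}\binom{p_+}{q_+}+\frac i{k_0}\binom{p_+}{-q_+}+\Big[\frac{8i}{k_0^2}\,\ell\cosh\theta+\frac{8i\lambda_0}{k_0^3}\sinh\theta+2i(ix-4\lambda_0t)\Big]\varphi_0 .$$ **Theorem.** (a) For $u=\hat u_0$, the functions $\hat\varphi,\hat\phi$ solve the Lax system with $\lambda=1$ and $\varphi_0,\phi_0$ solve it with $\lambda=\lambda_0$; $\varphi_1$ and $\phi_1$ are generalized solutions at $\lambda=\lambda_0$ over $\varphi_0$ and $\phi_0$, i.e. $(\varphi_0,\varphi_1)$ and $(\phi_0,\phi_1)$ both satisfy the Lax system and its first $\lambda$-derivative, $$\psi_{1,x}=U\psi_1+\partial_\lambda U\,\psi_0,\qquad \psi_{1,t}=V\psi_1+\partial_\lambda V\,\psi_0\qquad(\lambda=\lambda_0).$$ In $x$, $\hat\varphi$ is $L$-periodic and $\varphi_0,\varphi_1$ are $L$-antiperiodic. (b) Let $D=\cosh(\sigma_0t)-\lambda_0\cos(k_0x)$. Then $$v_1:=M(\hat\varphi,\hat\varphi)=-\frac{2\lambda_0(1+\lambda_0)}{1-\lambda_0}\,\frac{\sin(k_0x)[k_0\cosh(\sigma_0t)+2i\lambda_0\sinh(\sigma_0t)]}{D^2},$$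 $$v_2:=P(\hat\varphi,\hat\varphi)=\frac{2i(1+\lambda_0)}{1-\lambda_0}\,\frac{ik_0\lambda_0\sinh(\sigma_0t)\cosh(\sigma_0t)+(1-2\lambda_0^2)\cosh^2(\sigma_0t)-\lambda_0^2\cos^2(k_0x)+2\lambda_0^2}{D^2},$$ $$w_2:=P(\varphi_0,\varphi_0)=\frac{\lambda_0^2[k_0\sinh(\sigma_0t)\cos(k_0x)+2i\lambda_0\cosh(\sigma_0t)\cos(k_0x)-2i]}{2D^2}.$$ Let further $v_3=M(\hat\varphi,\hat\phi)$, $v_4=P(\hat\varphi,\hat\phi)$, $w_3=M(\varphi_0,\phi_0)$, $w_4=P(\varphi_0,\phi_0)$, $v_+=M(\varphi_0,\phi_1)+M(\varphi_1,\phi_0)$, $v_-=P(\varphi_0,\phi_1)+P(\varphi_1,\phi_0)$, and $$v_5=\lambda_0^2\tfrac{1-\lambda_0}{1+\lambda_0}v_3-w_3,\qquad v_6=k_0^2v_+-\tfrac{2\lambda_0(3-2\lambda_0^2)(1-\lambda_0)}{1+\lambda_0}v_3,$$ $$v_7=k_0^2v_--\tfrac{2(1-4\lambda_0^2)}{\lambda_0}w_4-\tfrac{8\lambda_0^2(1-\lambda_0)}{1+\lambda_0}v_4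 .$$ Then $v_1,v_2,w_2,v_5,v_6,v_7$ are smooth solutions of the linearized NLS equation at $\hat u_0$, $L$-periodic in $x$, and linearly independent over $\mathbb R$. (c) Uniformly in $x$, $\hat u_0(x,t)\to\theta_\pm:=(\sqrt{1-\lambda_0^2}\pm i\lambda_0)^2$ as $t\to\pm\infty$. Consider the modes, with $m=0,1$ and $L$-periodic in $x$, of the linearized NLS equation at the constant background $u=1$ (here $2\pi/L=k_0$ and $\tfrac12\sqrt{4-k_0^2}=\lambda_0$): $$\widetilde v_0^+=2i,\quad \widetilde v_0^-=1+2it,\quad v_{\lambda_0}^{+}=-(2i\lambda_0+k_0)e^{\sigma_0t}\sin(k_0x),\quad v_{-\lambda_0}^{+}=(2i\lambda_0+k_0)e^{\sigma_0t}\cos(k_0x),$$ $$v_{\lambda_0}^-=(2i\lambda_0-k_0)e^{-\sigma_0t}\sin(k_0x),\quad v_{-\lambda_0}^-=(2i\lambda_0-k_0)e^{-\sigma_0t}\cos(k_0x).$$ The solutions $v_1,v_2,w_2,v_5,v_6,v_7$ are asymptotically equivalent, as $t\to\pm\infty$, to $m=v_{\lambda_0}^-,\ \widetilde v_0^+,\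 v_{-\lambda_0}^-,\ \widetilde v_0^-,\ v_{-\lambda_0}^+,\ v_{\lambda_0}^+$ respectively, in the following sense: there are nonzero real constants $c_+,c_-$ (depending on the solution and on $\lambda_0$) such that, with $m^*(x,t)=\overline{m(x,-t)}$ the time reversal of $m$, $$\sup_x|v(x,t)-c_+\theta_+m(x,t)|=o\big(\sup_x|m(x,t)|\big)\quad(t\to+\infty),$$ $$\sup_x|v(x,t)-c_-\theta_-m^*(x,t)|=o\big(\sup_x|m^*(x,t)|\big)\quad(t\to-\infty).$$ (d) The norms $\|v_6(\cdot,t)\|_{L^2(0,L)}$ and $\|v_7(\cdot,t)\|_{L^2(0,L)}$ are bounded above and below by positive multiples of $e^{\sigma_0|t|}$ for all large $|t|$. Consequently the breather is linearly unstable: the zero solution of the linearized NLS equation at $\hat u_0$ is not (Lyapunov) stable for $t\ge0$ in $L^2_{\rm per}(0,L)$ among smooth $L$-periodic solutions. -/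

import Mathlib

open Filter Topology
open scoped ComplexConjugate ContDiff

noncomputable section

namespace Akhmediev

/-! ### Lax system and linearized equation for the normalized NLS equation
`i u_t + (1/2) u_xx + (|u|^2 - 1) u = 0`. Functions are written `u x t`. -/

/-- The matrix `U(u, lam)` of the spatial Lax equation. -/
def laxU (u : ℝ → ℝ → ℂ) (lam : ℂ) (x t : ℝ) : Matrix (Fin 2) (Fin 2) ℂ :=
  !![lam, u x t; -conj (u x t), -lam]

/-- The matrix `V(u, lam)` of the temporal Lax equation. -/
def laxV (u : ℝ → ℝ → ℂ) (lam : ℂ) (x t : ℝ) : Matrix (Fin 2) (Fin 2) ℂ :=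
  Complex.I •
    !![lam ^ 2 + (1 / 2) * ((‖u x t‖ : ℂ) ^ 2 - 1),
        lam * u x t + (1 / 2) * deriv (fun y => u y t) x;
      -lam * conj (u x t) + (1 / 2) * conj (deriv (fun y => u y t) x),
        -lam ^ 2 - (1 / 2) * ((‖u x t‖ : ℂ) ^ 2 - 1)]

/-- `phi` solves both Lax equations `phi_x = U phi` and `phi_t = V phi`. -/
def IsLaxSolution (u : ℝ → ℝ → ℂ) (lam : ℂ) (phi : ℝ → ℝ → Fin 2 → ℂ) : Prop :=
  ∀ x t : ℝ,
    HasDerivAt (fun y => phi y t) (Matrix.mulVec (laxU u lam x t) (phi x t)) x ∧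
    HasDerivAt (fun s => phi x s) (Matrix.mulVec (laxV u lam x t) (phi x t)) t

/-- The derivative of `laxU` with respect to `lam`. -/
def laxUDeriv : Matrix (Fin 2) (Fin 2) ℂ := !![1, 0; 0, -1]

/-- The derivative of `laxV` with respect to `lam`. -/
def laxVDeriv (u : ℝ → ℝ → ℂ) (lam : ℂ) (x t : ℝ) : Matrix (Fin 2) (Fin 2) ℂ :=
  Complex.I • !![2 * lam, u x t; -conj (u x t), -(2 * lam)]

/-- `psi` is a generalized solution of the Lax system over `phi`: the Lax system differentiated
once in `lam`. The `x`-part says precisely `(L - lam) psi = phi`, where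
`L = [[d/dx, -u], [-conj u, -d/dx]]`, since `L phi = lam phi` is `phi_x = U phi`. -/
def IsGeneralizedLaxSolution (u : ℝ → ℝ → ℂ) (lam : ℂ) (phi psi : ℝ → ℝ → Fin 2 → ℂ) : Prop :=
  ∀ x t : ℝ,
    HasDerivAt (fun y => psi y t)
      (Matrix.mulVec (laxU u lam x t) (psi x t) + Matrix.mulVec laxUDeriv (phi x t)) x ∧
    HasDerivAt (fun s => psi x s)
      (Matrix.mulVec (laxV u lam x t) (psi x t) + Matrix.mulVec (laxVDeriv u lam x t) (phi x t)) t

/-- Smooth solutions of the linearized NLS equation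
`i v_t + (1/2) v_xx + (2|u|^2 - 1) v + u^2 conj v = 0`. -/
structure IsLinNLSSolution (u v : ℝ → ℝ → ℂ) : Prop where
  smooth : ContDiff ℝ ∞ (fun z : ℝ × ℝ => v z.1 z.2)
  eqn : ∀ x t : ℝ,
    Complex.I * deriv (fun s => v x s) t + (1 / 2) * iteratedDeriv 2 (fun y => v y t) x
      + (2 * (‖u x t‖ : ℂ) ^ 2 - 1) * v x t + (u x t) ^ 2 * conj (v x t) = 0

/-- `phi_1 psi_1 - conj (phi_2 psi_2)`. -/
def pairMinus (phi psi : ℝ → ℝ → Fin 2 → ℂ) (x t : ℝ) : ℂ :=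
  phi x t 0 * psi x t 0 - conj (phi x t 1) * conj (psi x t 1)

/-- `i phi_1 psi_1 + i conj (phi_2 psi_2)`. -/
def pairPlus (phi psi : ℝ → ℝ → Fin 2 → ℂ) (x t : ℝ) : ℂ :=
  Complex.I * (phi x t 0 * psi x t 0) + Complex.I * (conj (phi x t 1) * conj (psi x t 1))

/-! ### Solutions of the Lax system for the constant background `u = 1` -/

/-- `k(lam) = 2 sqrt (1 - lam^2)`. -/
def kOf (lam : ℝ) : ℝ := 2 * √(1 - lam ^ 2)

/-- `sigma(lam) = lam k(lam)`. -/
def sigmaOf (lam : ℝ) : ℝ := lam * kOf lam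

/-- The principal square root of `lam - (i/2) k(lam)`. -/
def rootMinus (lam : ℝ) : ℂ := ((lam : ℂ) - Complex.I / 2 * (kOf lam : ℂ)) ^ (1 / 2 : ℂ)

/-- The principal square root of `lam + (i/2) k(lam)`. -/
def rootPlus (lam : ℝ) : ℂ := ((lam : ℂ) + Complex.I / 2 * (kOf lam : ℂ)) ^ (1 / 2 : ℂ)

/-- `exp ((- i k x + sigma t) / 2)`. -/
def expA (lam x t : ℝ) : ℂ :=
  Complex.exp ((1 / 2) * (-Complex.I * (kOf lam : ℂ) * (x : ℂ) + (sigmaOf lam : ℂ) * (t : ℂ)))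

/-- `exp ((i k x - sigma t) / 2)`. -/
def expB (lam x t : ℝ) : ℂ :=
  Complex.exp ((1 / 2) * (Complex.I * (kOf lam : ℂ) * (x : ℂ) - (sigmaOf lam : ℂ) * (t : ℂ)))

/-- `p_+(lam)`. -/
def pPlus (lam x t : ℝ) : ℂ := rootMinus lam * expA lam x t + rootPlus lam * expB lam x t

/-- `q_+(lam)`. -/
def qPlus (lam x t : ℝ) : ℂ := -rootPlus lam * expA lam x t - rootMinus lam * expB lam x t

/-- `p_0`. -/
def p0 (lam0 x t : ℝ) : ℂ := rootMinus lam0 * expA lam0 x t - rootPlus lam0 * expB lam0 x t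

/-- `q_0`. -/
def q0 (lam0 x t : ℝ) : ℂ := -rootPlus lam0 * expA lam0 x t + rootMinus lam0 * expB lam0 x t

/-! ### The Akhmediev breather with parameter `lam0 ∈ (0, 1)` -/

/-- `cosh (sigma_0 t) - lam0 cos (k_0 x)`. -/
def den (lam0 x t : ℝ) : ℝ :=
  Real.cosh (sigmaOf lam0 * t) - lam0 * Real.cos (kOf lam0 * x)

/-- The Akhmediev breather. -/
def breather (lam0 x t : ℝ) : ℂ :=
  -1 + (2 * (1 - (lam0 : ℂ) ^ 2) * (Real.cosh (sigmaOf lam0 * t) : ℂ)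
      + Complex.I * (sigmaOf lam0 : ℂ) * (Real.sinh (sigmaOf lam0 * t) : ℂ)) / (den lam0 x t : ℂ)

/-- The spatial period `L = 2 pi / k_0`. -/
def period (lam0 : ℝ) : ℝ := 2 * Real.pi / kOf lam0

/-- The Darboux-transformed eigenvector `(hat p_0, hat q_0)`, the eigenfunction for
`lam = lam0`. -/
def eigvec0 (lam0 x t : ℝ) : Fin 2 → ℂ :=
  ((2 * (lam0 : ℂ)) / ((‖p0 lam0 x t‖ : ℂ) ^ 2 + (‖q0 lam0 x t‖ : ℂ) ^ 2)) •
    ![-conj (q0 lam0 x t), conj (p0 lam0 x t)]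

/-- The `L`-periodic eigenfunction for `lam = 1`. -/
def eigvecOne (lam0 x t : ℝ) : Fin 2 → ℂ :=
  ![1, -1] - ((p0 lam0 x t + q0 lam0 x t) / (1 - (lam0 : ℂ))) • eigvec0 lam0 x t

/-- The second (non-periodic) solution for `lam = 1`. -/
def secondOne (lam0 x t : ℝ) : Fin 2 → ℂ :=
  ![(x : ℂ) + Complex.I * t + 1, -(x : ℂ) - Complex.I * t]
    - ((((x : ℂ) + Complex.I * t) * (p0 lam0 x t + q0 lam0 x t) + q0 lam0 x t)
        / (1 - (lam0 : ℂ))) • eigvec0 lam0 x t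

/-- The complex phase `sigma_0 t - i k_0 x`. -/
def theta (lam0 x t : ℝ) : ℂ :=
  (sigmaOf lam0 : ℂ) * (t : ℂ) - Complex.I * (kOf lam0 : ℂ) * (x : ℂ)

/-- The linear function `i lam0 x + (1 - 2 lam0^2) t`. -/
def linPart (lam0 x t : ℝ) : ℂ :=
  Complex.I * (lam0 : ℂ) * (x : ℂ) + (1 - 2 * (lam0 : ℂ) ^ 2) * (t : ℂ)

/-- The generalized eigenfunction `varphi_1` for `lam = lam0`. -/
def genEigvec (lam0 x t : ℝ) : Fin 2 → ℂ :=
  (1 / (2 * Complex.I * (kOf lam0 : ℂ))) • ![pPlus lam0 x t, qPlus lam0 x t]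
    + (2 / (kOf lam0 : ℂ) ^ 2 * (Complex.cosh (theta lam0 x t) - (lam0 : ℂ))) •
      eigvec0 lam0 x t

/-- The second (non-periodic) solution `phi_0` for `lam = lam0`. -/
def secondZero (lam0 x t : ℝ) : Fin 2 → ℂ :=
  ![p0 lam0 x t, q0 lam0 x t]
    + (4 * (-(lam0 : ℂ) * (x : ℂ) + Complex.I * (1 - 2 * (lam0 : ℂ) ^ 2) * (t : ℂ)
        + Complex.I / (kOf lam0 : ℂ) * Complex.sinh (theta lam0 x t))) • eigvec0 lam0 x t

/-- The generalized solution `phi_1` over `phi_0` for `lam = lam0`. -/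
def genSecond (lam0 x t : ℝ) : Fin 2 → ℂ :=
  (2 / (kOf lam0 : ℂ) * linPart lam0 x t) • ![pPlus lam0 x t, qPlus lam0 x t]
    + (Complex.I / (kOf lam0 : ℂ)) • ![pPlus lam0 x t, -qPlus lam0 x t]
    + (8 * Complex.I / (kOf lam0 : ℂ) ^ 2 * linPart lam0 x t * Complex.cosh (theta lam0 x t)
        + 8 * Complex.I * (lam0 : ℂ) / (kOf lam0 : ℂ) ^ 3 * Complex.sinh (theta lam0 x t)
        + 2 * Complex.I * (Complex.I * (x : ℂ) - 4 * (lam0 : ℂ) * (t : ℂ))) • eigvec0 lam0 x t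

/-! ### The solutions of the linearized equation at the breather -/

/-- `v_1` in closed form. -/
def v1 (lam0 x t : ℝ) : ℂ :=
  -(2 * (lam0 : ℂ) * (1 + (lam0 : ℂ)) / (1 - (lam0 : ℂ))) *
    ((Real.sin (kOf lam0 * x) : ℂ) *
      ((kOf lam0 : ℂ) * (Real.cosh (sigmaOf lam0 * t) : ℂ)
        + 2 * Complex.I * (lam0 : ℂ) * (Real.sinh (sigmaOf lam0 * t) : ℂ))
      / (den lam0 x t : ℂ) ^ 2)

/-- `v_2` in closed form. -/
def v2 (lam0 x t : ℝ) : ℂ :=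
  2 * Complex.I * (1 + (lam0 : ℂ)) / (1 - (lam0 : ℂ)) *
    (Complex.I * (kOf lam0 : ℂ) * (lam0 : ℂ) * (Real.sinh (sigmaOf lam0 * t) : ℂ)
        * (Real.cosh (sigmaOf lam0 * t) : ℂ) / (den lam0 x t : ℂ) ^ 2
      + ((1 - 2 * (lam0 : ℂ) ^ 2) * (Real.cosh (sigmaOf lam0 * t) : ℂ) ^ 2
        - (lam0 : ℂ) ^ 2 * (Real.cos (kOf lam0 * x) : ℂ) ^ 2 + 2 * (lam0 : ℂ) ^ 2)
        / (den lam0 x t : ℂ) ^ 2)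

/-- `w_2` in closed form. -/
def w2 (lam0 x t : ℝ) : ℂ :=
  (lam0 : ℂ) ^ 2 *
    ((kOf lam0 : ℂ) * (Real.sinh (sigmaOf lam0 * t) : ℂ) * (Real.cos (kOf lam0 * x) : ℂ)
      + 2 * Complex.I * (lam0 : ℂ) * (Real.cosh (sigmaOf lam0 * t) : ℂ)
        * (Real.cos (kOf lam0 * x) : ℂ)
      - 2 * Complex.I)
    / (2 * (den lam0 x t : ℂ) ^ 2)

/-- `v_3`, not periodic. -/
def v3 (lam0 : ℝ) : ℝ → ℝ → ℂ := pairMinus (eigvecOne lam0) (secondOne lam0)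

/-- `v_4`, not periodic. -/
def v4 (lam0 : ℝ) : ℝ → ℝ → ℂ := pairPlus (eigvecOne lam0) (secondOne lam0)

/-- `w_3`, not periodic. -/
def w3 (lam0 : ℝ) : ℝ → ℝ → ℂ := pairMinus (eigvec0 lam0) (secondZero lam0)

/-- `w_4`, not periodic. -/
def w4 (lam0 : ℝ) : ℝ → ℝ → ℂ := pairPlus (eigvec0 lam0) (secondZero lam0)

/-- `v_+`, not periodic. -/
def vPlus (lam0 x t : ℝ) : ℂ :=
  pairMinus (eigvec0 lam0) (genSecond lam0) x t + pairMinus (genEigvec lam0) (secondZero lam0) x t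

/-- `v_-`, not periodic. -/
def vMinus (lam0 x t : ℝ) : ℂ :=
  pairPlus (eigvec0 lam0) (genSecond lam0) x t + pairPlus (genEigvec lam0) (secondZero lam0) x t

/-- The combination of `v_3` and `w_3`. -/
def vLin (lam0 x t : ℝ) : ℂ :=
  (lam0 : ℂ) ^ 2 * ((1 - (lam0 : ℂ)) / (1 + (lam0 : ℂ))) * v3 lam0 x t - w3 lam0 x t

/-- The combination of `v_+` and `v_3`. -/
def vNewPlus (lam0 x t : ℝ) : ℂ :=
  (kOf lam0 : ℂ) ^ 2 * vPlus lam0 x t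
    - 2 * (lam0 : ℂ) * (3 - 2 * (lam0 : ℂ) ^ 2) * (1 - (lam0 : ℂ)) / (1 + (lam0 : ℂ))
      * v3 lam0 x t

/-- The combination of `v_-`, `w_4` and `v_4`. -/
def vNewMinus (lam0 x t : ℝ) : ℂ :=
  (kOf lam0 : ℂ) ^ 2 * vMinus lam0 x t
    - 2 * (1 - 4 * (lam0 : ℂ) ^ 2) / (lam0 : ℂ) * w4 lam0 x t
    - 8 * (lam0 : ℂ) ^ 2 * (1 - (lam0 : ℂ)) / (1 + (lam0 : ℂ)) * v4 lam0 x t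

/-- The six periodic solutions, in order. -/
def sixSolutions (lam0 : ℝ) : Fin 6 → ℝ → ℝ → ℂ :=
  ![v1 lam0, v2 lam0, w2 lam0, vLin lam0, vNewPlus lam0, vNewMinus lam0]

/-! ### Modes of the linearized equation at `u = 1` -/

/-- The wave number `k_m = 2 pi m / L`. -/
def waveNumber (L : ℝ) (m : ℕ) : ℝ := 2 * Real.pi * m / L

/-- `lam(k) = (1/2) sqrt (4 - k^2)`, for `0 ≤ k ≤ 2`. -/
def lamOf (k : ℝ) : ℝ := (1 / 2) * √(4 - k ^ 2)

/-- The constant mode `2i`. -/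
def modeZeroPlus (_x _t : ℝ) : ℂ := 2 * Complex.I

/-- The linearly growing mode `1 + 2it`. -/
def modeZeroMinus (_x t : ℝ) : ℂ := 1 + 2 * Complex.I * t

/-- `v_lam^+ = -(2 i lam + k) e^(lam k t) sin (k x)`. -/
def modeSinPlus (lam x t : ℝ) : ℂ :=
  -(2 * Complex.I * (lam : ℂ) + (kOf lam : ℂ)) * (Real.exp (lam * kOf lam * t) : ℂ)
    * (Real.sin (kOf lam * x) : ℂ)

/-- `v_(-lam)^+ = (2 i lam + k) e^(lam k t) cos (k x)`. -/
def modeCosPlus (lam x t : ℝ) : ℂ :=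
  (2 * Complex.I * (lam : ℂ) + (kOf lam : ℂ)) * (Real.exp (lam * kOf lam * t) : ℂ)
    * (Real.cos (kOf lam * x) : ℂ)

/-- `v_lam^- = (2 i lam - k) e^(- lam k t) sin (k x)`. -/
def modeSinMinus (lam x t : ℝ) : ℂ :=
  (2 * Complex.I * (lam : ℂ) - (kOf lam : ℂ)) * (Real.exp (-(lam * kOf lam * t)) : ℂ)
    * (Real.sin (kOf lam * x) : ℂ)

/-- `v_(-lam)^- = (2 i lam - k) e^(- lam k t) cos (k x)`. -/
def modeCosMinus (lam x t : ℝ) : ℂ :=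
  (2 * Complex.I * (lam : ℂ) - (kOf lam : ℂ)) * (Real.exp (-(lam * kOf lam * t)) : ℂ)
    * (Real.cos (kOf lam * x) : ℂ)

/-- The six modes with `m = 0, 1` for the period `L`, in the order of `sixSolutions`. -/
def sixModes (L : ℝ) : Fin 6 → ℝ → ℝ → ℂ :=
  ![modeSinMinus (lamOf (waveNumber L 1)), modeZeroPlus, modeCosMinus (lamOf (waveNumber L 1)),
    modeZeroMinus, modeCosPlus (lamOf (waveNumber L 1)), modeSinPlus (lamOf (waveNumber L 1))]

/-- The time reversal `v(x,t) ↦ conj v(x,-t)`, a symmetry of the linearized equation at `u = 1`. -/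
def timeReversal (m : ℝ → ℝ → ℂ) (x t : ℝ) : ℂ := conj (m x (-t))

/-- The limits `(sqrt (1 - lam0^2) ± i lam0)^2` of the breather as `t → ±∞`; the upper sign. -/
def phasePlus (lam0 : ℝ) : ℂ := ((√(1 - lam0 ^ 2) : ℂ) + Complex.I * (lam0 : ℂ)) ^ 2

/-- The limits `(sqrt (1 - lam0^2) ± i lam0)^2` of the breather as `t → ±∞`; the lower sign. -/
def phaseMinus (lam0 : ℝ) : ℂ := ((√(1 - lam0 ^ 2) : ℂ) - Complex.I * (lam0 : ℂ)) ^ 2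

/-- `v` is, along `l` in time, asymptotically a nonzero real multiple of the rotated mode
`θ m`: the difference is, uniformly in `x`, negligible with respect to the amplitude
`sup_y |m(y,t)|`. If `|θ| = 1`, then `m ↦ θ m` maps the solutions of the linearized equation at
`u = 1` to those of the linearized equation at the constant solution `u = θ`. -/
def AsympTo (l : Filter ℝ) (θ : ℂ) (v m : ℝ → ℝ → ℂ) : Prop :=
  ∃ c : ℝ, c ≠ 0 ∧ ∀ ε : ℝ, 0 < ε →
    ∀ᶠ t in l, ∀ x : ℝ, ‖v x t - (c : ℂ) * θ * m x t‖ ≤ ε * ⨆ y : ℝ, ‖m y t‖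

/-! ### Growth and linear instability in `L²_per(0, L)` -/

/-- The norm of `L²(0, L)`. -/
def l2Norm (L : ℝ) (f : ℝ → ℂ) : ℝ := √(∫ x in (0 : ℝ)..L, ‖f x‖ ^ 2)

/-- `L`-periodicity in `x`. -/
def PeriodicInSpace (L : ℝ) (v : ℝ → ℝ → ℂ) : Prop := ∀ x t : ℝ, v (x + L) t = v x t

/-- The `L²(0, L)` norm of `v(·,t)` is comparable to `e^(r |t|)` for large `|t|`. -/
def GrowsExponentially (L r : ℝ) (v : ℝ → ℝ → ℂ) : Prop :=
  ∃ c C T : ℝ, 0 < c ∧ 0 < C ∧ ∀ t : ℝ, T ≤ |t| →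
    c * Real.exp (r * |t|) ≤ l2Norm L (fun x => v x t) ∧
    l2Norm L (fun x => v x t) ≤ C * Real.exp (r * |t|)

/-- Linear stability of `u` with respect to `L`-periodic perturbations (in forward time): the zero
solution of the linearized equation is stable in `L²_per(0, L)`. -/
def LinearlyStable (L : ℝ) (u : ℝ → ℝ → ℂ) : Prop :=
  ∀ ε : ℝ, 0 < ε → ∃ δ : ℝ, 0 < δ ∧ ∀ v : ℝ → ℝ → ℂ,
    IsLinNLSSolution u v → PeriodicInSpace L v → l2Norm L (fun x => v x 0) < δ →
      ∀ t : ℝ, 0 ≤ t → l2Norm L (fun x => v x t) < ε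

end Akhmediev

end

open Akhmediev

noncomputable section

namespace Akhmediev

/-! ### Elementary facts on the background solutions -/

/-! The breather is the one-fold Darboux transform of the constant background `u = 1` with seed
`(p0, q0)` at the spectral parameter `lam0` (`breather_eq`). Every vector in the Lax part of the
theorem is a background vector plus a scalar times `eigvec0`, the transformed seed. For a spectral
parameter `mu ≠ lam0` that scalar is the Wronskian with the seed divided by `mu - lam0`. At `mu =
lam0` the quotient degenerates and the scalar becomes an antiderivative of a product of background
solutions. `isGeneralizedLaxSolution_darboux` states the conditions on the scalar so that it serves
both cases, and it includes the first `lam`-derivative of the system. Ordinary solutions are those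
generalized over zero.

The linearized equation is solved by squared eigenfunctions. Products of components of two Lax
solutions satisfy a closed linear system, and for a real spectral parameter `f - conj g`, with `f`
and `g` the products of the first and of the second components, solves the linearized equation. The
pairing `pairPlus` is `pairMinus` with one factor multiplied by `i`. `solvesLinNLS_of_squared`
proves this together with its derivative in `lam`; no hypothesis that `u` solves the NLS equation is
needed.

The second solutions at `lam = 1` and `lam = lam0` grow linearly in `x`, and so do their pairings.
The coefficients of `x` in these pairings are dependent over the reals, and the combinations `vLin`,
`vNewPlus`, `vNewMinus` are those in which they cancel. The closed forms `vLin_eq`, `vNewPlus_eq`,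
`vNewMinus_eq` involve `x` only through `cos (k x)` and `sin (k x)`. Periodicity, smoothness,
symmetry and asymptotics are all read off from closed forms of this kind.

In the variable `y = exp (-sigma t)` each solution is an amplitude times a quotient continuous at `y
= 0`, so its limit is uniform in `x` by compactness (`eventually_norm_sub_le`). The limit `t → -∞`
follows from the symmetry `sixSolutions_reversal`. Linear independence follows by peeling off the
growth rates `exp (sigma t)`, `t`, `1`, `exp (-sigma t)`. The two solutions of the fastest rate give
the exponential growth, and small multiples of one of them contradict stability. -/

/-- Half of the wave number, `sqrt (1 - lam^2)`. -/
def halfK (lam : ℝ) : ℝ := √(1 - lam ^ 2)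

lemma kOf_eq (lam : ℝ) : kOf lam = 2 * halfK lam := rfl

lemma sigmaOf_eq (lam : ℝ) : sigmaOf lam = 2 * lam * halfK lam := by
  rw [sigmaOf, kOf_eq]; ring

section

variable {lam : ℝ}

lemma halfK_pos (h0 : 0 < lam) (h1 : lam < 1) : 0 < halfK lam :=
  Real.sqrt_pos.2 (by nlinarith)

lemma halfK_sq (h0 : 0 < lam) (h1 : lam < 1) : halfK lam ^ 2 = 1 - lam ^ 2 :=
  Real.sq_sqrt (by nlinarith)

lemma ofReal_halfK_sq (h0 : 0 < lam) (h1 : lam < 1) :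
    (halfK lam : ℂ) ^ 2 = 1 - (lam : ℂ) ^ 2 := by
  exact_mod_cast halfK_sq h0 h1

lemma kOf_pos (h0 : 0 < lam) (h1 : lam < 1) : 0 < kOf lam :=
  mul_pos two_pos (halfK_pos h0 h1)

lemma sigmaOf_pos (h0 : 0 < lam) (h1 : lam < 1) : 0 < sigmaOf lam :=
  mul_pos h0 (kOf_pos h0 h1)

lemma rootPlus_sq (lam : ℝ) :
    rootPlus lam ^ 2 = (lam : ℂ) + Complex.I * (halfK lam : ℂ) := by
  have h := Complex.cpow_nat_inv_pow ((lam : ℂ) + Complex.I / 2 * (kOf lam : ℂ)) two_ne_zero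
  rw [rootPlus, one_div]
  push_cast at h
  rw [h, kOf_eq]; push_cast; ring

lemma rootMinus_sq (lam : ℝ) :
    rootMinus lam ^ 2 = (lam : ℂ) - Complex.I * (halfK lam : ℂ) := by
  have h := Complex.cpow_nat_inv_pow ((lam : ℂ) - Complex.I / 2 * (kOf lam : ℂ)) two_ne_zero
  rw [rootMinus, one_div]
  push_cast at h
  rw [h, kOf_eq]; push_cast; ring

/-- The radicand has real part `lam > 0`, so it avoids the branch cut, the only place where the
principal power fails to commute with conjugation. -/
lemma conj_rootPlus (h0 : 0 < lam) : conj (rootPlus lam) = rootMinus lam := by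
  have harg : ((lam : ℂ) + Complex.I / 2 * (kOf lam : ℂ)).arg ≠ Real.pi := by
    intro h
    rw [Complex.arg_eq_pi_iff] at h
    have : ((lam : ℂ) + Complex.I / 2 * (kOf lam : ℂ)).re = lam := by simp
    linarith [h.1]
  have h := Complex.cpow_conj ((lam : ℂ) + Complex.I / 2 * (kOf lam : ℂ)) (1 / 2) harg
  rw [rootPlus, rootMinus]
  have e1 : conj (1 / 2 : ℂ) = 1 / 2 := by simp [map_ofNat]
  have e2 : conj ((lam : ℂ) + Complex.I / 2 * (kOf lam : ℂ))
      = (lam : ℂ) - Complex.I / 2 * (kOf lam : ℂ) := by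
    simp [map_ofNat]; ring
  rw [e1, e2] at h
  rw [h, Complex.conj_conj]

lemma conj_rootMinus (h0 : 0 < lam) : conj (rootMinus lam) = rootPlus lam := by
  rw [← conj_rootPlus h0, Complex.conj_conj]

lemma rootPlus_mul_rootMinus (h0 : 0 < lam) (h1 : lam < 1) :
    rootPlus lam * rootMinus lam = 1 := by
  rw [← conj_rootPlus h0, Complex.mul_conj]
  norm_cast
  -- The square of the root is `lam + i sqrt (1 - lam^2)`, a point of the unit circle.
  have h2 : Complex.normSq (rootPlus lam) ^ 2 = 1 := by
    rw [← map_pow, rootPlus_sq]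
    have := halfK_sq h0 h1
    simp [Complex.normSq_apply]
    nlinarith
  have h3 := Complex.normSq_nonneg (rootPlus lam)
  nlinarith

lemma expA_eq (lam x t : ℝ) : expA lam x t = Complex.exp (theta lam x t / 2) := by
  rw [expA, theta]; congr 1; ring

lemma expB_eq (lam x t : ℝ) : expB lam x t = Complex.exp (-(theta lam x t / 2)) := by
  rw [expB, theta]; congr 1; ring

/-- Since `sigma` and `k` are real, conjugation only reverses the sign of `x`; products with
conjugates thus remain single exponentials. -/
lemma conj_theta (lam x t : ℝ) : conj (theta lam x t) = theta lam (-x) t := by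
  simp [theta]

lemma conj_expA (lam x t : ℝ) : conj (expA lam x t) = expA lam (-x) t := by
  rw [expA_eq, expA_eq, ← Complex.exp_conj, ← conj_theta]; simp [map_ofNat]

lemma conj_expB (lam x t : ℝ) : conj (expB lam x t) = expB lam (-x) t := by
  rw [expB_eq, expB_eq, ← Complex.exp_conj, ← conj_theta]; simp [map_ofNat]

lemma expA_mul_expB (lam x t : ℝ) : expA lam x t * expB lam x t = 1 := by
  rw [expA_eq, expB_eq, ← Complex.exp_add]; simp

lemma expA_sq (lam x t : ℝ) :
    expA lam x t ^ 2 = Complex.cosh (theta lam x t) + Complex.sinh (theta lam x t) := by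
  rw [expA_eq, Complex.cosh_add_sinh, ← Complex.exp_nat_mul]; congr 1; push_cast; ring

lemma expB_sq (lam x t : ℝ) :
    expB lam x t ^ 2 = Complex.cosh (theta lam x t) - Complex.sinh (theta lam x t) := by
  rw [expB_eq, Complex.cosh_sub_sinh, ← Complex.exp_nat_mul]; congr 1; push_cast; ring

/-! ### Reduction of exponentials to real hyperbolic and trigonometric functions -/

/-- `cosh (sigma t)` as a complex number. -/
def chT (lam t : ℝ) : ℂ := (Real.cosh (sigmaOf lam * t) : ℂ)

/-- `sinh (sigma t)` as a complex number. -/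
def shT (lam t : ℝ) : ℂ := (Real.sinh (sigmaOf lam * t) : ℂ)

/-- `cos (k x)` as a complex number. -/
def csX (lam x : ℝ) : ℂ := (Real.cos (kOf lam * x) : ℂ)

/-- `sin (k x)` as a complex number. -/
def snX (lam x : ℝ) : ℂ := (Real.sin (kOf lam * x) : ℂ)

@[simp] lemma conj_chT (lam t : ℝ) : conj (chT lam t) = chT lam t := Complex.conj_ofReal _

@[simp] lemma conj_shT (lam t : ℝ) : conj (shT lam t) = shT lam t := Complex.conj_ofReal _

@[simp] lemma conj_csX (lam x : ℝ) : conj (csX lam x) = csX lam x := Complex.conj_ofReal _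

@[simp] lemma conj_snX (lam x : ℝ) : conj (snX lam x) = snX lam x := Complex.conj_ofReal _

lemma shT_sq (lam t : ℝ) : shT lam t ^ 2 = chT lam t ^ 2 - 1 := by
  have h := Real.cosh_sq (sigmaOf lam * t)
  simp only [shT, chT]
  norm_cast
  linarith

lemma snX_sq (lam x : ℝ) : snX lam x ^ 2 = 1 - csX lam x ^ 2 := by
  have h := Real.sin_sq_add_cos_sq (kOf lam * x)
  simp only [snX, csX]
  norm_cast
  linarith

lemma den_eq (lam x t : ℝ) : (den lam x t : ℂ) = chT lam t - lam * csX lam x := by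
  simp [den, chT, csX]

lemma expA_mul_conj (lam x t : ℝ) : expA lam x t * conj (expA lam x t)
    = chT lam t + shT lam t := by
  rw [conj_expA, expA_eq, expA_eq, ← Complex.exp_add, chT, shT,
    Complex.ofReal_cosh, Complex.ofReal_sinh, Complex.cosh_add_sinh]
  congr 1; simp only [theta]; push_cast; ring

lemma expB_mul_conj (lam x t : ℝ) : expB lam x t * conj (expB lam x t)
    = chT lam t - shT lam t := by
  rw [conj_expB, expB_eq, expB_eq, ← Complex.exp_add, chT, shT,
    Complex.ofReal_cosh, Complex.ofReal_sinh, Complex.cosh_sub_sinh]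
  congr 1; simp only [theta]; push_cast; ring

lemma expA_mul_conj_expB (lam x t : ℝ) : expA lam x t * conj (expB lam x t)
    = csX lam x - Complex.I * snX lam x := by
  have h := Complex.exp_mul_I (-((kOf lam * x : ℝ) : ℂ))
  rw [Complex.cos_neg, Complex.sin_neg] at h
  rw [conj_expB, expA_eq, expB_eq, ← Complex.exp_add, csX, snX, Complex.ofReal_cos,
    Complex.ofReal_sin]
  trans Complex.exp (-((kOf lam * x : ℝ) : ℂ) * Complex.I)
  · congr 1; simp only [theta]; push_cast; ring
  · rw [h]; ring

lemma expB_mul_conj_expA (lam x t : ℝ) : expB lam x t * conj (expA lam x t)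
    = csX lam x + Complex.I * snX lam x := by
  have h := congrArg conj (expA_mul_conj_expB lam x t)
  simp only [map_mul, map_sub, Complex.conj_conj, conj_csX, conj_snX, Complex.conj_I] at h
  rw [mul_comm, h]; ring

lemma cosh_theta (lam x t : ℝ) : Complex.cosh (theta lam x t)
    = chT lam t * csX lam x
      - Complex.I * shT lam t * snX lam x := by
  have e : theta lam x t = ((sigmaOf lam * t : ℝ) : ℂ) - ((kOf lam * x : ℝ) : ℂ) * Complex.I := by
    rw [theta]; push_cast; ring
  rw [e, Complex.cosh_sub, Complex.cosh_mul_I, Complex.sinh_mul_I, chT, shT, csX, snX]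
  push_cast; ring

lemma sinh_theta (lam x t : ℝ) : Complex.sinh (theta lam x t)
    = shT lam t * csX lam x
      - Complex.I * chT lam t * snX lam x := by
  have e : theta lam x t = ((sigmaOf lam * t : ℝ) : ℂ) - ((kOf lam * x : ℝ) : ℂ) * Complex.I := by
    rw [theta]; push_cast; ring
  rw [e, Complex.sinh_sub, Complex.cosh_mul_I, Complex.sinh_mul_I, chT, shT, csX, snX]
  push_cast; ring

end

/-! ### The Lax system at the background `u = 1` -/

section

variable {lam : ℝ}

lemma hasDerivAt_ofReal (x : ℝ) : HasDerivAt (fun y : ℝ => (y : ℂ)) 1 x :=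
  Complex.ofRealCLM.hasDerivAt

lemma hasDerivAt_theta_fst (lam x t : ℝ) :
    HasDerivAt (fun y => theta lam y t) (-(2 * Complex.I * halfK lam)) x :=
  (((hasDerivAt_ofReal x).const_mul (Complex.I * (kOf lam : ℂ))).const_sub
    ((sigmaOf lam : ℂ) * (t : ℂ))).congr_deriv (by rw [kOf_eq]; push_cast; ring)

lemma hasDerivAt_theta_snd (lam x t : ℝ) :
    HasDerivAt (fun s => theta lam x s) (2 * lam * halfK lam) t :=
  (((hasDerivAt_ofReal t).const_mul (sigmaOf lam : ℂ)).sub_const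
    (Complex.I * (kOf lam : ℂ) * (x : ℂ))).congr_deriv (by rw [sigmaOf_eq]; push_cast; ring)

lemma hasDerivAt_expA_fst (lam x t : ℝ) :
    HasDerivAt (fun y => expA lam y t) (-(Complex.I * halfK lam) * expA lam x t) x := by
  simp only [expA_eq]
  exact ((hasDerivAt_theta_fst lam x t).div_const 2).cexp.congr_deriv (by ring)

lemma hasDerivAt_expB_fst (lam x t : ℝ) :
    HasDerivAt (fun y => expB lam y t) (Complex.I * halfK lam * expB lam x t) x := by
  simp only [expB_eq]
  exact ((hasDerivAt_theta_fst lam x t).div_const 2).fun_neg.cexp.congr_deriv (by ring)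

lemma hasDerivAt_expA_snd (lam x t : ℝ) :
    HasDerivAt (fun s => expA lam x s) (lam * halfK lam * expA lam x t) t := by
  simp only [expA_eq]
  exact ((hasDerivAt_theta_snd lam x t).div_const 2).cexp.congr_deriv (by ring)

lemma hasDerivAt_expB_snd (lam x t : ℝ) :
    HasDerivAt (fun s => expB lam x s) (-(lam * halfK lam) * expB lam x t) t := by
  simp only [expB_eq]
  exact ((hasDerivAt_theta_snd lam x t).div_const 2).fun_neg.cexp.congr_deriv (by ring)

/-- The two roots are mutually inverse, so their quotient is a square. This is the relation that
makes the pairs `(p, q)` eigenvectors of the constant-coefficient Lax matrices. -/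
lemma rootPlus_eq (h0 : 0 < lam) (h1 : lam < 1) :
    rootPlus lam = (lam + Complex.I * halfK lam) * rootMinus lam := by
  linear_combination rootPlus lam * (-rootPlus_mul_rootMinus h0 h1)
    + rootMinus lam * rootPlus_sq lam

lemma rootMinus_eq (h0 : 0 < lam) (h1 : lam < 1) :
    rootMinus lam = (lam - Complex.I * halfK lam) * rootPlus lam := by
  linear_combination rootMinus lam * (-rootPlus_mul_rootMinus h0 h1)
    + rootPlus lam * rootMinus_sq lam

lemma hasDerivAt_p0_fst (h0 : 0 < lam) (h1 : lam < 1) (x t : ℝ) :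
    HasDerivAt (fun y => p0 lam y t) (lam * p0 lam x t + q0 lam x t) x :=
  (((hasDerivAt_expA_fst lam x t).const_mul (rootMinus lam)).fun_sub
    ((hasDerivAt_expB_fst lam x t).const_mul (rootPlus lam))).congr_deriv (by
      simp only [p0, q0]
      linear_combination expA lam x t * rootPlus_eq h0 h1 - expB lam x t * rootMinus_eq h0 h1)

lemma hasDerivAt_q0_fst (h0 : 0 < lam) (h1 : lam < 1) (x t : ℝ) :
    HasDerivAt (fun y => q0 lam y t) (-p0 lam x t - lam * q0 lam x t) x :=
  (((hasDerivAt_expA_fst lam x t).const_mul (-rootPlus lam)).fun_add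
    ((hasDerivAt_expB_fst lam x t).const_mul (rootMinus lam))).congr_deriv (by
      simp only [p0, q0]
      linear_combination expA lam x t * rootMinus_eq h0 h1 - expB lam x t * rootPlus_eq h0 h1)

lemma hasDerivAt_p0_snd (h0 : 0 < lam) (h1 : lam < 1) (x t : ℝ) :
    HasDerivAt (fun s => p0 lam x s)
      (Complex.I * (lam ^ 2 * p0 lam x t + lam * q0 lam x t)) t :=
  (((hasDerivAt_expA_snd lam x t).const_mul (rootMinus lam)).fun_sub
    ((hasDerivAt_expB_snd lam x t).const_mul (rootPlus lam))).congr_deriv (by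
      simp only [p0, q0]
      linear_combination Complex.I * lam * (expA lam x t * rootPlus_eq h0 h1
        - expB lam x t * rootMinus_eq h0 h1) + lam * halfK lam * (rootMinus lam * expA lam x t
        + rootPlus lam * expB lam x t) * Complex.I_sq)

lemma hasDerivAt_q0_snd (h0 : 0 < lam) (h1 : lam < 1) (x t : ℝ) :
    HasDerivAt (fun s => q0 lam x s)
      (Complex.I * (-lam * p0 lam x t - lam ^ 2 * q0 lam x t)) t :=
  (((hasDerivAt_expA_snd lam x t).const_mul (-rootPlus lam)).fun_add
    ((hasDerivAt_expB_snd lam x t).const_mul (rootMinus lam))).congr_deriv (by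
      simp only [p0, q0]
      linear_combination Complex.I * lam * (expA lam x t * rootMinus_eq h0 h1
        - expB lam x t * rootPlus_eq h0 h1) - lam * halfK lam * (rootPlus lam * expA lam x t
        + rootMinus lam * expB lam x t) * Complex.I_sq)

lemma hasDerivAt_pPlus_fst (h0 : 0 < lam) (h1 : lam < 1) (x t : ℝ) :
    HasDerivAt (fun y => pPlus lam y t) (lam * pPlus lam x t + qPlus lam x t) x :=
  (((hasDerivAt_expA_fst lam x t).const_mul (rootMinus lam)).fun_add
    ((hasDerivAt_expB_fst lam x t).const_mul (rootPlus lam))).congr_deriv (by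
      simp only [pPlus, qPlus]
      linear_combination expA lam x t * rootPlus_eq h0 h1 + expB lam x t * rootMinus_eq h0 h1)

lemma hasDerivAt_qPlus_fst (h0 : 0 < lam) (h1 : lam < 1) (x t : ℝ) :
    HasDerivAt (fun y => qPlus lam y t) (-pPlus lam x t - lam * qPlus lam x t) x :=
  (((hasDerivAt_expA_fst lam x t).const_mul (-rootPlus lam)).fun_sub
    ((hasDerivAt_expB_fst lam x t).const_mul (rootMinus lam))).congr_deriv (by
      simp only [pPlus, qPlus]
      linear_combination expA lam x t * rootMinus_eq h0 h1 + expB lam x t * rootPlus_eq h0 h1)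

lemma hasDerivAt_pPlus_snd (h0 : 0 < lam) (h1 : lam < 1) (x t : ℝ) :
    HasDerivAt (fun s => pPlus lam x s)
      (Complex.I * (lam ^ 2 * pPlus lam x t + lam * qPlus lam x t)) t :=
  (((hasDerivAt_expA_snd lam x t).const_mul (rootMinus lam)).fun_add
    ((hasDerivAt_expB_snd lam x t).const_mul (rootPlus lam))).congr_deriv (by
      simp only [pPlus, qPlus]
      linear_combination Complex.I * lam * (expA lam x t * rootPlus_eq h0 h1
        + expB lam x t * rootMinus_eq h0 h1) + lam * halfK lam * (rootMinus lam * expA lam x t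
        - rootPlus lam * expB lam x t) * Complex.I_sq)

lemma hasDerivAt_qPlus_snd (h0 : 0 < lam) (h1 : lam < 1) (x t : ℝ) :
    HasDerivAt (fun s => qPlus lam x s)
      (Complex.I * (-lam * pPlus lam x t - lam ^ 2 * qPlus lam x t)) t :=
  (((hasDerivAt_expA_snd lam x t).const_mul (-rootPlus lam)).fun_sub
    ((hasDerivAt_expB_snd lam x t).const_mul (rootMinus lam))).congr_deriv (by
      simp only [pPlus, qPlus]
      linear_combination Complex.I * lam * (expA lam x t * rootMinus_eq h0 h1
        + expB lam x t * rootPlus_eq h0 h1) - lam * halfK lam * (rootPlus lam * expA lam x t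
        - rootMinus lam * expB lam x t) * Complex.I_sq)

/-! ### Products of the background solutions -/

lemma conj_p0 (h0 : 0 < lam) (x t : ℝ) : conj (p0 lam x t)
    = rootPlus lam * conj (expA lam x t) - rootMinus lam * conj (expB lam x t) := by
  simp only [p0, map_sub, map_mul, conj_rootPlus h0, conj_rootMinus h0]

lemma conj_q0 (h0 : 0 < lam) (x t : ℝ) : conj (q0 lam x t)
    = -rootMinus lam * conj (expA lam x t) + rootPlus lam * conj (expB lam x t) := by
  simp only [q0, map_add, map_mul, map_neg, conj_rootPlus h0, conj_rootMinus h0]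

lemma conj_qPlus (h0 : 0 < lam) (x t : ℝ) : conj (qPlus lam x t)
    = -rootMinus lam * conj (expA lam x t) - rootPlus lam * conj (expB lam x t) := by
  simp only [qPlus, map_sub, map_mul, map_neg, conj_rootPlus h0, conj_rootMinus h0]

/-- In the products with a conjugate, four exponential monomials occur. Their coefficients are
squares of roots, that is `lam ± i halfK`, or the product of the two roots, which is `1`. -/
lemma p0_mul_conj_q0 (h0 : 0 < lam) (h1 : lam < 1) (x t : ℝ) :
    p0 lam x t * conj (q0 lam x t)
      = 2 * (csX lam x - (lam * chT lam t - Complex.I * halfK lam * shT lam t)) := by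
  rw [conj_q0 h0, p0]
  linear_combination -rootMinus lam ^ 2 * expA_mul_conj lam x t
    - rootPlus lam ^ 2 * expB_mul_conj lam x t + rootPlus lam * rootMinus lam *
      (expA_mul_conj_expB lam x t + expB_mul_conj_expA lam x t)
    - (chT lam t + shT lam t) * rootMinus_sq lam - (chT lam t - shT lam t) * rootPlus_sq lam
    + 2 * csX lam x * rootPlus_mul_rootMinus h0 h1

lemma p0_mul_conj_p0 (h0 : 0 < lam) (h1 : lam < 1) (x t : ℝ) :
    p0 lam x t * conj (p0 lam x t)
      = 2 * (chT lam t - lam * csX lam x + halfK lam * snX lam x) := by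
  rw [conj_p0 h0, p0]
  linear_combination rootPlus lam * rootMinus lam * (expA_mul_conj lam x t
    + expB_mul_conj lam x t) - rootMinus lam ^ 2 * expA_mul_conj_expB lam x t
    - rootPlus lam ^ 2 * expB_mul_conj_expA lam x t
    - (csX lam x - Complex.I * snX lam x) * rootMinus_sq lam
    - (csX lam x + Complex.I * snX lam x) * rootPlus_sq lam
    + 2 * chT lam t * rootPlus_mul_rootMinus h0 h1
    - 2 * halfK lam * snX lam x * Complex.I_sq

lemma q0_mul_conj_q0 (h0 : 0 < lam) (h1 : lam < 1) (x t : ℝ) :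
    q0 lam x t * conj (q0 lam x t)
      = 2 * (chT lam t - lam * csX lam x - halfK lam * snX lam x) := by
  rw [conj_q0 h0, q0]
  linear_combination rootPlus lam * rootMinus lam * (expA_mul_conj lam x t
    + expB_mul_conj lam x t) - rootPlus lam ^ 2 * expA_mul_conj_expB lam x t
    - rootMinus lam ^ 2 * expB_mul_conj_expA lam x t
    - (csX lam x - Complex.I * snX lam x) * rootPlus_sq lam
    - (csX lam x + Complex.I * snX lam x) * rootMinus_sq lam
    + 2 * chT lam t * rootPlus_mul_rootMinus h0 h1
    + 2 * halfK lam * snX lam x * Complex.I_sq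

/-- The products without conjugates depend on the complex phase alone. They are the integrands whose
antiderivatives appear as coefficients of `eigvec0` at `mu = lam`. -/
lemma p0_sq (h0 : 0 < lam) (h1 : lam < 1) (x t : ℝ) :
    p0 lam x t ^ 2 = 2 * (lam * Complex.cosh (theta lam x t)
      - Complex.I * halfK lam * Complex.sinh (theta lam x t) - 1) := by
  rw [p0]
  linear_combination rootMinus lam ^ 2 * expA_sq lam x t + rootPlus lam ^ 2 * expB_sq lam x t
    - 2 * rootPlus lam * rootMinus lam * expA_mul_expB lam x t
    + (Complex.cosh (theta lam x t) + Complex.sinh (theta lam x t)) * rootMinus_sq lam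
    + (Complex.cosh (theta lam x t) - Complex.sinh (theta lam x t)) * rootPlus_sq lam
    - 2 * rootPlus_mul_rootMinus h0 h1

lemma q0_sq (h0 : 0 < lam) (h1 : lam < 1) (x t : ℝ) :
    q0 lam x t ^ 2 = 2 * (lam * Complex.cosh (theta lam x t)
      + Complex.I * halfK lam * Complex.sinh (theta lam x t) - 1) := by
  rw [q0]
  linear_combination rootPlus lam ^ 2 * expA_sq lam x t + rootMinus lam ^ 2 * expB_sq lam x t
    - 2 * rootPlus lam * rootMinus lam * expA_mul_expB lam x t
    + (Complex.cosh (theta lam x t) + Complex.sinh (theta lam x t)) * rootPlus_sq lam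
    + (Complex.cosh (theta lam x t) - Complex.sinh (theta lam x t)) * rootMinus_sq lam
    - 2 * rootPlus_mul_rootMinus h0 h1

lemma p0_mul_q0 (h0 : 0 < lam) (h1 : lam < 1) (x t : ℝ) :
    p0 lam x t * q0 lam x t = 2 * (lam - Complex.cosh (theta lam x t)) := by
  rw [p0, q0]
  linear_combination (-rootPlus lam * rootMinus lam) * (expA_sq lam x t + expB_sq lam x t)
    + (rootPlus lam ^ 2 + rootMinus lam ^ 2) * expA_mul_expB lam x t
    + rootPlus_sq lam + rootMinus_sq lam
    - 2 * Complex.cosh (theta lam x t) * rootPlus_mul_rootMinus h0 h1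

lemma pPlus_mul_conj_q0 (h0 : 0 < lam) (h1 : lam < 1) (x t : ℝ) :
    pPlus lam x t * conj (q0 lam x t)
      = 2 * (Complex.I * halfK lam * chT lam t - lam * shT lam t - Complex.I * snX lam x) := by
  rw [conj_q0 h0, pPlus]
  linear_combination -rootMinus lam ^ 2 * expA_mul_conj lam x t
    + rootPlus lam ^ 2 * expB_mul_conj lam x t + rootPlus lam * rootMinus lam *
      (expA_mul_conj_expB lam x t - expB_mul_conj_expA lam x t)
    - (chT lam t + shT lam t) * rootMinus_sq lam + (chT lam t - shT lam t) * rootPlus_sq lam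
    - 2 * Complex.I * snX lam x * rootPlus_mul_rootMinus h0 h1

lemma conj_qPlus_mul_p0 (h0 : 0 < lam) (h1 : lam < 1) (x t : ℝ) :
    conj (qPlus lam x t) * p0 lam x t
      = 2 * (Complex.I * halfK lam * chT lam t - lam * shT lam t + Complex.I * snX lam x) := by
  rw [conj_qPlus h0, p0]
  linear_combination -rootMinus lam ^ 2 * expA_mul_conj lam x t
    + rootPlus lam ^ 2 * expB_mul_conj lam x t - rootPlus lam * rootMinus lam *
      (expA_mul_conj_expB lam x t - expB_mul_conj_expA lam x t)
    - (chT lam t + shT lam t) * rootMinus_sq lam + (chT lam t - shT lam t) * rootPlus_sq lam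
    + 2 * Complex.I * snX lam x * rootPlus_mul_rootMinus h0 h1

lemma pPlus_mul_p0 (lam x t : ℝ) :
    pPlus lam x t * p0 lam x t = 2 * (lam * Complex.sinh (theta lam x t)
      - Complex.I * halfK lam * Complex.cosh (theta lam x t)) := by
  rw [pPlus, p0]
  linear_combination rootMinus lam ^ 2 * expA_sq lam x t - rootPlus lam ^ 2 * expB_sq lam x t
    + (Complex.cosh (theta lam x t) + Complex.sinh (theta lam x t)) * rootMinus_sq lam
    - (Complex.cosh (theta lam x t) - Complex.sinh (theta lam x t)) * rootPlus_sq lam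

lemma qPlus_mul_q0 (lam x t : ℝ) :
    qPlus lam x t * q0 lam x t = 2 * (lam * Complex.sinh (theta lam x t)
      + Complex.I * halfK lam * Complex.cosh (theta lam x t)) := by
  rw [qPlus, q0]
  linear_combination rootPlus lam ^ 2 * expA_sq lam x t - rootMinus lam ^ 2 * expB_sq lam x t
    + (Complex.cosh (theta lam x t) + Complex.sinh (theta lam x t)) * rootPlus_sq lam
    - (Complex.cosh (theta lam x t) - Complex.sinh (theta lam x t)) * rootMinus_sq lam

lemma pPlus_mul_q0 (h0 : 0 < lam) (h1 : lam < 1) (x t : ℝ) :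
    pPlus lam x t * q0 lam x t
      = -2 * (Complex.sinh (theta lam x t) + Complex.I * halfK lam) := by
  rw [pPlus, q0]
  linear_combination (-rootPlus lam * rootMinus lam) * (expA_sq lam x t - expB_sq lam x t)
    + (rootMinus lam ^ 2 - rootPlus lam ^ 2) * expA_mul_expB lam x t
    - rootPlus_sq lam + rootMinus_sq lam
    - 2 * Complex.sinh (theta lam x t) * rootPlus_mul_rootMinus h0 h1

lemma qPlus_mul_p0 (h0 : 0 < lam) (h1 : lam < 1) (x t : ℝ) :
    qPlus lam x t * p0 lam x t
      = -2 * (Complex.sinh (theta lam x t) - Complex.I * halfK lam) := by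
  rw [qPlus, p0]
  linear_combination (-rootPlus lam * rootMinus lam) * (expA_sq lam x t - expB_sq lam x t)
    - (rootMinus lam ^ 2 - rootPlus lam ^ 2) * expA_mul_expB lam x t
    + rootPlus_sq lam - rootMinus_sq lam
    - 2 * Complex.sinh (theta lam x t) * rootPlus_mul_rootMinus h0 h1

end

/-! ### The Darboux transformation -/

section

variable {lam : ℝ}

lemma den_pos (h0 : 0 < lam) (h1 : lam < 1) (x t : ℝ) : 0 < den lam x t := by
  have h2 := Real.one_le_cosh (sigmaOf lam * t)
  have h3 := Real.cos_le_one (kOf lam * x)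
  rw [den]
  nlinarith

lemma den_ne_zero (h0 : 0 < lam) (h1 : lam < 1) (x t : ℝ) : (den lam x t : ℂ) ≠ 0 :=
  Complex.ofReal_ne_zero.2 (den_pos h0 h1 x t).ne'

/-- The squared length `|p_0|^2 + |q_0|^2`. -/
def sqLen (lam x t : ℝ) : ℂ :=
  p0 lam x t * conj (p0 lam x t) + q0 lam x t * conj (q0 lam x t)

lemma sqLen_eq (h0 : 0 < lam) (h1 : lam < 1) (x t : ℝ) :
    sqLen lam x t = 4 * (den lam x t : ℂ) := by
  rw [sqLen, p0_mul_conj_p0 h0 h1, q0_mul_conj_q0 h0 h1, den_eq]; ring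

lemma sqLen_ne_zero (h0 : 0 < lam) (h1 : lam < 1) (x t : ℝ) : sqLen lam x t ≠ 0 := by
  rw [sqLen_eq h0 h1]
  exact mul_ne_zero (by norm_num) (den_ne_zero h0 h1 x t)

lemma eigvec0_eq_sqLen (lam x t : ℝ) :
    eigvec0 lam x t = (2 * lam / sqLen lam x t) • ![-conj (q0 lam x t), conj (p0 lam x t)] := by
  rw [eigvec0, sqLen, Complex.mul_conj', Complex.mul_conj']

/-- This is the Darboux formula. It makes the breather rational in `p0`, `q0` and their conjugates,
so that every Lax identity below becomes polynomial algebra. -/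
lemma breather_eq (h0 : 0 < lam) (h1 : lam < 1) (x t : ℝ) :
    breather lam x t = 1 + 4 * lam * (p0 lam x t * conj (q0 lam x t)) / sqLen lam x t := by
  have hD := den_ne_zero h0 h1 x t
  have hd := den_eq lam x t
  have hs := ofReal_halfK_sq h0 h1
  rw [p0_mul_conj_q0 h0 h1, sqLen_eq h0 h1, breather,
    show (sigmaOf lam : ℂ) = 2 * lam * halfK lam by rw [sigmaOf_eq]; push_cast; rfl,
    show (Real.cosh (sigmaOf lam * t) : ℂ) = chT lam t from rfl,
    show (Real.sinh (sigmaOf lam * t) : ℂ) = shT lam t from rfl]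
  field_simp
  rw [hd]
  ring

lemma conj_breather_eq (h0 : 0 < lam) (h1 : lam < 1) (x t : ℝ) :
    conj (breather lam x t)
      = 1 + 4 * lam * (conj (p0 lam x t) * q0 lam x t) / sqLen lam x t := by
  have hn : conj (sqLen lam x t) = sqLen lam x t := by
    rw [sqLen_eq h0 h1]; simp [map_ofNat]
  rw [breather_eq h0 h1]
  simp [map_ofNat, hn]

lemma hasDerivAt_sqLen_fst (h0 : 0 < lam) (h1 : lam < 1) (x t : ℝ) :
    HasDerivAt (fun y => sqLen lam y t)
      (2 * lam * (p0 lam x t * conj (p0 lam x t) - q0 lam x t * conj (q0 lam x t))) x := by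
  have hp := hasDerivAt_p0_fst h0 h1 x t
  have hq := hasDerivAt_q0_fst h0 h1 x t
  exact ((hp.mul hp.star).fun_add (hq.mul hq.star)).congr_deriv (by
    simp only [RCLike.star_def, map_add, map_sub, map_mul, map_neg, Complex.conj_ofReal]
    ring)

lemma hasDerivAt_sqLen_snd (h0 : 0 < lam) (h1 : lam < 1) (x t : ℝ) :
    HasDerivAt (fun s => sqLen lam x s)
      (2 * Complex.I * lam *
        (q0 lam x t * conj (p0 lam x t) - p0 lam x t * conj (q0 lam x t))) t := by
  have hp := hasDerivAt_p0_snd h0 h1 x t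
  have hq := hasDerivAt_q0_snd h0 h1 x t
  exact ((hp.mul hp.star).fun_add (hq.mul hq.star)).congr_deriv (by
    simp only [RCLike.star_def, map_add, map_sub, map_mul, map_neg, map_pow, Complex.conj_ofReal,
      Complex.conj_I]
    ring)

/-- The `x`-derivative of the breather. -/
def breatherX (lam x t : ℝ) : ℂ :=
  4 * lam * (((lam * p0 lam x t + q0 lam x t) * conj (q0 lam x t)
      + p0 lam x t * (-conj (p0 lam x t) - lam * conj (q0 lam x t))) / sqLen lam x t
    - p0 lam x t * conj (q0 lam x t) * (2 * lam * (p0 lam x t * conj (p0 lam x t)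
      - q0 lam x t * conj (q0 lam x t))) / sqLen lam x t ^ 2)

lemma hasDerivAt_breather_fst (h0 : 0 < lam) (h1 : lam < 1) (x t : ℝ) :
    HasDerivAt (fun y => breather lam y t) (breatherX lam x t) x := by
  have hp := hasDerivAt_p0_fst h0 h1 x t
  have hq := hasDerivAt_q0_fst h0 h1 x t
  have hN := hasDerivAt_sqLen_fst h0 h1 x t
  have hne := sqLen_ne_zero h0 h1 x t
  simp only [breather_eq h0 h1]
  exact ((((hp.fun_mul hq.star).const_mul (4 * lam : ℂ)).fun_div hN
    hne).const_add 1).congr_deriv (by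
    simp only [RCLike.star_def, map_sub, map_mul, map_neg, Complex.conj_ofReal, breatherX]
    field_simp)

lemma eigvec0_zero (lam x t : ℝ) :
    eigvec0 lam x t 0 = -(2 * lam * conj (q0 lam x t)) / sqLen lam x t := by
  rw [eigvec0_eq_sqLen]; simp; ring

lemma eigvec0_one (lam x t : ℝ) :
    eigvec0 lam x t 1 = 2 * lam * conj (p0 lam x t) / sqLen lam x t := by
  rw [eigvec0_eq_sqLen]; simp; ring

/-! ### The Lax system in components and the transformation of solutions -/

lemma isLaxSolution_iff (u : ℝ → ℝ → ℂ) (mu : ℂ) (phi : ℝ → ℝ → Fin 2 → ℂ) :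
    IsLaxSolution u mu phi ↔ IsGeneralizedLaxSolution u mu (fun _ _ => 0) phi := by
  simp [IsLaxSolution, IsGeneralizedLaxSolution]

lemma hasDerivAt_fin_two {f : ℝ → Fin 2 → ℂ} {f' : Fin 2 → ℂ} {x : ℝ}
    (h : HasDerivAt (fun y => f y 0) (f' 0) x) (h' : HasDerivAt (fun y => f y 1) (f' 1) x) :
    HasDerivAt f f' x :=
  hasDerivAt_pi.2 (Fin.forall_fin_two.2 ⟨h, h'⟩)

/-- Components of the generalized Lax system. -/
lemma isGeneralizedLaxSolution_of_components {u ux : ℝ → ℝ → ℂ} {mu : ℂ}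
    {phi psi : ℝ → ℝ → Fin 2 → ℂ}
    (hu : ∀ x t, HasDerivAt (fun y => u y t) (ux x t) x)
    (hx0 : ∀ x t, HasDerivAt (fun y => psi y t 0)
      (mu * psi x t 0 + u x t * psi x t 1 + phi x t 0) x)
    (hx1 : ∀ x t, HasDerivAt (fun y => psi y t 1)
      (-conj (u x t) * psi x t 0 - mu * psi x t 1 - phi x t 1) x)
    (ht0 : ∀ x t, HasDerivAt (fun s => psi x s 0)
      (Complex.I * ((mu ^ 2 + 1 / 2 * (u x t * conj (u x t) - 1)) * psi x t 0
        + (mu * u x t + 1 / 2 * ux x t) * psi x t 1 + 2 * mu * phi x t 0 + u x t * phi x t 1)) t)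
    (ht1 : ∀ x t, HasDerivAt (fun s => psi x s 1)
      (Complex.I * ((-mu * conj (u x t) + 1 / 2 * conj (ux x t)) * psi x t 0
        + (-mu ^ 2 - 1 / 2 * (u x t * conj (u x t) - 1)) * psi x t 1
        - conj (u x t) * phi x t 0 - 2 * mu * phi x t 1)) t) :
    IsGeneralizedLaxSolution u mu phi psi := by
  intro x t
  refine ⟨hasDerivAt_fin_two ((hx0 x t).congr_deriv ?_) ((hx1 x t).congr_deriv ?_),
    hasDerivAt_fin_two ((ht0 x t).congr_deriv ?_) ((ht1 x t).congr_deriv ?_)⟩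
  · simp [laxU, laxUDeriv, dotProduct]
  · simp [laxU, laxUDeriv, dotProduct]; ring
  · simp [laxV, laxVDeriv, dotProduct, (hu x t).deriv, Complex.mul_conj']; ring
  · simp [laxV, laxVDeriv, dotProduct, (hu x t).deriv, Complex.mul_conj']; ring

/-- The vector orthogonal to the seed, divided by the squared length of the seed, solves the
transformed system at the same spectral parameter. With the derivatives of the seed known this is a
rational identity. -/
lemma hasDerivAt_eigvec0_zero_fst (h0 : 0 < lam) (h1 : lam < 1) (x t : ℝ) :
    HasDerivAt (fun y => eigvec0 lam y t 0)
      (lam * eigvec0 lam x t 0 + breather lam x t * eigvec0 lam x t 1) x := by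
  have hq := hasDerivAt_q0_fst h0 h1 x t
  have hN := hasDerivAt_sqLen_fst h0 h1 x t
  have hne := sqLen_ne_zero h0 h1 x t
  rw [eigvec0_zero, eigvec0_one, breather_eq h0 h1]
  simp only [eigvec0_zero]
  exact ((hq.star.const_mul (2 * lam : ℂ)).fun_neg.fun_div hN hne).congr_deriv (by
    simp only [RCLike.star_def, map_sub, map_mul, map_neg, Complex.conj_ofReal]
    field_simp
    -- The squared length stays an atom while denominators are cleared and is expanded only now,
    -- since the identity depends on its value.
    rw [sqLen]
    ring)

lemma hasDerivAt_eigvec0_one_fst (h0 : 0 < lam) (h1 : lam < 1) (x t : ℝ) :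
    HasDerivAt (fun y => eigvec0 lam y t 1)
      (-conj (breather lam x t) * eigvec0 lam x t 0 - lam * eigvec0 lam x t 1) x := by
  have hp := hasDerivAt_p0_fst h0 h1 x t
  have hN := hasDerivAt_sqLen_fst h0 h1 x t
  have hne := sqLen_ne_zero h0 h1 x t
  rw [eigvec0_zero, eigvec0_one, conj_breather_eq h0 h1]
  simp only [eigvec0_one]
  exact ((hp.star.const_mul (2 * lam : ℂ)).fun_div hN hne).congr_deriv (by
    simp only [RCLike.star_def, map_add, map_mul, Complex.conj_ofReal]
    field_simp
    rw [sqLen]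
    ring)

lemma conj_breatherX (h0 : 0 < lam) (h1 : lam < 1) (x t : ℝ) :
    conj (breatherX lam x t) =
  4 * lam * (((lam * conj (p0 lam x t) + conj (q0 lam x t)) * q0 lam x t
      + conj (p0 lam x t) * (-p0 lam x t - lam * q0 lam x t)) / sqLen lam x t
    - conj (p0 lam x t) * q0 lam x t * (2 * lam * (p0 lam x t * conj (p0 lam x t)
      - q0 lam x t * conj (q0 lam x t))) / sqLen lam x t ^ 2) := by
  have hn : conj (sqLen lam x t) = sqLen lam x t := by
    rw [sqLen_eq h0 h1]; simp [map_ofNat]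
  simp only [breatherX, map_mul, map_sub, map_add, map_div₀, map_neg, map_pow, map_ofNat,
    Complex.conj_ofReal, Complex.conj_conj, hn]
  ring

lemma hasDerivAt_eigvec0_zero_snd (h0 : 0 < lam) (h1 : lam < 1) (x t : ℝ) :
    HasDerivAt (fun s => eigvec0 lam x s 0)
      (Complex.I * ((lam ^ 2 + 1 / 2 * (breather lam x t * conj (breather lam x t) - 1))
        * eigvec0 lam x t 0
        + (lam * breather lam x t + 1 / 2 * breatherX lam x t) * eigvec0 lam x t 1)) t := by
  have hq := hasDerivAt_q0_snd h0 h1 x t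
  have hN := hasDerivAt_sqLen_snd h0 h1 x t
  have hne := sqLen_ne_zero h0 h1 x t
  rw [eigvec0_zero, eigvec0_one, conj_breather_eq h0 h1, breather_eq h0 h1, breatherX]
  simp only [eigvec0_zero]
  exact ((hq.star.const_mul (2 * lam : ℂ)).fun_neg.fun_div hN hne).congr_deriv (by
    simp only [RCLike.star_def, map_sub, map_mul, map_neg, map_pow, Complex.conj_ofReal,
      Complex.conj_I]
    field_simp
    rw [sqLen]
    ring)

lemma hasDerivAt_eigvec0_one_snd (h0 : 0 < lam) (h1 : lam < 1) (x t : ℝ) :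
    HasDerivAt (fun s => eigvec0 lam x s 1)
      (Complex.I * ((-lam * conj (breather lam x t) + 1 / 2 * conj (breatherX lam x t))
        * eigvec0 lam x t 0
        + (-lam ^ 2 - 1 / 2 * (breather lam x t * conj (breather lam x t) - 1))
          * eigvec0 lam x t 1)) t := by
  have hp := hasDerivAt_p0_snd h0 h1 x t
  have hN := hasDerivAt_sqLen_snd h0 h1 x t
  have hne := sqLen_ne_zero h0 h1 x t
  rw [eigvec0_zero, eigvec0_one, conj_breather_eq h0 h1, breather_eq h0 h1, conj_breatherX h0 h1]
  simp only [eigvec0_one]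
  exact ((hp.star.const_mul (2 * lam : ℂ)).fun_div hN hne).congr_deriv (by
    simp only [RCLike.star_def, map_add, map_mul, map_pow, Complex.conj_ofReal,
      Complex.conj_I]
    field_simp
    rw [sqLen]
    ring)

/-- The Darboux transformation of solutions and generalized solutions at the background `u = 1`.
The scalar functions `S0` and `S1` are the Wronskians with `(p_0, q_0)`, divided by `mu - lam`. -/
lemma isGeneralizedLaxSolution_darboux (h0 : 0 < lam) (h1 : lam < 1) {mu : ℂ}
    {f1 f2 g1 g2 S0 S1 : ℝ → ℝ → ℂ} {phi psi : ℝ → ℝ → Fin 2 → ℂ}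
    (hphi0 : ∀ x t, phi x t 0 = f1 x t + S0 x t * eigvec0 lam x t 0)
    (hphi1 : ∀ x t, phi x t 1 = f2 x t + S0 x t * eigvec0 lam x t 1)
    (hpsi0 : ∀ x t, psi x t 0 = g1 x t + S1 x t * eigvec0 lam x t 0)
    (hpsi1 : ∀ x t, psi x t 1 = g2 x t + S1 x t * eigvec0 lam x t 1)
    (hg1x : ∀ x t, HasDerivAt (fun y => g1 y t) (mu * g1 x t + g2 x t + f1 x t) x)
    (hg2x : ∀ x t, HasDerivAt (fun y => g2 y t) (-g1 x t - mu * g2 x t - f2 x t) x)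
    (hg1t : ∀ x t, HasDerivAt (fun s => g1 x s)
      (Complex.I * (mu ^ 2 * g1 x t + mu * g2 x t + 2 * mu * f1 x t + f2 x t)) t)
    (hg2t : ∀ x t, HasDerivAt (fun s => g2 x s)
      (Complex.I * (-mu * g1 x t - mu ^ 2 * g2 x t - f1 x t - 2 * mu * f2 x t)) t)
    (hSx : ∀ x t, HasDerivAt (fun y => S1 y t)
      (-(p0 lam x t * g2 x t + q0 lam x t * g1 x t)) x)
    (hSt : ∀ x t, HasDerivAt (fun s => S1 x s)
      (-Complex.I * ((lam + mu) * (p0 lam x t * g2 x t + q0 lam x t * g1 x t)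
        + (q0 lam x t * g2 x t + p0 lam x t * g1 x t)
        + (p0 lam x t * f2 x t + q0 lam x t * f1 x t))) t)
    (hW0 : ∀ x t, p0 lam x t * f2 x t - q0 lam x t * f1 x t = (mu - lam) * S0 x t)
    (hW1 : ∀ x t, p0 lam x t * g2 x t - q0 lam x t * g1 x t = S0 x t + (mu - lam) * S1 x t) :
    IsGeneralizedLaxSolution (breather lam) mu phi psi := by
  -- Solving the second Wronskian relation for `S0` eliminates this function, so no derivative of it
  -- is ever needed.
  have hS0 : ∀ x t, S0 x t
      = p0 lam x t * g2 x t - q0 lam x t * g1 x t - (mu - lam) * S1 x t := fun x t => by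
    rw [hW1]; ring
  apply isGeneralizedLaxSolution_of_components (hasDerivAt_breather_fst h0 h1)
  · intro x t
    have hne := sqLen_ne_zero h0 h1 x t
    simp only [hphi0, hpsi0, hpsi1]
    refine ((hg1x x t).fun_add
      ((hSx x t).fun_mul (hasDerivAt_eigvec0_zero_fst h0 h1 x t))).congr_deriv ?_
    rw [hS0, eigvec0_zero, eigvec0_one, breather_eq h0 h1]
    field_simp
    ring
  · intro x t
    have hne := sqLen_ne_zero h0 h1 x t
    simp only [hphi1, hpsi0, hpsi1]
    refine ((hg2x x t).fun_add
      ((hSx x t).fun_mul (hasDerivAt_eigvec0_one_fst h0 h1 x t))).congr_deriv ?_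
    rw [hS0, eigvec0_zero, eigvec0_one, conj_breather_eq h0 h1]
    field_simp
    ring
  · intro x t
    have hne := sqLen_ne_zero h0 h1 x t
    simp only [hphi0, hphi1, hpsi0, hpsi1]
    refine ((hg1t x t).fun_add
      ((hSt x t).fun_mul (hasDerivAt_eigvec0_zero_snd h0 h1 x t))).congr_deriv ?_
    have hW := hW0 x t
    rw [hS0] at hW
    rw [← sub_eq_zero] at hW ⊢
    -- The two sides differ by a multiple of the residual of the first Wronskian relation, with `S0`
    -- eliminated. The time equations are the only place where that relation enters.
    trans Complex.I * eigvec0 lam x t 0 * (p0 lam x t * f2 x t - q0 lam x t * f1 x t -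
      (mu - lam) * (p0 lam x t * g2 x t - q0 lam x t * g1 x t - (mu - lam) * S1 x t))
    · rw [hS0, eigvec0_zero, eigvec0_one, conj_breather_eq h0 h1, breather_eq h0 h1, breatherX]
      field_simp
      rw [sqLen]
      ring
    · rw [hW, mul_zero]
  · intro x t
    have hne := sqLen_ne_zero h0 h1 x t
    simp only [hphi0, hphi1, hpsi0, hpsi1]
    refine ((hg2t x t).fun_add
      ((hSt x t).fun_mul (hasDerivAt_eigvec0_one_snd h0 h1 x t))).congr_deriv ?_
    have hW := hW0 x t
    rw [hS0] at hW
    rw [← sub_eq_zero] at hW ⊢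
    trans -Complex.I * eigvec0 lam x t 1 * (p0 lam x t * f2 x t - q0 lam x t * f1 x t -
      (mu - lam) * (p0 lam x t * g2 x t - q0 lam x t * g1 x t - (mu - lam) * S1 x t))
    · rw [hS0, eigvec0_zero, eigvec0_one, conj_breather_eq h0 h1, breather_eq h0 h1,
        conj_breatherX h0 h1]
      field_simp
      rw [sqLen]
      ring
    · rw [hW, mul_zero]

end

/-! ### The solutions of the Lax system at the breather -/

section

variable {lam : ℝ}

/-- The degenerate case: zero background vector, and a scalar that is constant because both
Wronskian relations hold trivially at `mu = lam`. -/
lemma isLaxSolution_eigvec0 (h0 : 0 < lam) (h1 : lam < 1) :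
    IsLaxSolution (breather lam) lam (eigvec0 lam) := by
  rw [isLaxSolution_iff]
  refine isGeneralizedLaxSolution_darboux h0 h1 (f1 := 0) (f2 := 0) (g1 := 0) (g2 := 0)
    (S0 := 0) (S1 := 1) ?_ ?_ ?_ ?_ ?_ ?_ ?_ ?_ ?_ ?_ ?_ ?_ <;> intro x t <;>
  simp [hasDerivAt_const]

lemma one_sub_ne_zero (h1 : lam < 1) : (1 - (lam : ℂ)) ≠ 0 := by
  rw [← Complex.ofReal_one, ← Complex.ofReal_sub, Complex.ofReal_ne_zero]
  linarith

/-- At `mu = 1` the background matrices are nilpotent and `(1, -1)` spans their kernel. Its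
Wronskian with the seed is `-(p0 + q0)`. -/
lemma isLaxSolution_eigvecOne (h0 : 0 < lam) (h1 : lam < 1) :
    IsLaxSolution (breather lam) 1 (eigvecOne lam) := by
  have hl := one_sub_ne_zero h1
  rw [isLaxSolution_iff]
  refine isGeneralizedLaxSolution_darboux h0 h1 (f1 := 0) (f2 := 0)
    (g1 := fun _ _ => 1) (g2 := fun _ _ => -1)
    (S0 := 0) (S1 := fun x t => -((p0 lam x t + q0 lam x t) / (1 - lam)))
    (fun x t => ?_) (fun x t => ?_) (fun x t => ?_) (fun x t => ?_)
    (fun x t => ?_) (fun x t => ?_) (fun x t => ?_) (fun x t => ?_)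
    (fun x t => ?_) (fun x t => ?_) (fun x t => ?_) (fun x t => ?_)
  · simp
  · simp
  · simp [eigvecOne]; ring
  · simp [eigvecOne]; ring
  · simp [hasDerivAt_const]
  · simp [hasDerivAt_const]
  · simp [hasDerivAt_const]
  · simp [hasDerivAt_const]
  · refine (((hasDerivAt_p0_fst h0 h1 x t).fun_add
      (hasDerivAt_q0_fst h0 h1 x t)).div_const _).fun_neg.congr_deriv ?_
    field_simp; ring
  · refine (((hasDerivAt_p0_snd h0 h1 x t).fun_add
      (hasDerivAt_q0_snd h0 h1 x t)).div_const _).fun_neg.congr_deriv ?_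
    simp; field_simp; ring
  · simp
  · simp; field_simp; ring

/-- The Jordan chain of the nilpotent background matrix at `mu = 1` gives a solution linear in `x +
i t`, which is then transformed. -/
lemma isLaxSolution_secondOne (h0 : 0 < lam) (h1 : lam < 1) :
    IsLaxSolution (breather lam) 1 (secondOne lam) := by
  have hl := one_sub_ne_zero h1
  have hzx : ∀ x t : ℝ, HasDerivAt (fun y : ℝ => (y : ℂ) + Complex.I * t) 1 x := fun x t =>
    (hasDerivAt_ofReal x).add_const _
  have hzt : ∀ x t : ℝ, HasDerivAt (fun s : ℝ => (x : ℂ) + Complex.I * s) Complex.I t :=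
    fun x t => (((hasDerivAt_ofReal t).const_mul Complex.I).const_add _).congr_deriv (mul_one _)
  rw [isLaxSolution_iff]
  refine isGeneralizedLaxSolution_darboux h0 h1 (f1 := 0) (f2 := 0)
    (g1 := fun x t => x + Complex.I * t + 1) (g2 := fun x t => -(x + Complex.I * t))
    (S0 := 0) (S1 := fun x t => -(((x + Complex.I * t) * (p0 lam x t + q0 lam x t)
      + q0 lam x t) / (1 - lam)))
    (fun x t => ?_) (fun x t => ?_) (fun x t => ?_) (fun x t => ?_)
    (fun x t => ?_) (fun x t => ?_) (fun x t => ?_) (fun x t => ?_)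
    (fun x t => ?_) (fun x t => ?_) (fun x t => ?_) (fun x t => ?_)
  · simp
  · simp
  · simp [secondOne]; ring
  · simp [secondOne]; ring
  · exact ((hzx x t).add_const 1).congr_deriv (by simp only [Pi.zero_apply]; ring)
  · exact (hzx x t).fun_neg.congr_deriv (by simp only [Pi.zero_apply]; ring)
  · exact ((hzt x t).add_const 1).congr_deriv (by simp only [Pi.zero_apply]; ring)
  · exact (hzt x t).fun_neg.congr_deriv (by simp only [Pi.zero_apply]; ring)
  · refine ((((hzx x t).fun_mul ((hasDerivAt_p0_fst h0 h1 x t).fun_add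
      (hasDerivAt_q0_fst h0 h1 x t))).fun_add
      (hasDerivAt_q0_fst h0 h1 x t)).div_const _).fun_neg.congr_deriv ?_
    field_simp; ring
  · refine ((((hzt x t).fun_mul ((hasDerivAt_p0_snd h0 h1 x t).fun_add
      (hasDerivAt_q0_snd h0 h1 x t))).fun_add
      (hasDerivAt_q0_snd h0 h1 x t)).div_const _).fun_neg.congr_deriv ?_
    simp; field_simp; ring
  · simp
  · simp; field_simp; ring

lemma ofReal_halfK_ne_zero (h0 : 0 < lam) (h1 : lam < 1) : (halfK lam : ℂ) ≠ 0 :=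
  Complex.ofReal_ne_zero.2 (halfK_pos h0 h1).ne'

lemma ofReal_kOf (lam : ℝ) : (kOf lam : ℂ) = 2 * (halfK lam : ℂ) := by
  rw [kOf_eq]; push_cast; rfl

lemma hasDerivAt_sinh_theta_fst (lam x t : ℝ) :
    HasDerivAt (fun y => Complex.sinh (theta lam y t))
      (Complex.cosh (theta lam x t) * -(2 * Complex.I * halfK lam)) x :=
  (Complex.hasDerivAt_sinh _).comp x (hasDerivAt_theta_fst lam x t)

lemma hasDerivAt_sinh_theta_snd (lam x t : ℝ) :
    HasDerivAt (fun s => Complex.sinh (theta lam x s))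
      (Complex.cosh (theta lam x t) * (2 * lam * halfK lam)) t :=
  (Complex.hasDerivAt_sinh _).comp t (hasDerivAt_theta_snd lam x t)

lemma hasDerivAt_cosh_theta_fst (lam x t : ℝ) :
    HasDerivAt (fun y => Complex.cosh (theta lam y t))
      (Complex.sinh (theta lam x t) * -(2 * Complex.I * halfK lam)) x :=
  (Complex.hasDerivAt_cosh _).comp x (hasDerivAt_theta_fst lam x t)

lemma hasDerivAt_cosh_theta_snd (lam x t : ℝ) :
    HasDerivAt (fun s => Complex.cosh (theta lam x s))
      (Complex.sinh (theta lam x t) * (2 * lam * halfK lam)) t :=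
  (Complex.hasDerivAt_cosh _).comp t (hasDerivAt_theta_snd lam x t)

/-- Differentiation in `x` changes the relative sign of the two exponentials, hence exchanges the
solutions with `+` and with `-`. Combined with the Lax equation this gives four such relations. -/
lemma pPlus_relation (h0 : 0 < lam) (h1 : lam < 1) (x t : ℝ) :
    lam * pPlus lam x t + qPlus lam x t = -(Complex.I * halfK lam) * p0 lam x t := by
  simp only [pPlus, qPlus, p0]
  linear_combination -expA lam x t * rootPlus_eq h0 h1 - expB lam x t * rootMinus_eq h0 h1

lemma qPlus_relation (h0 : 0 < lam) (h1 : lam < 1) (x t : ℝ) :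
    pPlus lam x t + lam * qPlus lam x t = Complex.I * halfK lam * q0 lam x t := by
  simp only [pPlus, qPlus, q0]
  linear_combination expA lam x t * rootMinus_eq h0 h1 + expB lam x t * rootPlus_eq h0 h1

lemma p0_relation (h0 : 0 < lam) (h1 : lam < 1) (x t : ℝ) :
    lam * p0 lam x t + q0 lam x t = -(Complex.I * halfK lam) * pPlus lam x t := by
  simp only [pPlus, q0, p0]
  linear_combination -expA lam x t * rootPlus_eq h0 h1 + expB lam x t * rootMinus_eq h0 h1

lemma q0_relation (h0 : 0 < lam) (h1 : lam < 1) (x t : ℝ) :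
    p0 lam x t + lam * q0 lam x t = Complex.I * halfK lam * qPlus lam x t := by
  simp only [p0, qPlus, q0]
  linear_combination expA lam x t * rootMinus_eq h0 h1 - expB lam x t * rootPlus_eq h0 h1

/-- The background vector is the seed itself, whose Wronskian with the seed vanishes. The
coefficient of `eigvec0` must have `x`-derivative `-2 p0 q0 = 4 (cosh theta - lam)`, whence the
linear term and the `sinh`. -/
lemma isLaxSolution_secondZero (h0 : 0 < lam) (h1 : lam < 1) :
    IsLaxSolution (breather lam) lam (secondZero lam) := by
  have hs := ofReal_halfK_ne_zero h0 h1
  rw [isLaxSolution_iff]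
  refine isGeneralizedLaxSolution_darboux h0 h1 (f1 := 0) (f2 := 0)
    (g1 := p0 lam) (g2 := q0 lam)
    (S0 := 0) (S1 := fun x t => 4 * (-(lam : ℂ) * (x : ℂ)
      + Complex.I * (1 - 2 * (lam : ℂ) ^ 2) * (t : ℂ)
      + Complex.I / (kOf lam : ℂ) * Complex.sinh (theta lam x t)))
    (fun x t => ?_) (fun x t => ?_) (fun x t => ?_) (fun x t => ?_)
    (fun x t => ?_) (fun x t => ?_) (fun x t => ?_) (fun x t => ?_)
    (fun x t => ?_) (fun x t => ?_) (fun x t => ?_) (fun x t => ?_)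
  · simp
  · simp
  · simp [secondZero]
  · simp [secondZero]
  · exact (hasDerivAt_p0_fst h0 h1 x t).congr_deriv (by simp)
  · exact (hasDerivAt_q0_fst h0 h1 x t).congr_deriv (by simp)
  · exact (hasDerivAt_p0_snd h0 h1 x t).congr_deriv (by simp)
  · exact (hasDerivAt_q0_snd h0 h1 x t).congr_deriv (by simp)
  · refine (((((hasDerivAt_ofReal x).const_mul (-(lam : ℂ))).add_const _).fun_add
      ((hasDerivAt_sinh_theta_fst lam x t).const_mul _)).const_mul 4).congr_deriv ?_
    rw [ofReal_kOf]
    field_simp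
    linear_combination 2 * p0_mul_q0 h0 h1 x t - 4 * Complex.cosh (theta lam x t) * Complex.I_sq
  · refine (((((hasDerivAt_ofReal t).const_mul _).const_add _).fun_add
      ((hasDerivAt_sinh_theta_snd lam x t).const_mul _)).const_mul 4).congr_deriv ?_
    rw [ofReal_kOf]
    simp only [Pi.zero_apply]
    field_simp
    linear_combination 4 * lam * p0_mul_q0 h0 h1 x t + p0_sq h0 h1 x t + q0_sq h0 h1 x t
  · simp
  · simp; ring

/-- Over `eigvec0` one has `S0 = 1`, so the background vector must have Wronskian `1` with the seed.
The factor `1 / (2 i k)` achieves this for `(pPlus, qPlus)`. The constant `-lam` in the coefficient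
is a choice, as it only adds a multiple of `eigvec0`. -/
lemma isGeneralizedLaxSolution_genEigvec (h0 : 0 < lam) (h1 : lam < 1) :
    IsGeneralizedLaxSolution (breather lam) lam (eigvec0 lam) (genEigvec lam) := by
  have hs := ofReal_halfK_ne_zero h0 h1
  have hI := Complex.I_ne_zero
  refine isGeneralizedLaxSolution_darboux h0 h1 (f1 := 0) (f2 := 0)
    (g1 := fun x t => 1 / (2 * Complex.I * (kOf lam : ℂ)) * pPlus lam x t)
    (g2 := fun x t => 1 / (2 * Complex.I * (kOf lam : ℂ)) * qPlus lam x t)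
    (S0 := 1) (S1 := fun x t => 2 / (kOf lam : ℂ) ^ 2 *
      (Complex.cosh (theta lam x t) - (lam : ℂ)))
    (fun x t => ?_) (fun x t => ?_) (fun x t => ?_) (fun x t => ?_)
    (fun x t => ?_) (fun x t => ?_) (fun x t => ?_) (fun x t => ?_)
    (fun x t => ?_) (fun x t => ?_) (fun x t => ?_) (fun x t => ?_)
  · simp
  · simp
  · simp [genEigvec]
  · simp [genEigvec]
  · exact ((hasDerivAt_pPlus_fst h0 h1 x t).const_mul _).congr_deriv (by simp; ring)
  · exact ((hasDerivAt_qPlus_fst h0 h1 x t).const_mul _).congr_deriv (by simp; ring)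
  · exact ((hasDerivAt_pPlus_snd h0 h1 x t).const_mul _).congr_deriv (by simp; ring)
  · exact ((hasDerivAt_qPlus_snd h0 h1 x t).const_mul _).congr_deriv (by simp; ring)
  · refine (((hasDerivAt_cosh_theta_fst lam x t).sub_const _).const_mul _).congr_deriv ?_
    rw [ofReal_kOf]
    field_simp
    linear_combination pPlus_mul_q0 h0 h1 x t + qPlus_mul_p0 h0 h1 x t
      - 4 * Complex.sinh (theta lam x t) * Complex.I_sq
  · refine (((hasDerivAt_cosh_theta_snd lam x t).sub_const _).const_mul _).congr_deriv ?_
    rw [ofReal_kOf]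
    simp only [Pi.zero_apply]
    field_simp
    linear_combination 2 * lam * (pPlus_mul_q0 h0 h1 x t + qPlus_mul_p0 h0 h1 x t)
      + pPlus_mul_p0 lam x t + qPlus_mul_q0 lam x t
  · simp
  · rw [ofReal_kOf]
    simp only [Pi.one_apply]
    field_simp
    linear_combination halfK lam * (qPlus_mul_p0 h0 h1 x t - pPlus_mul_q0 h0 h1 x t)

/-- The background part is the `lam`-derivative of the seed: the derivative of `theta / 2` is `2
linPart / k`, and the logarithmic derivatives of `rootMinus` and `rootPlus` are `i / k` and `-i /
k`. Here `S0` is the coefficient in `secondZero`. -/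
lemma isGeneralizedLaxSolution_genSecond (h0 : 0 < lam) (h1 : lam < 1) :
    IsGeneralizedLaxSolution (breather lam) lam (secondZero lam) (genSecond lam) := by
  have hs := ofReal_halfK_ne_zero h0 h1
  have hI := Complex.I_ne_zero
  have hss := ofReal_halfK_sq h0 h1
  have hlx : ∀ x t : ℝ, HasDerivAt (fun y => linPart lam y t) (Complex.I * lam) x := fun x t =>
    (((hasDerivAt_ofReal x).const_mul _).add_const _).congr_deriv (mul_one _)
  have hlt : ∀ x t : ℝ, HasDerivAt (fun s => linPart lam x s) (1 - 2 * (lam : ℂ) ^ 2) t :=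
    fun x t => (((hasDerivAt_ofReal t).const_mul _).const_add _).congr_deriv (mul_one _)
  refine isGeneralizedLaxSolution_darboux h0 h1 (f1 := p0 lam) (f2 := q0 lam)
    (g1 := fun x t => (2 / (kOf lam : ℂ) * linPart lam x t + Complex.I / (kOf lam : ℂ))
      * pPlus lam x t)
    (g2 := fun x t => (2 / (kOf lam : ℂ) * linPart lam x t - Complex.I / (kOf lam : ℂ))
      * qPlus lam x t)
    (S0 := fun x t => 4 * (-(lam : ℂ) * (x : ℂ)
      + Complex.I * (1 - 2 * (lam : ℂ) ^ 2) * (t : ℂ)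
      + Complex.I / (kOf lam : ℂ) * Complex.sinh (theta lam x t)))
    (S1 := fun x t => 8 * Complex.I / (kOf lam : ℂ) ^ 2 * linPart lam x t *
        Complex.cosh (theta lam x t)
      + 8 * Complex.I * (lam : ℂ) / (kOf lam : ℂ) ^ 3 * Complex.sinh (theta lam x t)
      + 2 * Complex.I * (Complex.I * (x : ℂ) - 4 * (lam : ℂ) * (t : ℂ)))
    (fun x t => ?_) (fun x t => ?_) (fun x t => ?_) (fun x t => ?_)
    (fun x t => ?_) (fun x t => ?_) (fun x t => ?_) (fun x t => ?_)
    (fun x t => ?_) (fun x t => ?_) (fun x t => ?_) (fun x t => ?_)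
  · simp [secondZero]
  · simp [secondZero]
  · simp [genSecond]; ring
  · simp [genSecond]; ring
  · refine ((((hlx x t).const_mul _).add_const _).fun_mul
      (hasDerivAt_pPlus_fst h0 h1 x t)).congr_deriv ?_
    rw [ofReal_kOf]
    linear_combination (norm := (field_simp; ring))
      Complex.I / halfK lam * pPlus_relation h0 h1 x t - p0 lam x t * Complex.I_sq
  · refine ((((hlx x t).const_mul _).sub_const _).fun_mul
      (hasDerivAt_qPlus_fst h0 h1 x t)).congr_deriv ?_
    rw [ofReal_kOf]
    linear_combination (norm := (field_simp; ring))
      Complex.I / halfK lam * qPlus_relation h0 h1 x t + q0 lam x t * Complex.I_sq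
  · refine ((((hlt x t).const_mul _).add_const _).fun_mul
      (hasDerivAt_pPlus_snd h0 h1 x t)).congr_deriv ?_
    rw [ofReal_kOf]
    linear_combination (norm := (field_simp; ring))
      -lam / halfK lam * pPlus_relation h0 h1 x t - pPlus lam x t / halfK lam * hss
        - Complex.I * p0_relation h0 h1 x t
        + (lam / halfK lam * qPlus lam x t + halfK lam * pPlus lam x t) * Complex.I_sq
  · refine ((((hlt x t).const_mul _).sub_const _).fun_mul
      (hasDerivAt_qPlus_snd h0 h1 x t)).congr_deriv ?_
    rw [ofReal_kOf]
    linear_combination (norm := (field_simp; ring))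
      -lam / halfK lam * qPlus_relation h0 h1 x t - qPlus lam x t / halfK lam * hss
        + Complex.I * q0_relation h0 h1 x t
        + (lam / halfK lam * pPlus lam x t + halfK lam * qPlus lam x t) * Complex.I_sq
  · refine (((((hlx x t).const_mul _).fun_mul (hasDerivAt_cosh_theta_fst lam x t)).fun_add
      ((hasDerivAt_sinh_theta_fst lam x t).const_mul _)).fun_add
      ((((hasDerivAt_ofReal x).const_mul _).sub_const _).const_mul _)).congr_deriv ?_
    rw [ofReal_kOf]
    linear_combination (norm := (field_simp; ring))
      (linPart lam x t / halfK lam - Complex.I / (2 * halfK lam)) * qPlus_mul_p0 h0 h1 x t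
      + (linPart lam x t / halfK lam + Complex.I / (2 * halfK lam)) * pPlus_mul_q0 h0 h1 x t
      + (-4 * linPart lam x t / halfK lam * Complex.sinh (theta lam x t)) * Complex.I_sq
  · refine (((((hlt x t).const_mul _).fun_mul (hasDerivAt_cosh_theta_snd lam x t)).fun_add
      ((hasDerivAt_sinh_theta_snd lam x t).const_mul _)).fun_add
      ((((hasDerivAt_ofReal t).const_mul _).const_sub _).const_mul _)).congr_deriv ?_
    rw [ofReal_kOf]
    linear_combination (norm := (field_simp; ring))
      Complex.I * (2 * lam * (linPart lam x t / halfK lam - Complex.I / (2 * halfK lam))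
        * qPlus_mul_p0 h0 h1 x t
      + 2 * lam * (linPart lam x t / halfK lam + Complex.I / (2 * halfK lam))
        * pPlus_mul_q0 h0 h1 x t
      + (linPart lam x t / halfK lam - Complex.I / (2 * halfK lam)) * qPlus_mul_q0 lam x t
      + (linPart lam x t / halfK lam + Complex.I / (2 * halfK lam)) * pPlus_mul_p0 lam x t
      + 2 * p0_mul_q0 h0 h1 x t)
      - 2 * Complex.I * Complex.cosh (theta lam x t) / halfK lam ^ 2 * hss
      - Complex.I * (4 * lam + 2 * Complex.cosh (theta lam x t)) * Complex.I_sq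
  · ring
  · rw [ofReal_kOf]
    linear_combination (norm := (simp only [linPart]; field_simp; ring))
      (linPart lam x t / halfK lam - Complex.I / (2 * halfK lam)) * qPlus_mul_p0 h0 h1 x t
      - (linPart lam x t / halfK lam + Complex.I / (2 * halfK lam)) * pPlus_mul_q0 h0 h1 x t
      + 4 * lam * x * Complex.I_sq

/-! ### Periodicity in `x` -/

lemma kOf_mul_period (h0 : 0 < lam) (h1 : lam < 1) : kOf lam * period lam = 2 * Real.pi := by
  rw [period, mul_div_cancel₀ _ (kOf_pos h0 h1).ne']

/-- The exponentials contain half of this phase, so the shift by `2 pi i` changes their sign. This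
is the source of the antiperiodicity at `lam0`. -/
lemma theta_add_period (h0 : 0 < lam) (h1 : lam < 1) (x t : ℝ) :
    theta lam (x + period lam) t = theta lam x t - 2 * Real.pi * Complex.I := by
  have h : (kOf lam : ℂ) * period lam = 2 * Real.pi := by exact_mod_cast kOf_mul_period h0 h1
  rw [theta, theta]
  push_cast
  linear_combination -Complex.I * h

lemma expA_add_period (h0 : 0 < lam) (h1 : lam < 1) (x t : ℝ) :
    expA lam (x + period lam) t = -expA lam x t := by
  rw [expA_eq, expA_eq, theta_add_period h0 h1, ← Complex.exp_sub_pi_mul_I]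
  congr 1; ring

lemma expB_add_period (h0 : 0 < lam) (h1 : lam < 1) (x t : ℝ) :
    expB lam (x + period lam) t = -expB lam x t := by
  rw [expB_eq, expB_eq, theta_add_period h0 h1, ← Complex.exp_add_pi_mul_I]
  congr 1; ring

lemma p0_add_period (h0 : 0 < lam) (h1 : lam < 1) (x t : ℝ) :
    p0 lam (x + period lam) t = -p0 lam x t := by
  rw [p0, p0, expA_add_period h0 h1, expB_add_period h0 h1]; ring

lemma q0_add_period (h0 : 0 < lam) (h1 : lam < 1) (x t : ℝ) :
    q0 lam (x + period lam) t = -q0 lam x t := by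
  rw [q0, q0, expA_add_period h0 h1, expB_add_period h0 h1]; ring

lemma pPlus_add_period (h0 : 0 < lam) (h1 : lam < 1) (x t : ℝ) :
    pPlus lam (x + period lam) t = -pPlus lam x t := by
  rw [pPlus, pPlus, expA_add_period h0 h1, expB_add_period h0 h1]; ring

lemma qPlus_add_period (h0 : 0 < lam) (h1 : lam < 1) (x t : ℝ) :
    qPlus lam (x + period lam) t = -qPlus lam x t := by
  rw [qPlus, qPlus, expA_add_period h0 h1, expB_add_period h0 h1]; ring

lemma eigvec0_add_period (h0 : 0 < lam) (h1 : lam < 1) (x t : ℝ) :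
    eigvec0 lam (x + period lam) t = -eigvec0 lam x t := by
  rw [eigvec0, eigvec0, p0_add_period h0 h1, q0_add_period h0 h1]
  ext j; fin_cases j <;> simp

lemma eigvecOne_add_period (h0 : 0 < lam) (h1 : lam < 1) (x t : ℝ) :
    eigvecOne lam (x + period lam) t = eigvecOne lam x t := by
  rw [eigvecOne, eigvecOne, p0_add_period h0 h1, q0_add_period h0 h1, eigvec0_add_period h0 h1,
    ← neg_add, neg_div, neg_smul_neg]

lemma genEigvec_add_period (h0 : 0 < lam) (h1 : lam < 1) (x t : ℝ) :
    genEigvec lam (x + period lam) t = -genEigvec lam x t := by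
  have e : Complex.cosh (theta lam (x + period lam) t) = Complex.cosh (theta lam x t) := by
    have h := kOf_mul_period h0 h1
    rw [cosh_theta, cosh_theta, csX, csX, snX, snX, mul_add, h, Real.cos_add_two_pi,
      Real.sin_add_two_pi]
  rw [genEigvec, genEigvec, pPlus_add_period h0 h1, qPlus_add_period h0 h1,
    eigvec0_add_period h0 h1, e, smul_neg, neg_add]
  congr 1
  ext j; fin_cases j <;> simp

end

/-! ### Closed forms -/

section

variable {lam : ℝ}

lemma eigvec0_zero_eq (h0 : 0 < lam) (h1 : lam < 1) (x t : ℝ) :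
    eigvec0 lam x t 0 = -(lam * conj (q0 lam x t)) / (2 * den lam x t) := by
  have hD := den_ne_zero h0 h1 x t
  rw [eigvec0_zero, sqLen_eq h0 h1]; field_simp; ring

lemma conj_eigvec0_one_eq (h0 : 0 < lam) (h1 : lam < 1) (x t : ℝ) :
    conj (eigvec0 lam x t 1) = lam * p0 lam x t / (2 * den lam x t) := by
  have hD := den_ne_zero h0 h1 x t
  rw [eigvec0_one, sqLen_eq h0 h1]
  simp only [map_div₀, map_mul, Complex.conj_conj, Complex.conj_ofReal, map_ofNat]
  field_simp; ring

lemma eigvecOne_zero_eq (h0 : 0 < lam) (h1 : lam < 1) (x t : ℝ) :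
    eigvecOne lam x t 0 = halfK lam * (halfK lam * chT lam t + Complex.I * lam * shT lam t
      - lam * snX lam x) / ((1 - lam) * den lam x t) := by
  have hD := den_ne_zero h0 h1 x t
  have hl := one_sub_ne_zero h1
  have e : eigvecOne lam x t 0
      = 1 - (p0 lam x t + q0 lam x t) / (1 - lam) * eigvec0 lam x t 0 := by simp [eigvecOne]
  rw [e, eigvec0_zero_eq h0 h1]
  field_simp
  linear_combination lam * (p0_mul_conj_q0 h0 h1 x t + q0_mul_conj_q0 h0 h1 x t)
    + 2 * (1 - lam) * den_eq lam x t - 2 * chT lam t * ofReal_halfK_sq h0 h1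

lemma conj_eigvecOne_one_eq (h0 : 0 < lam) (h1 : lam < 1) (x t : ℝ) :
    conj (eigvecOne lam x t 1) = -(halfK lam * (halfK lam * chT lam t
      + Complex.I * lam * shT lam t + lam * snX lam x)) / ((1 - lam) * den lam x t) := by
  have hD := den_ne_zero h0 h1 x t
  have hl := one_sub_ne_zero h1
  have e : conj (eigvecOne lam x t 1) = -1 - (conj (p0 lam x t) + conj (q0 lam x t)) / (1 - lam)
      * conj (eigvec0 lam x t 1) := by simp [eigvecOne]
  rw [e, conj_eigvec0_one_eq h0 h1]
  field_simp
  linear_combination -lam * (p0_mul_conj_q0 h0 h1 x t + p0_mul_conj_p0 h0 h1 x t)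
    - 2 * (1 - lam) * den_eq lam x t + 2 * chT lam t * ofReal_halfK_sq h0 h1

/-- Splitting off `x + i t` times the periodic eigenfunction shows that the coefficient of `x` in
`v3` is `v1`, and in `v4` it is `v2`. -/
lemma secondOne_zero_eq (h0 : 0 < lam) (h1 : lam < 1) (x t : ℝ) :
    secondOne lam x t 0 = (x + Complex.I * t) * eigvecOne lam x t 0
      + (chT lam t - lam * csX lam x - lam * halfK lam * snX lam x)
        / ((1 - lam) * den lam x t) := by
  have hD := den_ne_zero h0 h1 x t
  have hl := one_sub_ne_zero h1
  have e : secondOne lam x t 0 = (x + Complex.I * t) * eigvecOne lam x t 0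
      + (1 - q0 lam x t / (1 - lam) * eigvec0 lam x t 0) := by
    simp [eigvecOne, secondOne]; ring
  rw [e, eigvec0_zero_eq h0 h1]
  congr 1
  field_simp
  linear_combination lam * q0_mul_conj_q0 h0 h1 x t + 2 * (1 - lam) * den_eq lam x t

lemma conj_secondOne_one_eq (h0 : 0 < lam) (h1 : lam < 1) (x t : ℝ) :
    conj (secondOne lam x t 1) = (x - Complex.I * t) * conj (eigvecOne lam x t 1)
      + lam * (lam * chT lam t - Complex.I * halfK lam * shT lam t - csX lam x)
        / ((1 - lam) * den lam x t) := by
  have hD := den_ne_zero h0 h1 x t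
  have hl := one_sub_ne_zero h1
  have e : conj (secondOne lam x t 1) = (x - Complex.I * t) * conj (eigvecOne lam x t 1)
      - conj (q0 lam x t) / (1 - lam) * conj (eigvec0 lam x t 1) := by
    simp [eigvecOne, secondOne]; ring
  rw [e, conj_eigvec0_one_eq h0 h1, sub_eq_add_neg]
  congr 1
  field_simp
  linear_combination -lam * p0_mul_conj_q0 h0 h1 x t

lemma v1_eq_pairMinus (h0 : 0 < lam) (h1 : lam < 1) :
    v1 lam = pairMinus (eigvecOne lam) (eigvecOne lam) := by
  ext x t
  have hD := den_ne_zero h0 h1 x t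
  have hl := one_sub_ne_zero h1
  rw [pairMinus, eigvecOne_zero_eq h0 h1, conj_eigvecOne_one_eq h0 h1]
  have e : v1 lam x t = -(2 * (lam : ℂ) * (1 + (lam : ℂ)) / (1 - (lam : ℂ))) *
      (snX lam x * ((kOf lam : ℂ) * chT lam t + 2 * Complex.I * (lam : ℂ) * shT lam t)
      / (den lam x t : ℂ) ^ 2) := rfl
  rw [e, ofReal_kOf]
  field_simp
  linear_combination 4 * lam * snX lam x *
    (halfK lam * chT lam t + Complex.I * lam * shT lam t) * ofReal_halfK_sq h0 h1

lemma v2_eq_pairPlus (h0 : 0 < lam) (h1 : lam < 1) :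
    v2 lam = pairPlus (eigvecOne lam) (eigvecOne lam) := by
  ext x t
  have hD := den_ne_zero h0 h1 x t
  have hl := one_sub_ne_zero h1
  rw [pairPlus, eigvecOne_zero_eq h0 h1, conj_eigvecOne_one_eq h0 h1]
  have e : v2 lam x t = 2 * Complex.I * (1 + (lam : ℂ)) / (1 - (lam : ℂ)) *
    (Complex.I * (kOf lam : ℂ) * (lam : ℂ) * shT lam t * chT lam t / (den lam x t : ℂ) ^ 2
      + ((1 - 2 * (lam : ℂ) ^ 2) * chT lam t ^ 2
        - (lam : ℂ) ^ 2 * csX lam x ^ 2 + 2 * (lam : ℂ) ^ 2) / (den lam x t : ℂ) ^ 2) := rfl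
  have hs := ofReal_halfK_sq h0 h1
  have hS := shT_sq lam t
  have hn := snX_sq lam x
  have hI := Complex.I_sq
  rw [e, ofReal_kOf]
  field_simp
  clear e
  -- With the functions replaced by indeterminates, the claim is a polynomial identity modulo the
  -- four relations for `s^2`, `S^2`, `n^2` and `i^2`.
  generalize shT lam t = S at *
  generalize chT lam t = C at *
  generalize snX lam x = n at *
  generalize csX lam x = c at *
  generalize (halfK lam : ℂ) = s at *
  generalize (lam : ℂ) = l at *
  generalize Complex.I = i at *
  grind

lemma p0_sq_eq (h0 : 0 < lam) (h1 : lam < 1) (x t : ℝ) :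
    p0 lam x t ^ 2 = 2 * (csX lam x * (lam * chT lam t - Complex.I * halfK lam * shT lam t)
      - snX lam x * (halfK lam * chT lam t + Complex.I * lam * shT lam t) - 1) := by
  rw [p0_sq h0 h1, cosh_theta, sinh_theta]
  linear_combination 2 * halfK lam * chT lam t * snX lam x * Complex.I_sq

lemma conj_q0_sq_eq (h0 : 0 < lam) (h1 : lam < 1) (x t : ℝ) :
    conj (q0 lam x t) ^ 2
      = 2 * (csX lam x * (lam * chT lam t - Complex.I * halfK lam * shT lam t)
      + snX lam x * (halfK lam * chT lam t + Complex.I * lam * shT lam t) - 1) := by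
  rw [← map_pow, q0_sq h0 h1, cosh_theta, sinh_theta]
  simp only [map_mul, map_sub, map_add, map_one, map_ofNat, conj_csX, conj_snX, conj_chT,
    conj_shT, Complex.conj_I, Complex.conj_ofReal]
  linear_combination -2 * halfK lam * chT lam t * snX lam x * Complex.I_sq

lemma pPlus_mul_p0_eq (lam x t : ℝ) :
    pPlus lam x t * p0 lam x t
      = 2 * (csX lam x * (lam * shT lam t - Complex.I * halfK lam * chT lam t)
        - snX lam x * (halfK lam * shT lam t + Complex.I * lam * chT lam t)) := by
  rw [pPlus_mul_p0, cosh_theta, sinh_theta]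
  linear_combination 2 * halfK lam * shT lam t * snX lam x * Complex.I_sq

lemma conj_qPlus_mul_q0_eq (lam x t : ℝ) :
    conj (qPlus lam x t) * conj (q0 lam x t)
      = 2 * (csX lam x * (lam * shT lam t - Complex.I * halfK lam * chT lam t)
        + snX lam x * (halfK lam * shT lam t + Complex.I * lam * chT lam t)) := by
  rw [← map_mul, qPlus_mul_q0, cosh_theta, sinh_theta]
  simp only [map_mul, map_sub, map_add, map_ofNat, conj_csX, conj_snX, conj_chT,
    conj_shT, Complex.conj_I, Complex.conj_ofReal]
  linear_combination -2 * halfK lam * shT lam t * snX lam x * Complex.I_sq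

lemma v3_eq (h0 : 0 < lam) (h1 : lam < 1) (x t : ℝ) :
    v3 lam x t = halfK lam * (halfK lam * (x + Complex.I * t) * (halfK lam * chT lam t
        + Complex.I * lam * shT lam t - lam * snX lam x) ^ 2
      - halfK lam * (x - Complex.I * t) * (halfK lam * chT lam t
        + Complex.I * lam * shT lam t + lam * snX lam x) ^ 2
      + (halfK lam * chT lam t + Complex.I * lam * shT lam t - lam * snX lam x)
        * (chT lam t - lam * csX lam x - lam * halfK lam * snX lam x)
      + (halfK lam * chT lam t + Complex.I * lam * shT lam t + lam * snX lam x)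
        * (lam * (lam * chT lam t - Complex.I * halfK lam * shT lam t - csX lam x)))
      / ((1 - lam) ^ 2 * den lam x t ^ 2) := by
  have hD := den_ne_zero h0 h1 x t
  have hl := one_sub_ne_zero h1
  rw [v3, pairMinus, secondOne_zero_eq h0 h1, conj_secondOne_one_eq h0 h1,
    eigvecOne_zero_eq h0 h1, conj_eigvecOne_one_eq h0 h1]
  field_simp
  ring

lemma v4_eq (h0 : 0 < lam) (h1 : lam < 1) (x t : ℝ) :
    v4 lam x t = Complex.I * halfK lam * (halfK lam * (x + Complex.I * t) *
        (halfK lam * chT lam t + Complex.I * lam * shT lam t - lam * snX lam x) ^ 2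
      + halfK lam * (x - Complex.I * t) * (halfK lam * chT lam t
        + Complex.I * lam * shT lam t + lam * snX lam x) ^ 2
      + (halfK lam * chT lam t + Complex.I * lam * shT lam t - lam * snX lam x)
        * (chT lam t - lam * csX lam x - lam * halfK lam * snX lam x)
      - (halfK lam * chT lam t + Complex.I * lam * shT lam t + lam * snX lam x)
        * (lam * (lam * chT lam t - Complex.I * halfK lam * shT lam t - csX lam x)))
      / ((1 - lam) ^ 2 * den lam x t ^ 2) := by
  have hD := den_ne_zero h0 h1 x t
  have hl := one_sub_ne_zero h1
  rw [v4, pairPlus, secondOne_zero_eq h0 h1, conj_secondOne_one_eq h0 h1,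
    eigvecOne_zero_eq h0 h1, conj_eigvecOne_one_eq h0 h1]
  field_simp
  ring

lemma w2_eq_pairPlus (h0 : 0 < lam) (h1 : lam < 1) :
    w2 lam = pairPlus (eigvec0 lam) (eigvec0 lam) := by
  ext x t
  have hD := den_ne_zero h0 h1 x t
  have e : w2 lam x t = (lam : ℂ) ^ 2 *
    ((kOf lam : ℂ) * shT lam t * csX lam x
      + 2 * Complex.I * (lam : ℂ) * chT lam t * csX lam x - 2 * Complex.I)
    / (2 * (den lam x t : ℂ) ^ 2) := rfl
  rw [pairPlus, eigvec0_zero_eq h0 h1, conj_eigvec0_one_eq h0 h1, e, ofReal_kOf]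
  field_simp
  linear_combination lam ^ 2 * (-Complex.I * (p0_sq_eq h0 h1 x t + conj_q0_sq_eq h0 h1 x t)
    + 4 * csX lam x * halfK lam * shT lam t * Complex.I_sq)

/-- The coefficient of `eigvec0` in `secondZero`. -/
def coefZero (lam x t : ℝ) : ℂ :=
  4 * (-(lam : ℂ) * (x : ℂ) + Complex.I * (1 - 2 * (lam : ℂ) ^ 2) * (t : ℂ)
    + Complex.I / (2 * halfK lam) * (shT lam t * csX lam x
      - Complex.I * chT lam t * snX lam x))

lemma secondZero_zero_eq (lam x t : ℝ) :
    secondZero lam x t 0 = p0 lam x t + coefZero lam x t * eigvec0 lam x t 0 := by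
  simp [secondZero, coefZero, sinh_theta, ofReal_kOf]

lemma secondZero_one_eq (lam x t : ℝ) :
    secondZero lam x t 1 = q0 lam x t + coefZero lam x t * eigvec0 lam x t 1 := by
  simp [secondZero, coefZero, sinh_theta, ofReal_kOf]

lemma conj_coefZero (lam x t : ℝ) : conj (coefZero lam x t)
    = 4 * (-(lam : ℂ) * (x : ℂ) - Complex.I * (1 - 2 * (lam : ℂ) ^ 2) * (t : ℂ)
      - Complex.I / (2 * halfK lam) * (shT lam t * csX lam x
      + Complex.I * chT lam t * snX lam x)) := by
  simp only [coefZero, map_mul, map_sub, map_add, map_neg, map_div₀, map_pow, map_one, map_ofNat,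
    conj_csX, conj_snX, conj_chT, conj_shT, Complex.conj_I, Complex.conj_ofReal]
  ring

lemma w3_eq (h0 : 0 < lam) (h1 : lam < 1) (x t : ℝ) :
    w3 lam x t = -(2 * lam * (csX lam x - (lam * chT lam t - Complex.I * halfK lam * shT lam t)))
        / den lam x t
      + lam ^ 2 / (2 * den lam x t ^ 2) * (coefZero lam x t
        * (csX lam x * (lam * chT lam t - Complex.I * halfK lam * shT lam t)
        + snX lam x * (halfK lam * chT lam t + Complex.I * lam * shT lam t) - 1)
        - conj (coefZero lam x t)
        * (csX lam x * (lam * chT lam t - Complex.I * halfK lam * shT lam t)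
        - snX lam x * (halfK lam * chT lam t + Complex.I * lam * shT lam t) - 1)) := by
  have hD := den_ne_zero h0 h1 x t
  have e : w3 lam x t = -(lam * (p0 lam x t * conj (q0 lam x t))) / den lam x t
      + lam ^ 2 / (4 * den lam x t ^ 2) * (coefZero lam x t * conj (q0 lam x t) ^ 2
        - conj (coefZero lam x t) * p0 lam x t ^ 2) := by
    rw [w3, pairMinus, secondZero_zero_eq, secondZero_one_eq, map_add, map_mul,
      eigvec0_zero_eq h0 h1, conj_eigvec0_one_eq h0 h1]
    field_simp
    ring
  rw [e, p0_mul_conj_q0 h0 h1, p0_sq_eq h0 h1, conj_q0_sq_eq h0 h1]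
  field_simp
  ring

lemma w4_eq (h0 : 0 < lam) (h1 : lam < 1) (x t : ℝ) :
    w4 lam x t = Complex.I * lam ^ 2 / (2 * den lam x t ^ 2) * (coefZero lam x t
        * (csX lam x * (lam * chT lam t - Complex.I * halfK lam * shT lam t)
        + snX lam x * (halfK lam * chT lam t + Complex.I * lam * shT lam t) - 1)
        + conj (coefZero lam x t)
        * (csX lam x * (lam * chT lam t - Complex.I * halfK lam * shT lam t)
        - snX lam x * (halfK lam * chT lam t + Complex.I * lam * shT lam t) - 1)) := by
  have hD := den_ne_zero h0 h1 x t
  have e : w4 lam x t = Complex.I * lam ^ 2 / (4 * den lam x t ^ 2) *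
      (coefZero lam x t * conj (q0 lam x t) ^ 2
        + conj (coefZero lam x t) * p0 lam x t ^ 2) := by
    rw [w4, pairPlus, secondZero_zero_eq, secondZero_one_eq, map_add, map_mul,
      eigvec0_zero_eq h0 h1, conj_eigvec0_one_eq h0 h1]
    field_simp
    ring
  rw [e, p0_sq_eq h0 h1, conj_q0_sq_eq h0 h1]
  field_simp
  ring

/-- The numerator of the periodic closed form of `vLin`. -/
def numLin (l s C S c n t : ℂ) : ℂ :=
  s * (-2 * l ^ 3 * C * n + t * S * c * (8 * l ^ 4 - 4 * l ^ 2) - 4 * l ^ 3 * t * C * S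
      + Complex.I * (2 * l - 2 * l ^ 3) * C * S)
    - l ^ 4 * c ^ 2 + 2 * l * C * c + (2 * l ^ 4 - 3 * l ^ 2) * C ^ 2
    + Complex.I * (-2 * l ^ 4 * S * n + (4 * l ^ 2 - 4 * l ^ 4) * t - 2 * l ^ 4 * t * c ^ 2
      + (8 * l ^ 5 - 4 * l ^ 3) * t * C * c + (2 * l ^ 2 - 4 * l ^ 4) * t * C ^ 2)

lemma one_add_ne_zero (h0 : 0 < lam) : (1 + (lam : ℂ)) ≠ 0 := by
  rw [← Complex.ofReal_one, ← Complex.ofReal_add, Complex.ofReal_ne_zero]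
  linarith

/-- The coefficient of `x` in `w3` is `-4 lam` times the pairing `pairMinus` of `eigvec0` with
itself, which equals `lam^2 (1 - lam) / (1 + lam)` times `v1`. Since `v3` has the coefficient `v1`,
the combination loses its explicit `x`; the terms linear in `t` survive. -/
lemma vLin_eq (h0 : 0 < lam) (h1 : lam < 1) (x t : ℝ) :
    vLin lam x t = numLin lam (halfK lam) (chT lam t) (shT lam t) (csX lam x) (snX lam x) t
      / (chT lam t - lam * csX lam x) ^ 2 := by
  have hD := den_ne_zero h0 h1 x t
  have hl := one_sub_ne_zero h1
  have hl' := one_add_ne_zero h0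
  have hs0 := ofReal_halfK_ne_zero h0 h1
  have hs := ofReal_halfK_sq h0 h1
  have hS := shT_sq lam t
  have hn := snX_sq lam x
  have hI := Complex.I_sq
  rw [vLin, v3_eq h0 h1, w3_eq h0 h1, conj_coefZero, coefZero, numLin]
  rw [den_eq] at hD ⊢
  generalize shT lam t = S at *
  generalize chT lam t = C at *
  generalize snX lam x = n at *
  generalize csX lam x = c at *
  generalize (halfK lam : ℂ) = s at *
  generalize (lam : ℂ) = l at *
  generalize Complex.I = i at *
  -- The denominator is made an atom so that it can be cleared, and is substituted back before the
  -- polynomial identity is checked.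
  generalize hd : C - l * c = D at *
  field_simp
  subst hd
  grind

end

/-! ### Closed forms of the combinations with generalized solutions -/

section

variable {lam : ℝ}

/-- The coefficient of `eigvec0` in `genEigvec`. -/
def coefEig (lam x t : ℝ) : ℂ :=
  1 / (2 * halfK lam ^ 2) * (chT lam t * csX lam x - Complex.I * shT lam t * snX lam x - lam)

/-- The coefficient of `eigvec0` in `genSecond`. -/
def coefGen (lam x t : ℝ) : ℂ :=
  2 * Complex.I / halfK lam ^ 2 * linPart lam x t
      * (chT lam t * csX lam x - Complex.I * shT lam t * snX lam x)
    + Complex.I * lam / halfK lam ^ 3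
      * (shT lam t * csX lam x - Complex.I * chT lam t * snX lam x)
    + 2 * Complex.I * (Complex.I * x - 4 * lam * t)

lemma genEigvec_zero_eq (lam x t : ℝ) :
    genEigvec lam x t 0 = 1 / (4 * Complex.I * halfK lam) * pPlus lam x t
      + coefEig lam x t * eigvec0 lam x t 0 := by
  simp [genEigvec, coefEig, cosh_theta, ofReal_kOf]; ring

lemma genEigvec_one_eq (lam x t : ℝ) :
    genEigvec lam x t 1 = 1 / (4 * Complex.I * halfK lam) * qPlus lam x t
      + coefEig lam x t * eigvec0 lam x t 1 := by
  simp [genEigvec, coefEig, cosh_theta, ofReal_kOf]; ring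

lemma genSecond_zero_eq (lam x t : ℝ) :
    genSecond lam x t 0 = (linPart lam x t / halfK lam + Complex.I / (2 * halfK lam))
      * pPlus lam x t + coefGen lam x t * eigvec0 lam x t 0 := by
  simp [genSecond, coefGen, cosh_theta, sinh_theta, ofReal_kOf]; ring

lemma genSecond_one_eq (lam x t : ℝ) :
    genSecond lam x t 1 = (linPart lam x t / halfK lam - Complex.I / (2 * halfK lam))
      * qPlus lam x t + coefGen lam x t * eigvec0 lam x t 1 := by
  simp [genSecond, coefGen, cosh_theta, sinh_theta, ofReal_kOf]; ring

lemma conj_linPart (lam x t : ℝ) : conj (linPart lam x t)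
    = -(Complex.I * lam * x) + (1 - 2 * (lam : ℂ) ^ 2) * t := by
  simp [linPart, map_ofNat]

lemma conj_coefEig (lam x t : ℝ) : conj (coefEig lam x t)
    = 1 / (2 * halfK lam ^ 2)
      * (chT lam t * csX lam x + Complex.I * shT lam t * snX lam x - lam) := by
  simp only [coefEig, map_mul, map_sub, map_div₀, map_pow, map_one, map_ofNat,
    conj_csX, conj_snX, conj_chT, conj_shT, Complex.conj_I, Complex.conj_ofReal]
  ring

lemma conj_coefGen (lam x t : ℝ) : conj (coefGen lam x t)
    = -(2 * Complex.I / halfK lam ^ 2 * conj (linPart lam x t)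
        * (chT lam t * csX lam x + Complex.I * shT lam t * snX lam x))
      - Complex.I * lam / halfK lam ^ 3
        * (shT lam t * csX lam x + Complex.I * chT lam t * snX lam x)
      + 2 * Complex.I * (Complex.I * x + 4 * lam * t) := by
  simp only [coefGen, map_mul, map_sub, map_add, map_div₀, map_pow, map_ofNat,
    conj_csX, conj_snX, conj_chT, conj_shT, Complex.conj_I, Complex.conj_ofReal]
  ring

/-- The first component of the products whose sum or difference is `vPlus` or `vMinus`. -/
lemma prod_zero_eq (h0 : 0 < lam) (h1 : lam < 1) (x t : ℝ) :
    eigvec0 lam x t 0 * genSecond lam x t 0 + genEigvec lam x t 0 * secondZero lam x t 0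
    = -lam / (2 * den lam x t) * ((linPart lam x t / halfK lam + Complex.I / (2 * halfK lam)
          + coefZero lam x t / (4 * Complex.I * halfK lam))
        * (2 * (Complex.I * halfK lam * chT lam t - lam * shT lam t - Complex.I * snX lam x))
        + coefEig lam x t
          * (2 * (csX lam x - (lam * chT lam t - Complex.I * halfK lam * shT lam t))))
      + 1 / (4 * Complex.I * halfK lam) *
        (2 * (csX lam x * (lam * shT lam t - Complex.I * halfK lam * chT lam t)
        - snX lam x * (halfK lam * shT lam t + Complex.I * lam * chT lam t)))
      + lam ^ 2 / (4 * den lam x t ^ 2) * (coefGen lam x t + coefEig lam x t * coefZero lam x t)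
        * (2 * (csX lam x * (lam * chT lam t - Complex.I * halfK lam * shT lam t)
        + snX lam x * (halfK lam * chT lam t + Complex.I * lam * shT lam t) - 1)) := by
  have hD := den_ne_zero h0 h1 x t
  have hs := ofReal_halfK_ne_zero h0 h1
  have hI := Complex.I_ne_zero
  rw [← conj_q0_sq_eq h0 h1, ← pPlus_mul_p0_eq, ← pPlus_mul_conj_q0 h0 h1,
    ← p0_mul_conj_q0 h0 h1, genEigvec_zero_eq, genSecond_zero_eq, secondZero_zero_eq,
    eigvec0_zero_eq h0 h1]
  field_simp
  ring

/-- The second component of the products whose sum or difference is `vPlus` or `vMinus`. -/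
lemma conj_prod_one_eq (h0 : 0 < lam) (h1 : lam < 1) (x t : ℝ) :
    conj (eigvec0 lam x t 1) * conj (genSecond lam x t 1)
      + conj (genEigvec lam x t 1) * conj (secondZero lam x t 1)
    = lam / (2 * den lam x t) * ((conj (linPart lam x t) / halfK lam
          + Complex.I / (2 * halfK lam)
          - conj (coefZero lam x t) / (4 * Complex.I * halfK lam))
        * (2 * (Complex.I * halfK lam * chT lam t - lam * shT lam t + Complex.I * snX lam x))
        + conj (coefEig lam x t)
          * (2 * (csX lam x - (lam * chT lam t - Complex.I * halfK lam * shT lam t))))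
      - 1 / (4 * Complex.I * halfK lam) *
        (2 * (csX lam x * (lam * shT lam t - Complex.I * halfK lam * chT lam t)
        + snX lam x * (halfK lam * shT lam t + Complex.I * lam * chT lam t)))
      + lam ^ 2 / (4 * den lam x t ^ 2) * (conj (coefGen lam x t)
        + conj (coefEig lam x t) * conj (coefZero lam x t))
        * (2 * (csX lam x * (lam * chT lam t - Complex.I * halfK lam * shT lam t)
        - snX lam x * (halfK lam * chT lam t + Complex.I * lam * shT lam t) - 1)) := by
  have hD := den_ne_zero h0 h1 x t
  have hs := ofReal_halfK_ne_zero h0 h1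
  have hI := Complex.I_ne_zero
  rw [← p0_sq_eq h0 h1, ← conj_qPlus_mul_q0_eq, ← conj_qPlus_mul_p0 h0 h1,
    ← p0_mul_conj_q0 h0 h1, genEigvec_one_eq, genSecond_one_eq, secondZero_one_eq]
  simp only [map_add, map_sub, map_mul, map_div₀, map_one, map_ofNat, Complex.conj_I,
    Complex.conj_ofReal]
  rw [conj_eigvec0_one_eq h0 h1]
  field_simp
  ring

/-- The numerator of the periodic closed form of `vNewPlus`. -/
def numPlus (l s C S c n t : ℂ) : ℂ :=
  (12 * l ^ 2 - 20 * l ^ 4 + 8 * l ^ 6) * C * n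
    + (-56 * l ^ 3 + 136 * l ^ 5 - 80 * l ^ 7) * t * S * c
    + (56 * l ^ 2 - 136 * l ^ 4 + 80 * l ^ 6) * t * C * S
    + Complex.I * (4 * l ^ 5 * S * c ^ 3 + (12 * l ^ 2 - 20 * l ^ 4 + 8 * l ^ 6) * C * S
      + (8 * l ^ 2 - 16 * l ^ 4) * C * S * c ^ 2 + (16 * l ^ 3 - 12 * l) * C ^ 2 * S * c)
    + s * ((6 * l ^ 3 - 4 * l ^ 5) * c ^ 2 + 4 * l ^ 2 * C * c + 4 * l ^ 4 * C * c ^ 3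
      + (2 * l - 16 * l ^ 3 + 8 * l ^ 5) * C ^ 2 - 16 * l ^ 3 * C ^ 2 * c ^ 2
      + (16 * l ^ 2 - 4) * C ^ 3 * c)
    + s * Complex.I * ((12 * l ^ 3 - 8 * l ^ 5) * S * n + (28 * l ^ 3 - 40 * l ^ 5) * t * c ^ 2
      + (80 * l ^ 6 - 56 * l ^ 4) * t * C * c + (96 * l ^ 3 - 28 * l - 80 * l ^ 5) * t * C ^ 2)

/-- The numerator of the periodic closed form of `vNewMinus`. -/
def numMinus (l s C S c n t : ℂ) : ℂ :=
  (16 * l ^ 3 - 16 * l ^ 5) * C * S + (-8 * l + 24 * l ^ 5 - 16 * l ^ 7) * t * C * n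
    + Complex.I * ((4 * l - 4 * l ^ 3) * C * n + 4 * l ^ 5 * C * c ^ 2 * n
      + (8 * l ^ 2 - 16 * l ^ 4) * C ^ 2 * c * n + (16 * l ^ 3 - 12 * l) * C ^ 3 * n)
    + s * (4 * l ^ 4 * S * c ^ 2 * n - 16 * l ^ 3 * C * S * c * n
      + (16 * l ^ 2 - 4) * C ^ 2 * S * n)
    + s * Complex.I * (-16 * l ^ 4 + 8 * l ^ 4 * c ^ 2 + (16 * l ^ 4 - 8 * l ^ 2) * C ^ 2
      + (16 * l ^ 6 - 8 * l ^ 4 - 8 * l ^ 2) * t * S * n)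

/-- After multiplication by `k^2`, the coefficient of `x` in `vPlus` is a real multiple of `v1`, so
one subtraction of `v3` makes the result periodic. The numerator is cubic in the hyperbolic
functions over a quadratic denominator, whence the growth `exp (sigma |t|)`. -/
lemma vNewPlus_eq (h0 : 0 < lam) (h1 : lam < 1) (x t : ℝ) :
    vNewPlus lam x t
      = numPlus lam (halfK lam) (chT lam t) (shT lam t) (csX lam x) (snX lam x) t
      / (halfK lam * (chT lam t - lam * csX lam x) ^ 2) := by
  have hD := den_ne_zero h0 h1 x t
  have hl := one_sub_ne_zero h1
  have hl' := one_add_ne_zero h0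
  have hs0 := ofReal_halfK_ne_zero h0 h1
  have hs := ofReal_halfK_sq h0 h1
  have hS := shT_sq lam t
  have hn := snX_sq lam x
  have hI := Complex.I_sq
  have hI0 := Complex.I_ne_zero
  have e : vNewPlus lam x t = 4 * halfK lam ^ 2 * ((eigvec0 lam x t 0 * genSecond lam x t 0
      + genEigvec lam x t 0 * secondZero lam x t 0)
      - (conj (eigvec0 lam x t 1) * conj (genSecond lam x t 1)
      + conj (genEigvec lam x t 1) * conj (secondZero lam x t 1)))
      - 2 * lam * (3 - 2 * lam ^ 2) * (1 - lam) / (1 + lam) * v3 lam x t := by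
    rw [vNewPlus, vPlus, pairMinus, pairMinus, ofReal_kOf]; ring
  rw [e, prod_zero_eq h0 h1, conj_prod_one_eq h0 h1, v3_eq h0 h1, conj_coefZero, conj_coefEig,
    conj_coefGen, conj_linPart, coefZero, coefEig, coefGen, linPart, numPlus]
  clear e
  rw [den_eq] at hD ⊢
  generalize shT lam t = S at *
  generalize chT lam t = C at *
  generalize snX lam x = n at *
  generalize csX lam x = c at *
  generalize (halfK lam : ℂ) = s at *
  generalize (lam : ℂ) = l at *
  generalize Complex.I = i at *
  generalize hd : C - l * c = D at *
  field_simp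
  subst hd
  grind

/-- For the other pairing the coefficient of `x` is a combination of `v2` and `w2`, so two
corrections are required: `v4` carries `v2`, and `w4` carries `-4 lam w2`. -/
lemma vNewMinus_eq (h0 : 0 < lam) (h1 : lam < 1) (x t : ℝ) :
    vNewMinus lam x t
      = numMinus lam (halfK lam) (chT lam t) (shT lam t) (csX lam x) (snX lam x) t
      / (halfK lam * (chT lam t - lam * csX lam x) ^ 2) := by
  have hD := den_ne_zero h0 h1 x t
  have hl := one_sub_ne_zero h1
  have hl' := one_add_ne_zero h0
  have hl0 : (lam : ℂ) ≠ 0 := Complex.ofReal_ne_zero.2 h0.ne'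
  have hs0 := ofReal_halfK_ne_zero h0 h1
  have hs := ofReal_halfK_sq h0 h1
  have hS := shT_sq lam t
  have hn := snX_sq lam x
  have hI := Complex.I_sq
  have hI0 := Complex.I_ne_zero
  have e : vNewMinus lam x t = 4 * halfK lam ^ 2 * Complex.I *
      ((eigvec0 lam x t 0 * genSecond lam x t 0
      + genEigvec lam x t 0 * secondZero lam x t 0)
      + (conj (eigvec0 lam x t 1) * conj (genSecond lam x t 1)
      + conj (genEigvec lam x t 1) * conj (secondZero lam x t 1)))
      - 2 * (1 - 4 * lam ^ 2) / lam * w4 lam x t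
      - 8 * lam ^ 2 * (1 - lam) / (1 + lam) * v4 lam x t := by
    rw [vNewMinus, vMinus, pairPlus, pairPlus, ofReal_kOf]; ring
  rw [e, prod_zero_eq h0 h1, conj_prod_one_eq h0 h1, v4_eq h0 h1, w4_eq h0 h1, conj_coefZero,
    conj_coefEig, conj_coefGen, conj_linPart, coefZero, coefEig, coefGen, linPart, numMinus]
  clear e
  rw [den_eq] at hD ⊢
  generalize shT lam t = S at *
  generalize chT lam t = C at *
  generalize snX lam x = n at *
  generalize csX lam x = c at *
  generalize (halfK lam : ℂ) = s at *
  generalize (lam : ℂ) = l at *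
  generalize Complex.I = i at *
  generalize hd : C - l * c = D at *
  field_simp
  subst hd
  grind

end

/-! ### From the Lax system to the linearized equation -/

/-- Solutions of the linearized equation, without smoothness but with explicit derivatives. -/
def SolvesLinNLS (u v : ℝ → ℝ → ℂ) : Prop :=
  ∃ vx vxx vt : ℝ → ℝ → ℂ, ∀ x t : ℝ,
    HasDerivAt (fun y => v y t) (vx x t) x ∧ HasDerivAt (fun y => vx y t) (vxx x t) x ∧
    HasDerivAt (fun s => v x s) (vt x t) t ∧
    Complex.I * vt x t + (1 / 2) * vxx x t + (2 * (u x t * conj (u x t)) - 1) * v x t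
      + (u x t) ^ 2 * conj (v x t) = 0

lemma SolvesLinNLS.isLinNLSSolution {u v : ℝ → ℝ → ℂ} (h : SolvesLinNLS u v)
    (hv : ContDiff ℝ ∞ (fun z : ℝ × ℝ => v z.1 z.2)) : IsLinNLSSolution u v := by
  obtain ⟨vx, vxx, vt, h⟩ := h
  refine ⟨hv, fun x t => ?_⟩
  obtain ⟨-, h2, h3, h4⟩ := h x t
  have e : deriv (fun y => v y t) = fun y => vx y t := funext fun y => (h y t).1.deriv
  rw [iteratedDeriv_succ, iteratedDeriv_one, e, h2.deriv, h3.deriv, ← Complex.mul_conj']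
  exact h4

lemma SolvesLinNLS.add {u v w : ℝ → ℝ → ℂ} (hv : SolvesLinNLS u v) (hw : SolvesLinNLS u w) :
    SolvesLinNLS u (fun x t => v x t + w x t) := by
  obtain ⟨vx, vxx, vt, hv⟩ := hv
  obtain ⟨wx, wxx, wt, hw⟩ := hw
  refine ⟨fun x t => vx x t + wx x t, fun x t => vxx x t + wxx x t,
    fun x t => vt x t + wt x t, fun x t => ?_⟩
  obtain ⟨a1, a2, a3, a4⟩ := hv x t
  obtain ⟨b1, b2, b3, b4⟩ := hw x t
  refine ⟨a1.fun_add b1, a2.fun_add b2, a3.fun_add b3, ?_⟩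
  rw [map_add]
  linear_combination a4 + b4

/-- Only real factors are admissible, because the equation contains `conj v`. -/
lemma SolvesLinNLS.real_mul {u v : ℝ → ℝ → ℂ} (hv : SolvesLinNLS u v) (r : ℝ) :
    SolvesLinNLS u (fun x t => (r : ℂ) * v x t) := by
  obtain ⟨vx, vxx, vt, hv⟩ := hv
  refine ⟨fun x t => r * vx x t, fun x t => r * vxx x t, fun x t => r * vt x t, fun x t => ?_⟩
  obtain ⟨a1, a2, a3, a4⟩ := hv x t
  refine ⟨a1.const_mul _, a2.const_mul _, a3.const_mul _, ?_⟩
  rw [map_mul, Complex.conj_ofReal]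
  linear_combination (r : ℂ) * a4

/-- The quadratic system satisfied by products of components of (generalized) solutions of the Lax
system yields two solutions of the linearized equation. -/
lemma solvesLinNLS_of_squared {u ux f g h f' g' h' : ℝ → ℝ → ℂ} {mu : ℝ}
    (hu : ∀ x t, HasDerivAt (fun y => u y t) (ux x t) x)
    (hfx : ∀ x t, HasDerivAt (fun y => f y t)
      (2 * mu * f x t + u x t * h x t + 2 * f' x t) x)
    (hgx : ∀ x t, HasDerivAt (fun y => g y t)
      (-conj (u x t) * h x t - 2 * mu * g x t - 2 * g' x t) x)
    (hhx : ∀ x t, HasDerivAt (fun y => h y t)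
      (2 * u x t * g x t - 2 * conj (u x t) * f x t) x)
    (hft : ∀ x t, HasDerivAt (fun s => f x s)
      (Complex.I * (2 * (mu ^ 2 + 1 / 2 * (u x t * conj (u x t) - 1)) * f x t
        + (mu * u x t + 1 / 2 * ux x t) * h x t + 4 * mu * f' x t + u x t * h' x t)) t)
    (hgt : ∀ x t, HasDerivAt (fun s => g x s)
      (Complex.I * (-2 * (mu ^ 2 + 1 / 2 * (u x t * conj (u x t) - 1)) * g x t
        + (-mu * conj (u x t) + 1 / 2 * conj (ux x t)) * h x t - 4 * mu * g' x t
        - conj (u x t) * h' x t)) t)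
    (hfx' : ∀ x t, HasDerivAt (fun y => f' y t) (2 * mu * f' x t + u x t * h' x t) x)
    (hgx' : ∀ x t, HasDerivAt (fun y => g' y t)
      (-conj (u x t) * h' x t - 2 * mu * g' x t) x) :
    SolvesLinNLS u (fun x t => f x t - conj (g x t)) ∧
    SolvesLinNLS u (fun x t => Complex.I * f x t + Complex.I * conj (g x t)) := by
  -- The second derivatives come from differentiating the right-hand sides of the first-order
  -- system, so `u` is differentiated only once.
  have hfxx := fun x t => (((hfx x t).const_mul (2 * mu : ℂ)).fun_add
    ((hu x t).fun_mul (hhx x t))).fun_add ((hfx' x t).const_mul 2)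
  have hgxx := fun x t => (((hu x t).star.fun_neg.fun_mul (hhx x t)).fun_sub
    ((hgx x t).const_mul (2 * mu : ℂ))).fun_sub ((hgx' x t).const_mul 2)
  have hI := Complex.I_sq
  constructor
  · refine ⟨_, _, _, fun x t => ⟨(hfx x t).fun_sub (hgx x t).star,
      (hfxx x t).fun_sub (hgxx x t).star, (hft x t).fun_sub (hgt x t).star, ?_⟩⟩
    simp only [RCLike.star_def, map_add, map_sub, map_mul, map_neg, map_pow, map_div₀, map_one,
      map_ofNat, Complex.conj_conj, Complex.conj_I, Complex.conj_ofReal]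
    -- Once the derivatives are inserted, everything cancels up to `i^2 = -1`. That `mu` is real is
    -- used in its conjugation.
    linear_combination (2 * (mu ^ 2 + 1 / 2 * (u x t * conj (u x t) - 1))
      * (f x t - conj (g x t)) + (mu * u x t + 1 / 2 * ux x t) * h x t
      + (-mu * u x t + 1 / 2 * ux x t) * conj (h x t) + 4 * mu * f' x t + u x t * h' x t
      - 4 * mu * conj (g' x t) - u x t * conj (h' x t)) * hI
  · refine ⟨_, _, _, fun x t => ⟨((hfx x t).const_mul Complex.I).fun_add
      ((hgx x t).star.const_mul Complex.I),
      ((hfxx x t).const_mul Complex.I).fun_add ((hgxx x t).star.const_mul Complex.I),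
      ((hft x t).const_mul Complex.I).fun_add ((hgt x t).star.const_mul Complex.I), ?_⟩⟩
    simp only [RCLike.star_def, map_add, map_sub, map_mul, map_neg, map_pow, map_div₀, map_one,
      map_ofNat, Complex.conj_conj, Complex.conj_I, Complex.conj_ofReal]
    linear_combination Complex.I * (2 * (mu ^ 2 + 1 / 2 * (u x t * conj (u x t) - 1))
      * (f x t + conj (g x t)) + (mu * u x t + 1 / 2 * ux x t) * h x t
      + (mu * u x t - 1 / 2 * ux x t) * conj (h x t) + 4 * mu * f' x t + u x t * h' x t
      + 4 * mu * conj (g' x t) + u x t * conj (h' x t)) * hI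

lemma IsGeneralizedLaxSolution.components {u ux : ℝ → ℝ → ℂ} {mu : ℂ}
    {phi psi : ℝ → ℝ → Fin 2 → ℂ} (h : IsGeneralizedLaxSolution u mu phi psi)
    (hu : ∀ x t, HasDerivAt (fun y => u y t) (ux x t) x) (x t : ℝ) :
    HasDerivAt (fun y => psi y t 0)
      (mu * psi x t 0 + u x t * psi x t 1 + phi x t 0) x ∧
    HasDerivAt (fun y => psi y t 1)
      (-conj (u x t) * psi x t 0 - mu * psi x t 1 - phi x t 1) x ∧
    HasDerivAt (fun s => psi x s 0)
      (Complex.I * ((mu ^ 2 + 1 / 2 * (u x t * conj (u x t) - 1)) * psi x t 0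
        + (mu * u x t + 1 / 2 * ux x t) * psi x t 1 + 2 * mu * phi x t 0 + u x t * phi x t 1)) t ∧
    HasDerivAt (fun s => psi x s 1)
      (Complex.I * ((-mu * conj (u x t) + 1 / 2 * conj (ux x t)) * psi x t 0
        + (-mu ^ 2 - 1 / 2 * (u x t * conj (u x t) - 1)) * psi x t 1
        - conj (u x t) * phi x t 0 - 2 * mu * phi x t 1)) t := by
  obtain ⟨hx, ht⟩ := h x t
  rw [hasDerivAt_pi] at hx ht
  refine ⟨(hx 0).congr_deriv ?_, (hx 1).congr_deriv ?_, (ht 0).congr_deriv ?_,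
    (ht 1).congr_deriv ?_⟩
  · simp [laxU, laxUDeriv, dotProduct]
  · simp [laxU, laxUDeriv, dotProduct]; ring
  · simp [laxV, laxVDeriv, dotProduct, (hu x t).deriv, Complex.mul_conj']; ring
  · simp [laxV, laxVDeriv, dotProduct, (hu x t).deriv, Complex.mul_conj']; ring

/-- Pairs of generalized solutions of the Lax system over solutions. -/
lemma solvesLinNLS_of_generalized {u ux : ℝ → ℝ → ℂ} {mu : ℝ}
    {phi0 phi1 psi0 psi1 : ℝ → ℝ → Fin 2 → ℂ}
    (hu : ∀ x t, HasDerivAt (fun y => u y t) (ux x t) x)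
    (hphi0 : IsLaxSolution u mu phi0) (hphi1 : IsGeneralizedLaxSolution u mu phi0 phi1)
    (hpsi0 : IsLaxSolution u mu psi0) (hpsi1 : IsGeneralizedLaxSolution u mu psi0 psi1) :
    SolvesLinNLS u (fun x t => pairMinus phi0 psi1 x t + pairMinus phi1 psi0 x t) ∧
    SolvesLinNLS u (fun x t => pairPlus phi0 psi1 x t + pairPlus phi1 psi0 x t) := by
  rw [isLaxSolution_iff] at hphi0 hpsi0
  have a := fun x t => hphi0.components hu x t
  have b := fun x t => hphi1.components hu x t
  have c := fun x t => hpsi0.components hu x t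
  have d := fun x t => hpsi1.components hu x t
  simp only [Pi.zero_apply, mul_zero, add_zero, sub_zero] at a c
  have key := solvesLinNLS_of_squared (mu := mu) hu
    (f := fun x t => phi0 x t 0 * psi1 x t 0 + phi1 x t 0 * psi0 x t 0)
    (g := fun x t => phi0 x t 1 * psi1 x t 1 + phi1 x t 1 * psi0 x t 1)
    (h := fun x t => phi0 x t 0 * psi1 x t 1 + phi0 x t 1 * psi1 x t 0
      + (phi1 x t 0 * psi0 x t 1 + phi1 x t 1 * psi0 x t 0))
    (f' := fun x t => phi0 x t 0 * psi0 x t 0)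
    (g' := fun x t => phi0 x t 1 * psi0 x t 1)
    (h' := fun x t => phi0 x t 0 * psi0 x t 1 + phi0 x t 1 * psi0 x t 0)
    (fun x t => (((a x t).1.fun_mul (d x t).1).fun_add
      ((b x t).1.fun_mul (c x t).1)).congr_deriv (by ring))
    (fun x t => (((a x t).2.1.fun_mul (d x t).2.1).fun_add
      ((b x t).2.1.fun_mul (c x t).2.1)).congr_deriv (by ring))
    (fun x t => ((((a x t).1.fun_mul (d x t).2.1).fun_add
      ((a x t).2.1.fun_mul (d x t).1)).fun_add (((b x t).1.fun_mul (c x t).2.1).fun_add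
      ((b x t).2.1.fun_mul (c x t).1))).congr_deriv (by ring))
    (fun x t => (((a x t).2.2.1.fun_mul (d x t).2.2.1).fun_add
      ((b x t).2.2.1.fun_mul (c x t).2.2.1)).congr_deriv (by ring))
    (fun x t => (((a x t).2.2.2.fun_mul (d x t).2.2.2).fun_add
      ((b x t).2.2.2.fun_mul (c x t).2.2.2)).congr_deriv (by ring))
    (fun x t => ((a x t).1.fun_mul (c x t).1).congr_deriv (by ring))
    (fun x t => ((a x t).2.1.fun_mul (c x t).2.1).congr_deriv (by ring))
  convert key using 4 <;> simp only [pairMinus, pairPlus, map_add, map_mul] <;> ring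

/-- Pairs of solutions of the Lax system. -/
lemma solvesLinNLS_of_lax {u ux : ℝ → ℝ → ℂ} {mu : ℝ} {phi psi : ℝ → ℝ → Fin 2 → ℂ}
    (hu : ∀ x t, HasDerivAt (fun y => u y t) (ux x t) x)
    (hphi : IsLaxSolution u mu phi) (hpsi : IsLaxSolution u mu psi) :
    SolvesLinNLS u (pairMinus phi psi) ∧ SolvesLinNLS u (pairPlus phi psi) := by
  rw [isLaxSolution_iff] at hphi hpsi
  have a := fun x t => hphi.components hu x t
  have c := fun x t => hpsi.components hu x t
  simp only [Pi.zero_apply, mul_zero, add_zero, sub_zero] at a c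
  have key := solvesLinNLS_of_squared (mu := mu) hu
    (f := fun x t => phi x t 0 * psi x t 0) (g := fun x t => phi x t 1 * psi x t 1)
    (h := fun x t => phi x t 0 * psi x t 1 + phi x t 1 * psi x t 0)
    (f' := fun _ _ => 0) (g' := fun _ _ => 0) (h' := fun _ _ => 0)
    (fun x t => ((a x t).1.fun_mul (c x t).1).congr_deriv (by ring))
    (fun x t => ((a x t).2.1.fun_mul (c x t).2.1).congr_deriv (by ring))
    (fun x t => (((a x t).1.fun_mul (c x t).2.1).fun_add
      ((a x t).2.1.fun_mul (c x t).1)).congr_deriv (by ring))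
    (fun x t => ((a x t).2.2.1.fun_mul (c x t).2.2.1).congr_deriv (by ring))
    (fun x t => ((a x t).2.2.2.fun_mul (c x t).2.2.2).congr_deriv (by ring))
    (fun x t => by simp [hasDerivAt_const]) (fun x t => by simp [hasDerivAt_const])
  simp only [map_mul] at key
  exact key

/-! ### The six periodic solutions -/

section

variable {lam : ℝ}

lemma solvesLinNLS_sixSolutions (h0 : 0 < lam) (h1 : lam < 1) (j : Fin 6) :
    SolvesLinNLS (breather lam) (sixSolutions lam j) := by
  have hu := hasDerivAt_breather_fst h0 h1
  have hone := isLaxSolution_eigvecOne h0 h1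
  have hsone := isLaxSolution_secondOne h0 h1
  have hz := isLaxSolution_eigvec0 h0 h1
  have hsz := isLaxSolution_secondZero h0 h1
  -- The pairing lemmas take a real spectral parameter, so `1` is read as a cast.
  rw [← Complex.ofReal_one] at hone hsone
  have hv3 := (solvesLinNLS_of_lax hu hone hsone).1
  have hv4 := (solvesLinNLS_of_lax hu hone hsone).2
  have hw3 := (solvesLinNLS_of_lax hu hz hsz).1
  have hw4 := (solvesLinNLS_of_lax hu hz hsz).2
  have hpm := solvesLinNLS_of_generalized hu hz (isGeneralizedLaxSolution_genEigvec h0 h1) hsz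
    (isGeneralizedLaxSolution_genSecond h0 h1)
  fin_cases j
  · change SolvesLinNLS _ (v1 lam)
    rw [v1_eq_pairMinus h0 h1]
    exact (solvesLinNLS_of_lax hu hone hone).1
  · change SolvesLinNLS _ (v2 lam)
    rw [v2_eq_pairPlus h0 h1]
    exact (solvesLinNLS_of_lax hu hone hone).2
  · change SolvesLinNLS _ (w2 lam)
    rw [w2_eq_pairPlus h0 h1]
    exact (solvesLinNLS_of_lax hu hz hz).2
  · change SolvesLinNLS _ (vLin lam)
    convert (hv3.real_mul (lam ^ 2 * ((1 - lam) / (1 + lam)))).add (hw3.real_mul (-1)) using 3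
    rw [vLin, v3, w3]; push_cast; ring
  · change SolvesLinNLS _ (vNewPlus lam)
    convert (hpm.1.real_mul (kOf lam ^ 2)).add (hv3.real_mul
      (-(2 * lam * (3 - 2 * lam ^ 2) * (1 - lam) / (1 + lam)))) using 3
    rw [vNewPlus, vPlus, v3]; push_cast; ring
  · change SolvesLinNLS _ (vNewMinus lam)
    convert ((hpm.2.real_mul (kOf lam ^ 2)).add (hw4.real_mul
      (-(2 * (1 - 4 * lam ^ 2) / lam)))).add (hv4.real_mul
      (-(8 * lam ^ 2 * (1 - lam) / (1 + lam)))) using 3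
    rw [vNewMinus, vMinus, w4, v4]; push_cast; ring

/-! ### Periodicity of the six solutions -/

lemma csX_add_period (h0 : 0 < lam) (h1 : lam < 1) (x : ℝ) :
    csX lam (x + period lam) = csX lam x := by
  rw [csX, csX, mul_add, kOf_mul_period h0 h1, Real.cos_add_two_pi]

lemma snX_add_period (h0 : 0 < lam) (h1 : lam < 1) (x : ℝ) :
    snX lam (x + period lam) = snX lam x := by
  rw [snX, snX, mul_add, kOf_mul_period h0 h1, Real.sin_add_two_pi]

lemma v1_eq (lam x t : ℝ) : v1 lam x t = -(2 * lam * (1 + lam) / (1 - lam)) *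
    (snX lam x * (2 * halfK lam * chT lam t + 2 * Complex.I * lam * shT lam t)
      / (chT lam t - lam * csX lam x) ^ 2) := by
  rw [← den_eq, ← ofReal_kOf]; rfl

lemma v2_eq (lam x t : ℝ) : v2 lam x t = 2 * Complex.I * (1 + lam) / (1 - lam) *
    ((2 * Complex.I * halfK lam * lam * shT lam t * chT lam t
      + (1 - 2 * lam ^ 2) * chT lam t ^ 2 - lam ^ 2 * csX lam x ^ 2 + 2 * lam ^ 2)
      / (chT lam t - lam * csX lam x) ^ 2) := by
  have e : v2 lam x t = 2 * Complex.I * (1 + (lam : ℂ)) / (1 - (lam : ℂ)) *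
    (Complex.I * (kOf lam : ℂ) * (lam : ℂ) * shT lam t * chT lam t / (den lam x t : ℂ) ^ 2
      + ((1 - 2 * (lam : ℂ) ^ 2) * chT lam t ^ 2
        - (lam : ℂ) ^ 2 * csX lam x ^ 2 + 2 * (lam : ℂ) ^ 2) / (den lam x t : ℂ) ^ 2) := rfl
  rw [e, ← den_eq, ofReal_kOf, ← add_div]
  ring

lemma w2_eq (lam x t : ℝ) : w2 lam x t = lam ^ 2 / 2 *
    ((2 * halfK lam * shT lam t * csX lam x + 2 * Complex.I * lam * chT lam t * csX lam x
      - 2 * Complex.I) / (chT lam t - lam * csX lam x) ^ 2) := by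
  have e : w2 lam x t = (lam : ℂ) ^ 2 *
    ((kOf lam : ℂ) * shT lam t * csX lam x
      + 2 * Complex.I * (lam : ℂ) * chT lam t * csX lam x - 2 * Complex.I)
    / (2 * (den lam x t : ℂ) ^ 2) := rfl
  rw [e, ← den_eq, ofReal_kOf]
  ring

lemma periodicInSpace_sixSolutions (h0 : 0 < lam) (h1 : lam < 1) (j : Fin 6) :
    PeriodicInSpace (period lam) (sixSolutions lam j) := by
  intro x t
  have hc := csX_add_period h0 h1 x
  have hn := snX_add_period h0 h1 x
  fin_cases j
  · change v1 lam _ _ = v1 lam _ _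
    rw [v1_eq, v1_eq, hc, hn]
  · change v2 lam _ _ = v2 lam _ _
    rw [v2_eq, v2_eq, hc]
  · change w2 lam _ _ = w2 lam _ _
    rw [w2_eq, w2_eq, hc]
  · change vLin lam _ _ = vLin lam _ _
    rw [vLin_eq h0 h1, vLin_eq h0 h1, hc, hn]
  · change vNewPlus lam _ _ = vNewPlus lam _ _
    rw [vNewPlus_eq h0 h1, vNewPlus_eq h0 h1, hc, hn]
  · change vNewMinus lam _ _ = vNewMinus lam _ _
    rw [vNewMinus_eq h0 h1, vNewMinus_eq h0 h1, hc, hn]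

/-! ### Smoothness of the six solutions -/

@[fun_prop]
lemma contDiff_ofReal {n : WithTop ℕ∞} : ContDiff ℝ n (fun x : ℝ => (x : ℂ)) :=
  Complex.ofRealCLM.contDiff

@[fun_prop]
lemma contDiff_chT {n : WithTop ℕ∞} : ContDiff ℝ n (chT lam) :=
  contDiff_ofReal.comp (Real.contDiff_cosh.comp (contDiff_const.mul contDiff_id))

@[fun_prop]
lemma contDiff_shT {n : WithTop ℕ∞} : ContDiff ℝ n (shT lam) :=
  contDiff_ofReal.comp (Real.contDiff_sinh.comp (contDiff_const.mul contDiff_id))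

@[fun_prop]
lemma contDiff_csX {n : WithTop ℕ∞} : ContDiff ℝ n (csX lam) :=
  contDiff_ofReal.comp (Real.contDiff_cos.comp (contDiff_const.mul contDiff_id))

@[fun_prop]
lemma contDiff_snX {n : WithTop ℕ∞} : ContDiff ℝ n (snX lam) :=
  contDiff_ofReal.comp (Real.contDiff_sin.comp (contDiff_const.mul contDiff_id))

lemma contDiff_div {E : Type*} [NormedAddCommGroup E] [NormedSpace ℝ E] {n : WithTop ℕ∞}
    {f g : E → ℂ} (hf : ContDiff ℝ n f) (hg : ContDiff ℝ n g) (h : ∀ x, g x ≠ 0) :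
    ContDiff ℝ n (fun x => f x / g x) := by
  simp only [div_eq_mul_inv]
  exact hf.mul (hg.inv h)

lemma contDiff_sixSolutions (h0 : 0 < lam) (h1 : lam < 1) (j : Fin 6) :
    ContDiff ℝ ∞ (fun z : ℝ × ℝ => sixSolutions lam j z.1 z.2) := by
  have hD : ∀ z : ℝ × ℝ, (chT lam z.2 - lam * csX lam z.1) ^ 2 ≠ 0 := fun z => by
    rw [← den_eq]
    exact pow_ne_zero 2 (den_ne_zero h0 h1 z.1 z.2)
  have hD' : ∀ z : ℝ × ℝ, halfK lam * (chT lam z.2 - lam * csX lam z.1) ^ 2 ≠ 0 := fun z =>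
    mul_ne_zero (ofReal_halfK_ne_zero h0 h1) (hD z)
  fin_cases j
  · change ContDiff ℝ ∞ (fun z : ℝ × ℝ => v1 lam z.1 z.2)
    simp only [v1_eq]
    exact contDiff_const.mul (contDiff_div (by fun_prop) (by fun_prop) hD)
  · change ContDiff ℝ ∞ (fun z : ℝ × ℝ => v2 lam z.1 z.2)
    simp only [v2_eq]
    exact contDiff_const.mul (contDiff_div (by fun_prop) (by fun_prop) hD)
  · change ContDiff ℝ ∞ (fun z : ℝ × ℝ => w2 lam z.1 z.2)
    simp only [w2_eq]
    exact contDiff_const.mul (contDiff_div (by fun_prop) (by fun_prop) hD)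
  · change ContDiff ℝ ∞ (fun z : ℝ × ℝ => vLin lam z.1 z.2)
    simp only [vLin_eq h0 h1, numLin]
    exact contDiff_div (by fun_prop) (by fun_prop) hD
  · change ContDiff ℝ ∞ (fun z : ℝ × ℝ => vNewPlus lam z.1 z.2)
    simp only [vNewPlus_eq h0 h1, numPlus]
    exact contDiff_div (by fun_prop) (by fun_prop) hD'
  · change ContDiff ℝ ∞ (fun z : ℝ × ℝ => vNewMinus lam z.1 z.2)
    simp only [vNewMinus_eq h0 h1, numMinus]
    exact contDiff_div (by fun_prop) (by fun_prop) hD'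

lemma isLinNLSSolution_sixSolutions (h0 : 0 < lam) (h1 : lam < 1) (j : Fin 6) :
    IsLinNLSSolution (breather lam) (sixSolutions lam j) :=
  (solvesLinNLS_sixSolutions h0 h1 j).isLinNLSSolution (contDiff_sixSolutions h0 h1 j)

end

/-! ### Asymptotic behaviour -/

section

variable {lam : ℝ}

lemma norm_csX_le (lam x : ℝ) : ‖csX lam x‖ ≤ 1 := by
  rw [csX, Complex.norm_real]; exact Real.abs_cos_le_one _

lemma norm_snX_le (lam x : ℝ) : ‖snX lam x‖ ≤ 1 := by
  rw [snX, Complex.norm_real]; exact Real.abs_sin_le_one _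

/-- The decaying exponential `e^(- sigma t)` as a complex number. -/
def decay (lam t : ℝ) : ℂ := (Real.exp (-(sigmaOf lam * t)) : ℂ)

lemma decay_ne_zero (lam t : ℝ) : decay lam t ≠ 0 :=
  Complex.ofReal_ne_zero.2 (Real.exp_ne_zero _)

lemma ofReal_exp_eq (lam t : ℝ) : (Real.exp (sigmaOf lam * t) : ℂ) = (decay lam t)⁻¹ := by
  rw [decay, ← Complex.ofReal_inv, Real.exp_neg, inv_inv]

lemma chT_eq_decay (lam t : ℝ) : chT lam t = (1 + decay lam t ^ 2) / (2 * decay lam t) := by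
  have h := decay_ne_zero lam t
  rw [chT, Real.cosh_eq, Complex.ofReal_div, Complex.ofReal_add, ofReal_exp_eq, ← decay]
  push_cast
  field_simp

lemma shT_eq_decay (lam t : ℝ) : shT lam t = (1 - decay lam t ^ 2) / (2 * decay lam t) := by
  have h := decay_ne_zero lam t
  rw [shT, Real.sinh_eq, Complex.ofReal_div, Complex.ofReal_sub, ofReal_exp_eq, ← decay]
  push_cast
  field_simp

lemma tendsto_sigmaOf_mul (h0 : 0 < lam) (h1 : lam < 1) :
    Tendsto (fun t => sigmaOf lam * t) atTop atTop :=
  tendsto_id.const_mul_atTop (sigmaOf_pos h0 h1)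

lemma tendsto_decay (h0 : 0 < lam) (h1 : lam < 1) :
    Tendsto (decay lam) atTop (𝓝 0) := by
  have h := Complex.continuous_ofReal.continuousAt.tendsto.comp
    (Real.tendsto_exp_neg_atTop_nhds_zero.comp (tendsto_sigmaOf_mul h0 h1))
  rw [Complex.ofReal_zero] at h
  exact h

lemma tendsto_decay_mul (h0 : 0 < lam) (h1 : lam < 1) :
    Tendsto (fun t : ℝ => decay lam t * (t : ℂ)) atTop (𝓝 0) := by
  have h := ((Real.tendsto_pow_mul_exp_neg_atTop_nhds_zero 1).comp
    (tendsto_sigmaOf_mul h0 h1)).const_mul (sigmaOf lam)⁻¹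
  have h2 := Complex.continuous_ofReal.continuousAt.tendsto.comp h
  rw [mul_zero, Complex.ofReal_zero] at h2
  refine h2.congr fun t => ?_
  have hs := (sigmaOf_pos h0 h1).ne'
  simp only [Function.comp_apply, decay]
  rw [← Complex.ofReal_mul]
  congr 1
  field_simp

lemma decay_chT_sub (lam x t : ℝ) : chT lam t - lam * csX lam x
    = (1 + decay lam t ^ 2 - 2 * lam * csX lam x * decay lam t) / (2 * decay lam t) := by
  have h := decay_ne_zero lam t
  rw [chT_eq_decay]
  field_simp

/-- Uniform asymptotics of quotients which depend on `x` only through `cos (k x)` and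
`sin (k x)`. -/
lemma eventually_norm_sub_le (h0 : 0 < lam) (h1 : lam < 1) {v m : ℝ → ℝ → ℂ} {A : ℝ → ℝ}
    {z : ℝ → ℂ} {a : ℂ} {N : ℂ → ℂ → ℂ → ℂ → ℂ} {M : ℂ → ℂ → ℂ → ℂ}
    (hA : ∀ᶠ t in atTop, 0 ≤ A t) (hz : Tendsto z atTop (𝓝 0))
    (hN : Continuous fun p : (ℂ × ℂ) × (ℂ × ℂ) => N p.1.1 p.1.2 p.2.1 p.2.2)
    (hM : Continuous fun p : (ℂ × ℂ) × (ℂ × ℂ) => M p.1.2 p.2.1 p.2.2)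
    (h00 : ∀ c n, N 0 0 c n = a * M 0 c n)
    (hv : ∀ᶠ t in atTop, ∀ x, v x t = A t * (N (decay lam t) (z t) (csX lam x) (snX lam x) /
      (1 + decay lam t ^ 2 - 2 * lam * csX lam x * decay lam t) ^ 2))
    (hm : ∀ᶠ t in atTop, ∀ x, m x t = A t * M (z t) (csX lam x) (snX lam x))
    {ε : ℝ} (hε : 0 < ε) :
    ∀ᶠ t in atTop, ∀ x, ‖v x t - a * m x t‖ ≤ ε * A t := by
  set H : ℂ × ℂ → ℂ × ℂ → ℂ := fun p w => N p.1 p.2 w.1 w.2 /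
    (1 + p.1 ^ 2 - 2 * lam * w.1 * p.1) ^ 2 - a * M p.2 w.1 w.2 with hH
  -- At `p = (0, 0)` the denominator is `1` and the error `H` vanishes for every `w`. By joint
  -- continuity it is small near each such point.
  have hcont : ∀ w ∈ Metric.closedBall (0 : ℂ) 1 ×ˢ Metric.closedBall (0 : ℂ) 1,
      ∀ᶠ p : (ℂ × ℂ) × (ℂ × ℂ) in 𝓝 ((0, 0), w), ‖H p.1 p.2‖ < ε := by
    intro w _
    have hc : ContinuousAt (fun p : (ℂ × ℂ) × (ℂ × ℂ) => ‖H p.1 p.2‖) ((0, 0), w) := by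
      refine ((hN.continuousAt.div (by fun_prop) (by simp)).sub
        (continuousAt_const.mul hM.continuousAt)).norm
    refine hc.eventually_lt continuousAt_const ?_
    simp [hH, h00, hε]
  have hK : IsCompact (Metric.closedBall (0 : ℂ) 1 ×ˢ Metric.closedBall (0 : ℂ) 1) :=
    (isCompact_closedBall _ _).prod (isCompact_closedBall _ _)
  -- The pair `(cos (k x), sin (k x))` stays in a compact set, and the tube argument makes the
  -- smallness uniform in it, hence uniform in `x`.
  have hev := hK.eventually_forall_of_forall_eventually
    (P := fun p w => ‖H p w‖ < ε) (x₀ := ((0 : ℂ), (0 : ℂ))) hcont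
  have htend : Tendsto (fun t => (decay lam t, z t)) atTop (𝓝 ((0 : ℂ), (0 : ℂ))) :=
    (tendsto_decay h0 h1).prodMk_nhds hz
  filter_upwards [htend.eventually hev, hA, hv, hm] with t ht hAt hvt hmt x
  have hb := ht (csX lam x, snX lam x)
    ⟨by simpa using norm_csX_le lam x, by simpa using norm_snX_le lam x⟩
  have e : v x t - a * m x t = A t * H (decay lam t, z t) (csX lam x, snX lam x) := by
    rw [hvt x, hmt x, hH]; ring
  rw [e, norm_mul, Complex.norm_real, Real.norm_of_nonneg hAt, mul_comm]
  exact mul_le_mul_of_nonneg_right hb.le hAt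

/-! ### Leading terms as time tends to infinity -/

lemma phasePlus_eq (lam : ℝ) : phasePlus lam = (halfK lam + Complex.I * lam) ^ 2 := rfl

lemma phaseMinus_eq_conj (lam : ℝ) : phaseMinus lam = conj (phasePlus lam) := by
  simp [phaseMinus, phasePlus, sub_eq_add_neg]

lemma norm_phasePlus (h0 : 0 < lam) (h1 : lam < 1) : ‖phasePlus lam‖ = 1 := by
  have h : ‖(halfK lam : ℂ) + Complex.I * lam‖ ^ 2 = 1 := by
    rw [← Complex.normSq_eq_norm_sq, Complex.normSq_apply]
    simp
    nlinarith [halfK_sq h0 h1]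
  rw [phasePlus_eq, norm_pow, h]

/-- The leading coefficients of the six solutions. -/
def leadCoef (lam : ℝ) : Fin 6 → ℝ :=
  ![4 * lam * (1 + lam) / (1 - lam), (1 + lam) / (1 - lam), -lam ^ 2, lam ^ 2,
    -(halfK lam)⁻¹, (halfK lam)⁻¹]

/-- The amplitudes of the six modes, up to constants. -/
def amp (lam : ℝ) : Fin 6 → ℝ → ℝ :=
  ![fun t => Real.exp (-(sigmaOf lam * t)), fun _ => 1, fun t => Real.exp (-(sigmaOf lam * t)),
    fun t => t, fun t => Real.exp (sigmaOf lam * t), fun t => Real.exp (sigmaOf lam * t)]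

/-- The modes with `m = 0, 1` in terms of `lam`. -/
def modes (lam : ℝ) : Fin 6 → ℝ → ℝ → ℂ :=
  ![modeSinMinus lam, modeZeroPlus, modeCosMinus lam, modeZeroMinus, modeCosPlus lam,
    modeSinPlus lam]

/-- The first wave number of the period is `k`, and `4 - k^2 = (2 lam)^2` with `lam > 0` gives the
spectral parameter back. -/
lemma sixModes_period (h0 : 0 < lam) (h1 : lam < 1) : sixModes (period lam) = modes lam := by
  have hk := kOf_pos h0 h1
  have e1 : waveNumber (period lam) 1 = kOf lam := by
    rw [waveNumber, period]; field_simp; simp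
  have e2 : lamOf (kOf lam) = lam := by
    rw [lamOf, show 4 - kOf lam ^ 2 = (2 * lam) ^ 2 by
      rw [kOf_eq, mul_pow, halfK_sq h0 h1]; ring, Real.sqrt_sq (by linarith)]
    ring
  rw [sixModes, modes, e1, e2]

lemma ofReal_exp_neg_sigma (lam t : ℝ) :
    (Real.exp (-(lam * kOf lam * t)) : ℂ) = decay lam t := rfl

lemma ofReal_exp_sigma (lam t : ℝ) :
    (Real.exp (lam * kOf lam * t) : ℂ) = (decay lam t)⁻¹ := ofReal_exp_eq lam t

lemma asymp_v1 (h0 : 0 < lam) (h1 : lam < 1) {ε : ℝ} (hε : 0 < ε) :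
    ∀ᶠ t in atTop, ∀ x, ‖v1 lam x t
      - ((4 * lam * (1 + lam) / (1 - lam) : ℝ) : ℂ) * phasePlus lam * modeSinMinus lam x t‖
      ≤ ε * Real.exp (-(sigmaOf lam * t)) := by
  have hl := one_sub_ne_zero h1
  -- The closed form contains no explicit `t`, so the second small variable is not needed. The
  -- amplitude is `exp (-sigma t)`.
  refine eventually_norm_sub_le h0 h1 (z := fun _ => 0)
    (N := fun y _ _ n => -(4 * lam * (1 + lam) / (1 - lam)) * n *
      (2 * halfK lam * (1 + y ^ 2) + 2 * Complex.I * lam * (1 - y ^ 2)))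
    (M := fun _ _ n => (2 * Complex.I * lam - 2 * halfK lam) * n)
    (Eventually.of_forall fun t => (Real.exp_pos _).le) tendsto_const_nhds
    (by fun_prop) (by fun_prop) (fun c n => ?_)
    (Eventually.of_forall fun t x => ?_) (Eventually.of_forall fun t x => ?_) hε
  · have hs := ofReal_halfK_sq h0 h1
    have hI := Complex.I_sq
    rw [phasePlus_eq]
    push_cast
    field_simp
    generalize (halfK lam : ℂ) = s at *
    generalize (lam : ℂ) = l at *
    generalize Complex.I = i at *
    grind
  · rw [v1_eq, decay_chT_sub, chT_eq_decay, shT_eq_decay,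
      show (Real.exp (-(sigmaOf lam * t)) : ℂ) = decay lam t from rfl]
    have hy := decay_ne_zero lam t
    generalize decay lam t = y at *
    generalize (1 + y ^ 2 - 2 * lam * csX lam x * y) = E
    field_simp
    ring
  · rw [modeSinMinus, ofReal_exp_neg_sigma, ofReal_kOf, ← snX,
      show (Real.exp (-(sigmaOf lam * t)) : ℂ) = decay lam t from rfl]
    ring

lemma asymp_v2 (h0 : 0 < lam) (h1 : lam < 1) {ε : ℝ} (hε : 0 < ε) :
    ∀ᶠ t in atTop, ∀ x, ‖v2 lam x t
      - (((1 + lam) / (1 - lam) : ℝ) : ℂ) * phasePlus lam * modeZeroPlus x t‖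
      ≤ ε * 1 := by
  have hl := one_sub_ne_zero h1
  refine eventually_norm_sub_le h0 h1 (z := fun _ => 0) (A := fun _ => 1)
    (N := fun y _ c _ => 2 * Complex.I * (1 + lam) / (1 - lam) *
      (2 * Complex.I * halfK lam * lam * (1 - y ^ 2) * (1 + y ^ 2)
        + (1 - 2 * lam ^ 2) * (1 + y ^ 2) ^ 2 - 4 * lam ^ 2 * c ^ 2 * y ^ 2
        + 8 * lam ^ 2 * y ^ 2))
    (M := fun _ _ _ => 2 * Complex.I)
    (Eventually.of_forall fun t => zero_le_one) tendsto_const_nhds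
    (by fun_prop) (by fun_prop) (fun c n => ?_)
    (Eventually.of_forall fun t x => ?_) (Eventually.of_forall fun t x => ?_) hε
  · have hs := ofReal_halfK_sq h0 h1
    have hI := Complex.I_sq
    rw [phasePlus_eq]
    push_cast
    field_simp
    generalize (halfK lam : ℂ) = s at *
    generalize (lam : ℂ) = l at *
    generalize Complex.I = i at *
    grind
  · rw [v2_eq, decay_chT_sub, chT_eq_decay, shT_eq_decay]
    have hy := decay_ne_zero lam t
    generalize decay lam t = y at *
    generalize (1 + y ^ 2 - 2 * lam * csX lam x * y) = E
    push_cast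
    field_simp
    ring
  · simp [modeZeroPlus]

lemma asymp_w2 (h0 : 0 < lam) (h1 : lam < 1) {ε : ℝ} (hε : 0 < ε) :
    ∀ᶠ t in atTop, ∀ x, ‖w2 lam x t
      - ((-lam ^ 2 : ℝ) : ℂ) * phasePlus lam * modeCosMinus lam x t‖
      ≤ ε * Real.exp (-(sigmaOf lam * t)) := by
  refine eventually_norm_sub_le h0 h1 (z := fun _ => 0)
    (N := fun y _ c _ => lam ^ 2 / 2 * (4 * halfK lam * (1 - y ^ 2) * c
      + 4 * Complex.I * lam * (1 + y ^ 2) * c - 8 * Complex.I * y))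
    (M := fun _ c _ => (2 * Complex.I * lam - 2 * halfK lam) * c)
    (Eventually.of_forall fun t => (Real.exp_pos _).le) tendsto_const_nhds
    (by fun_prop) (by fun_prop) (fun c n => ?_)
    (Eventually.of_forall fun t x => ?_) (Eventually.of_forall fun t x => ?_) hε
  · have hs := ofReal_halfK_sq h0 h1
    have hI := Complex.I_sq
    rw [phasePlus_eq]
    push_cast
    generalize (halfK lam : ℂ) = s at *
    generalize (lam : ℂ) = l at *
    generalize Complex.I = i at *
    grind
  · rw [w2_eq, decay_chT_sub, chT_eq_decay, shT_eq_decay,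
      show (Real.exp (-(sigmaOf lam * t)) : ℂ) = decay lam t from rfl]
    have hy := decay_ne_zero lam t
    generalize decay lam t = y at *
    generalize (1 + y ^ 2 - 2 * lam * csX lam x * y) = E
    field_simp
    ring
  · rw [modeCosMinus, ofReal_exp_neg_sigma, ofReal_kOf, ← csX,
      show (Real.exp (-(sigmaOf lam * t)) : ℂ) = decay lam t from rfl]
    ring

lemma tendsto_ofReal_inv : Tendsto (fun t : ℝ => (t : ℂ)⁻¹) atTop (𝓝 0) := by
  have h := Complex.continuous_ofReal.continuousAt.tendsto.comp tendsto_inv_atTop_zero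
  rw [Complex.ofReal_zero] at h
  exact h.congr fun t => Complex.ofReal_inv t

lemma asymp_vLin (h0 : 0 < lam) (h1 : lam < 1) {ε : ℝ} (hε : 0 < ε) :
    ∀ᶠ t in atTop, ∀ x, ‖vLin lam x t
      - ((lam ^ 2 : ℝ) : ℂ) * phasePlus lam * modeZeroMinus x t‖ ≤ ε * t := by
  -- The amplitude is `t`, so the terms without a factor `t` enter with the small variable `1 / t`;
  -- the mode becomes `t (1 / t + 2 i)`.
  refine eventually_norm_sub_le h0 h1 (z := fun t => (t : ℂ)⁻¹) (A := fun t => t)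
    (N := fun y z c n => z * (halfK lam * (-2 * lam ^ 3 * (1 + y ^ 2) * (2 * y) * n
          + Complex.I * (2 * lam - 2 * lam ^ 3) * (1 + y ^ 2) * (1 - y ^ 2))
        - lam ^ 4 * c ^ 2 * (2 * y) ^ 2 + 2 * lam * (1 + y ^ 2) * (2 * y) * c
        + (2 * lam ^ 4 - 3 * lam ^ 2) * (1 + y ^ 2) ^ 2
        - 2 * Complex.I * lam ^ 4 * (1 - y ^ 2) * (2 * y) * n)
      + halfK lam * ((8 * lam ^ 4 - 4 * lam ^ 2) * (1 - y ^ 2) * (2 * y) * c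
        - 4 * lam ^ 3 * (1 + y ^ 2) * (1 - y ^ 2))
      + Complex.I * ((4 * lam ^ 2 - 4 * lam ^ 4) * (2 * y) ^ 2
        - 2 * lam ^ 4 * c ^ 2 * (2 * y) ^ 2
        + (8 * lam ^ 5 - 4 * lam ^ 3) * (1 + y ^ 2) * (2 * y) * c
        + (2 * lam ^ 2 - 4 * lam ^ 4) * (1 + y ^ 2) ^ 2))
    (M := fun z _ _ => z + 2 * Complex.I)
    (eventually_ge_atTop 0) tendsto_ofReal_inv
    (by fun_prop) (by fun_prop) (fun c n => ?_) ?_ ?_ hε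
  · have hs := ofReal_halfK_sq h0 h1
    have hI := Complex.I_sq
    rw [phasePlus_eq]
    push_cast
    generalize (halfK lam : ℂ) = s at *
    generalize (lam : ℂ) = l at *
    generalize Complex.I = i at *
    grind
  · filter_upwards [eventually_gt_atTop 0] with t ht x
    have ht' : (t : ℂ) ≠ 0 := Complex.ofReal_ne_zero.2 ht.ne'
    rw [vLin_eq h0 h1, decay_chT_sub, chT_eq_decay, shT_eq_decay, numLin]
    have hy := decay_ne_zero lam t
    generalize decay lam t = y at *
    generalize (1 + y ^ 2 - 2 * lam * csX lam x * y) = E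
    field_simp
    ring
  · filter_upwards [eventually_gt_atTop 0] with t ht x
    have ht' : (t : ℂ) ≠ 0 := Complex.ofReal_ne_zero.2 ht.ne'
    rw [modeZeroMinus]
    field_simp

lemma asymp_vNewPlus (h0 : 0 < lam) (h1 : lam < 1) {ε : ℝ} (hε : 0 < ε) :
    ∀ᶠ t in atTop, ∀ x, ‖vNewPlus lam x t
      - ((-(halfK lam)⁻¹ : ℝ) : ℂ) * phasePlus lam * modeCosPlus lam x t‖
      ≤ ε * Real.exp (sigmaOf lam * t) := by
  have hs0 := ofReal_halfK_ne_zero h0 h1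
  -- Here `N` is the numerator times `(2 y)^3 / (2 halfK)`. The terms with a factor `t` have at most
  -- two hyperbolic factors, which leaves a factor `y t = z`, and this tends to zero.
  refine eventually_norm_sub_le h0 h1 (z := fun t => decay lam t * t)
    (N := fun y z c n => ((12 * lam ^ 2 - 20 * lam ^ 4 + 8 * lam ^ 6)
          * (1 + y ^ 2) * (2 * y) ^ 2 * n
        + (-56 * lam ^ 3 + 136 * lam ^ 5 - 80 * lam ^ 7) * (2 * z) * (1 - y ^ 2) * (2 * y) * c
        + (56 * lam ^ 2 - 136 * lam ^ 4 + 80 * lam ^ 6) * (2 * z) * (1 + y ^ 2) * (1 - y ^ 2)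
        + Complex.I * (4 * lam ^ 5 * (1 - y ^ 2) * (2 * y) ^ 2 * c ^ 3
          + (12 * lam ^ 2 - 20 * lam ^ 4 + 8 * lam ^ 6) * (1 + y ^ 2) * (1 - y ^ 2) * (2 * y)
          + (8 * lam ^ 2 - 16 * lam ^ 4) * (1 + y ^ 2) * (1 - y ^ 2) * (2 * y) * c ^ 2
          + (16 * lam ^ 3 - 12 * lam) * (1 + y ^ 2) ^ 2 * (1 - y ^ 2) * c)
        + halfK lam * ((6 * lam ^ 3 - 4 * lam ^ 5) * (2 * y) ^ 3 * c ^ 2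
          + 4 * lam ^ 2 * (1 + y ^ 2) * (2 * y) ^ 2 * c
          + 4 * lam ^ 4 * (1 + y ^ 2) * (2 * y) ^ 2 * c ^ 3
          + (2 * lam - 16 * lam ^ 3 + 8 * lam ^ 5) * (1 + y ^ 2) ^ 2 * (2 * y)
          - 16 * lam ^ 3 * (1 + y ^ 2) ^ 2 * (2 * y) * c ^ 2
          + (16 * lam ^ 2 - 4) * (1 + y ^ 2) ^ 3 * c)
        + halfK lam * Complex.I * ((12 * lam ^ 3 - 8 * lam ^ 5) * (1 - y ^ 2) * (2 * y) ^ 2 * n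
          + (28 * lam ^ 3 - 40 * lam ^ 5) * (2 * z) * (2 * y) ^ 2 * c ^ 2
          + (80 * lam ^ 6 - 56 * lam ^ 4) * (2 * z) * (1 + y ^ 2) * (2 * y) * c
          + (96 * lam ^ 3 - 28 * lam - 80 * lam ^ 5) * (2 * z) * (1 + y ^ 2) ^ 2))
      / (2 * halfK lam))
    (M := fun _ c _ => (2 * Complex.I * lam + 2 * halfK lam) * c)
    (Eventually.of_forall fun t => (Real.exp_pos _).le) (tendsto_decay_mul h0 h1)
    (by fun_prop) (by fun_prop) (fun c n => ?_)
    (Eventually.of_forall fun t x => ?_) (Eventually.of_forall fun t x => ?_) hε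
  · have hs := ofReal_halfK_sq h0 h1
    have hI := Complex.I_sq
    rw [phasePlus_eq]
    push_cast
    generalize (halfK lam : ℂ) = s at *
    generalize (lam : ℂ) = l at *
    generalize Complex.I = i at *
    field_simp
    grind
  · rw [vNewPlus_eq h0 h1, decay_chT_sub, chT_eq_decay, shT_eq_decay, numPlus, ofReal_exp_eq]
    have hy := decay_ne_zero lam t
    generalize decay lam t = y at *
    generalize (1 + y ^ 2 - 2 * lam * csX lam x * y) = E
    field_simp
  · rw [modeCosPlus, ofReal_exp_sigma, ofReal_kOf, ← csX, ofReal_exp_eq]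
    ring

lemma asymp_vNewMinus (h0 : 0 < lam) (h1 : lam < 1) {ε : ℝ} (hε : 0 < ε) :
    ∀ᶠ t in atTop, ∀ x, ‖vNewMinus lam x t
      - (((halfK lam)⁻¹ : ℝ) : ℂ) * phasePlus lam * modeSinPlus lam x t‖
      ≤ ε * Real.exp (sigmaOf lam * t) := by
  have hs0 := ofReal_halfK_ne_zero h0 h1
  refine eventually_norm_sub_le h0 h1 (z := fun t => decay lam t * t)
    (N := fun y z c n => ((16 * lam ^ 3 - 16 * lam ^ 5) * (1 + y ^ 2) * (1 - y ^ 2) * (2 * y)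
        + (-8 * lam + 24 * lam ^ 5 - 16 * lam ^ 7) * (2 * z) * (1 + y ^ 2) * (2 * y) * n
        + Complex.I * ((4 * lam - 4 * lam ^ 3) * (1 + y ^ 2) * (2 * y) ^ 2 * n
          + 4 * lam ^ 5 * (1 + y ^ 2) * (2 * y) ^ 2 * c ^ 2 * n
          + (8 * lam ^ 2 - 16 * lam ^ 4) * (1 + y ^ 2) ^ 2 * (2 * y) * c * n
          + (16 * lam ^ 3 - 12 * lam) * (1 + y ^ 2) ^ 3 * n)
        + halfK lam * (4 * lam ^ 4 * (1 - y ^ 2) * (2 * y) ^ 2 * c ^ 2 * n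
          - 16 * lam ^ 3 * (1 + y ^ 2) * (1 - y ^ 2) * (2 * y) * c * n
          + (16 * lam ^ 2 - 4) * (1 + y ^ 2) ^ 2 * (1 - y ^ 2) * n)
        + halfK lam * Complex.I * (-16 * lam ^ 4 * (2 * y) ^ 3 + 8 * lam ^ 4 * c ^ 2 * (2 * y) ^ 3
          + (16 * lam ^ 4 - 8 * lam ^ 2) * (1 + y ^ 2) ^ 2 * (2 * y)
          + (16 * lam ^ 6 - 8 * lam ^ 4 - 8 * lam ^ 2) * (2 * z) * (1 - y ^ 2) * (2 * y) * n))
      / (2 * halfK lam))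
    (M := fun _ _ n => -(2 * Complex.I * lam + 2 * halfK lam) * n)
    (Eventually.of_forall fun t => (Real.exp_pos _).le) (tendsto_decay_mul h0 h1)
    (by fun_prop) (by fun_prop) (fun c n => ?_)
    (Eventually.of_forall fun t x => ?_) (Eventually.of_forall fun t x => ?_) hε
  · have hs := ofReal_halfK_sq h0 h1
    have hI := Complex.I_sq
    rw [phasePlus_eq]
    push_cast
    generalize (halfK lam : ℂ) = s at *
    generalize (lam : ℂ) = l at *
    generalize Complex.I = i at *
    field_simp
    grind
  · rw [vNewMinus_eq h0 h1, decay_chT_sub, chT_eq_decay, shT_eq_decay, numMinus, ofReal_exp_eq]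
    have hy := decay_ne_zero lam t
    generalize decay lam t = y at *
    generalize (1 + y ^ 2 - 2 * lam * csX lam x * y) = E
    field_simp
  · rw [modeSinPlus, ofReal_exp_sigma, ofReal_kOf, ← snX, ofReal_exp_eq]
    ring

lemma asymp_sixSolutions (h0 : 0 < lam) (h1 : lam < 1) (j : Fin 6) {ε : ℝ} (hε : 0 < ε) :
    ∀ᶠ t in atTop, ∀ x, ‖sixSolutions lam j x t
      - (leadCoef lam j : ℂ) * phasePlus lam * modes lam j x t‖ ≤ ε * amp lam j t := by
  fin_cases j
  · exact asymp_v1 h0 h1 hε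
  · exact asymp_v2 h0 h1 hε
  · exact asymp_w2 h0 h1 hε
  · exact asymp_vLin h0 h1 hε
  · exact asymp_vNewPlus h0 h1 hε
  · exact asymp_vNewMinus h0 h1 hε

lemma asymp_breather (h0 : 0 < lam) (h1 : lam < 1) {ε : ℝ} (hε : 0 < ε) :
    ∀ᶠ t in atTop, ∀ x, ‖breather lam x t - phasePlus lam * 1‖ ≤ ε * 1 := by
  -- The breather has the denominator to the first power only, so `N` carries one extra factor of it
  -- to fit the squared denominator.
  refine eventually_norm_sub_le h0 h1 (z := fun _ => 0) (A := fun _ => 1) (m := fun _ _ => 1)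
    (N := fun y _ c _ => (1 + y ^ 2 - 2 * lam * c * y) *
      (-(1 + y ^ 2 - 2 * lam * c * y) + (2 * (1 - lam ^ 2) * (1 + y ^ 2)
        + 2 * Complex.I * lam * halfK lam * (1 - y ^ 2))))
    (M := fun _ _ _ => 1)
    (Eventually.of_forall fun t => zero_le_one) tendsto_const_nhds
    (by fun_prop) (by fun_prop) (fun c n => ?_)
    (Eventually.of_forall fun t x => ?_) (Eventually.of_forall fun t x => ?_) hε
  · have hs := ofReal_halfK_sq h0 h1
    have hI := Complex.I_sq
    rw [phasePlus_eq]
    generalize (halfK lam : ℂ) = s at *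
    generalize (lam : ℂ) = l at *
    generalize Complex.I = i at *
    grind
  · have hD := den_ne_zero h0 h1 x t
    have e : breather lam x t = -1 + (2 * (1 - (lam : ℂ) ^ 2) * chT lam t
      + Complex.I * (2 * lam * halfK lam) * shT lam t) / (den lam x t : ℂ) := by
      have e' : (sigmaOf lam : ℂ) = 2 * lam * halfK lam := by
        rw [sigmaOf_eq]; push_cast; rfl
      rw [← e']; rfl
    have hy := decay_ne_zero lam t
    rw [e]
    rw [den_eq, decay_chT_sub] at hD ⊢
    rw [chT_eq_decay, shT_eq_decay]
    generalize decay lam t = y at *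
    generalize (1 + y ^ 2 - 2 * lam * csX lam x * y) = E at *
    have hE : E ≠ 0 := fun h => hD (by rw [h, zero_div])
    push_cast
    field_simp
  · simp

end

section

variable {lam : ℝ}

/-! ### Time reversal -/

lemma chT_neg (lam t : ℝ) : chT lam (-t) = chT lam t := by
  rw [chT, chT, mul_neg, Real.cosh_neg]

lemma shT_neg (lam t : ℝ) : shT lam (-t) = -shT lam t := by
  rw [shT, shT, mul_neg, Real.sinh_neg, Complex.ofReal_neg]

/-- The signs of the six solutions under time reversal. -/
def revSign : Fin 6 → ℝ := ![1, -1, -1, 1, 1, -1]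

/-- In each closed form, conjugation and `t → -t` together (with `sinh` odd and `cosh` even)
multiply the numerator by a fixed sign. This reduces `t → -∞` to `t → +∞`. -/
lemma sixSolutions_reversal (h0 : 0 < lam) (h1 : lam < 1) (j : Fin 6) (x t : ℝ) :
    sixSolutions lam j x t = revSign j * conj (sixSolutions lam j x (-t)) := by
  fin_cases j
  · change v1 lam x t = ((1 : ℝ) : ℂ) * conj (v1 lam x (-t))
    rw [v1_eq, v1_eq, chT_neg, shT_neg]
    simp [map_ofNat]
  · change v2 lam x t = ((-1 : ℝ) : ℂ) * conj (v2 lam x (-t))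
    rw [v2_eq, v2_eq, chT_neg, shT_neg]
    simp [map_ofNat]; ring
  · change w2 lam x t = ((-1 : ℝ) : ℂ) * conj (w2 lam x (-t))
    rw [w2_eq, w2_eq, chT_neg, shT_neg]
    simp [map_ofNat]; ring
  · change vLin lam x t = ((1 : ℝ) : ℂ) * conj (vLin lam x (-t))
    rw [vLin_eq h0 h1, vLin_eq h0 h1, chT_neg, shT_neg, numLin, numLin]
    simp [map_ofNat]; ring
  · change vNewPlus lam x t = ((1 : ℝ) : ℂ) * conj (vNewPlus lam x (-t))
    rw [vNewPlus_eq h0 h1, vNewPlus_eq h0 h1, chT_neg, shT_neg, numPlus, numPlus]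
    simp [map_ofNat]; ring
  · change vNewMinus lam x t = ((-1 : ℝ) : ℂ) * conj (vNewMinus lam x (-t))
    rw [vNewMinus_eq h0 h1, vNewMinus_eq h0 h1, chT_neg, shT_neg, numMinus, numMinus]
    simp [map_ofNat]; ring

lemma breather_neg (lam x t : ℝ) : breather lam x (-t) = conj (breather lam x t) := by
  simp [breather, den, map_ofNat, -Complex.ofReal_cosh, -Complex.ofReal_sinh,
    -Complex.ofReal_cos]

lemma tendstoUniformly_breather_atTop (h0 : 0 < lam) (h1 : lam < 1) :
    TendstoUniformly (fun t x => breather lam x t) (fun _ => phasePlus lam) atTop := by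
  rw [Metric.tendstoUniformly_iff]
  intro ε hε
  filter_upwards [asymp_breather h0 h1 (half_pos hε)] with t ht x
  rw [dist_comm, dist_eq_norm]
  have := ht x
  rw [mul_one] at this
  linarith

lemma tendstoUniformly_breather_atBot (h0 : 0 < lam) (h1 : lam < 1) :
    TendstoUniformly (fun t x => breather lam x t) (fun _ => phaseMinus lam) atBot := by
  have h := tendstoUniformly_breather_atTop h0 h1
  rw [Metric.tendstoUniformly_iff] at h ⊢
  intro ε hε
  filter_upwards [tendsto_neg_atBot_atTop.eventually (h ε hε)] with t ht x
  have := ht x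
  rw [breather_neg, dist_comm, dist_eq_norm, ← Complex.norm_conj, map_sub, Complex.conj_conj,
    ← phaseMinus_eq_conj] at this
  rwa [dist_comm, dist_eq_norm]

/-! ### Comparison with the modes -/

lemma asympTo_of_le {l : Filter ℝ} {θ : ℂ} {v m : ℝ → ℝ → ℂ} {A : ℝ → ℝ} {c K : ℝ} (hc : c ≠ 0)
    (hK : 0 < K) (hA : ∀ᶠ t in l, A t ≤ K * ⨆ y : ℝ, ‖m y t‖)
    (h : ∀ ε : ℝ, 0 < ε → ∀ᶠ t in l, ∀ x, ‖v x t - (c : ℂ) * θ * m x t‖ ≤ ε * A t) :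
    AsympTo l θ v m := by
  refine ⟨c, hc, fun ε hε => ?_⟩
  filter_upwards [hA, h (ε / K) (div_pos hε hK)] with t ht1 ht2 x
  calc _ ≤ ε / K * A t := ht2 x
    _ ≤ ε / K * (K * ⨆ y : ℝ, ‖m y t‖) := mul_le_mul_of_nonneg_left ht1 (div_pos hε hK).le
    _ = ε * ⨆ y : ℝ, ‖m y t‖ := by field_simp

lemma le_iSup_norm {m : ℝ → ℝ → ℂ} {a : ℂ} {A t y0 : ℝ} {g : ℝ → ℝ}
    (hA : 0 ≤ A) (hm : ∀ y, m y t = a * A * g y) (hg : ∀ y, |g y| ≤ 1) (h0 : g y0 = 1) :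
    ‖a‖ * A ≤ ⨆ y : ℝ, ‖m y t‖ := by
  have hn : ∀ y, ‖m y t‖ = ‖a‖ * A * |g y| := fun y => by
    rw [hm, norm_mul, norm_mul, Complex.norm_real, Complex.norm_real, Real.norm_of_nonneg hA,
      Real.norm_eq_abs]
  -- Boundedness is required: the real supremum of an unbounded family would be the junk value `0`.
  have hb : BddAbove (Set.range fun y => ‖m y t‖) := by
    refine ⟨‖a‖ * A, ?_⟩
    rintro _ ⟨y, rfl⟩
    simp only [hn]
    exact mul_le_of_le_one_right (by positivity) (hg y)
  refine le_trans (le_of_eq ?_) (le_ciSup hb y0)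
  simp [hn, h0]

lemma kOf_mul_half_pi (h0 : 0 < lam) (h1 : lam < 1) :
    kOf lam * (Real.pi / 2 / kOf lam) = Real.pi / 2 :=
  mul_div_cancel₀ _ (kOf_pos h0 h1).ne'

lemma two_I_mul_add_ne_zero (h0 : 0 < lam) (h1 : lam < 1) :
    2 * Complex.I * (lam : ℂ) + (kOf lam : ℂ) ≠ 0 := fun h => by
  have := congrArg Complex.re h
  simp at this
  exact (kOf_pos h0 h1).ne' this

lemma two_I_mul_sub_ne_zero (h0 : 0 < lam) (h1 : lam < 1) :
    2 * Complex.I * (lam : ℂ) - (kOf lam : ℂ) ≠ 0 := fun h => by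
  have := congrArg Complex.re h
  simp at this
  exact (kOf_pos h0 h1).ne' this

lemma amp_le_iSup_modes (h0 : 0 < lam) (h1 : lam < 1) (j : Fin 6) :
    ∃ K : ℝ, 0 < K ∧ ∀ t : ℝ, amp lam j t ≤ K * ⨆ y : ℝ, ‖modes lam j y t‖ := by
  have key : ∀ {m : ℝ → ℝ → ℂ} {A : ℝ → ℝ} (a : ℂ) (g : ℝ → ℝ) (y0 : ℝ), a ≠ 0 →
      (∀ t, 0 ≤ A t) → (∀ t y, m y t = a * A t * g y) → (∀ y, |g y| ≤ 1) → g y0 = 1 →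
      ∃ K : ℝ, 0 < K ∧ ∀ t : ℝ, A t ≤ K * ⨆ y : ℝ, ‖m y t‖ := by
    intro m A a g y0 ha hA hm hg hy
    refine ⟨‖a‖⁻¹, inv_pos.2 (norm_pos_iff.2 ha), fun t => ?_⟩
    rw [← div_eq_inv_mul, le_div_iff₀ (norm_pos_iff.2 ha), mul_comm]
    exact le_iSup_norm (hA t) (hm t) hg hy
  have hp := two_I_mul_add_ne_zero h0 h1
  have hm := two_I_mul_sub_ne_zero h0 h1
  fin_cases j
  · refine key _ (fun y => Real.sin (kOf lam * y)) (Real.pi / 2 / kOf lam) hm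
      (fun t => (Real.exp_pos _).le) (fun t y => rfl) (fun y => Real.abs_sin_le_one _) ?_
    simp [kOf_mul_half_pi h0 h1]
  · exact key (2 * Complex.I) (fun _ => 1) 0 (by simp) (fun t => zero_le_one)
      (fun t y => by simp [modes, amp, modeZeroPlus]) (fun y => by simp) rfl
  · refine key _ (fun y => Real.cos (kOf lam * y)) 0 hm
      (fun t => (Real.exp_pos _).le) (fun t y => rfl) (fun y => Real.abs_cos_le_one _) ?_
    simp
  · refine ⟨1, one_pos, fun t => ?_⟩
    change t ≤ 1 * ⨆ y : ℝ, ‖modeZeroMinus y t‖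
    simp only [modeZeroMinus]
    rw [ciSup_const, one_mul]
    have h := Complex.abs_im_le_norm (1 + 2 * Complex.I * (t : ℂ))
    simp only [Complex.add_im, Complex.mul_im, Complex.one_im, Complex.ofReal_re,
      Complex.ofReal_im] at h
    have h2 := le_abs_self t
    have h3 : |2 * t| = 2 * |t| := by rw [abs_mul]; norm_num
    simp at h
    have h4 := abs_nonneg t
    linarith
  · refine key _ (fun y => Real.cos (kOf lam * y)) 0 hp
      (fun t => (Real.exp_pos _).le) (fun t y => rfl) (fun y => Real.abs_cos_le_one _) ?_
    simp
  · refine key _ (fun y => Real.sin (kOf lam * y)) (Real.pi / 2 / kOf lam) (neg_ne_zero.2 hp)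
      (fun t => (Real.exp_pos _).le) (fun t y => rfl) (fun y => Real.abs_sin_le_one _) ?_
    simp [kOf_mul_half_pi h0 h1]

lemma leadCoef_ne_zero (h0 : 0 < lam) (h1 : lam < 1) (j : Fin 6) : leadCoef lam j ≠ 0 := by
  have hs := halfK_pos h0 h1
  have h2 : (0 : ℝ) < 1 - lam := by linarith
  fin_cases j
  · exact (by positivity : (0 : ℝ) < 4 * lam * (1 + lam) / (1 - lam)).ne'
  · exact (by positivity : (0 : ℝ) < (1 + lam) / (1 - lam)).ne'
  · exact neg_ne_zero.2 (by positivity : (0 : ℝ) < lam ^ 2).ne'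
  · exact (by positivity : (0 : ℝ) < lam ^ 2).ne'
  · exact neg_ne_zero.2 (inv_ne_zero hs.ne')
  · exact inv_ne_zero hs.ne'

lemma asympTo_atTop_sixSolutions (h0 : 0 < lam) (h1 : lam < 1) (j : Fin 6) :
    AsympTo atTop (phasePlus lam) (sixSolutions lam j) (sixModes (period lam) j) := by
  rw [sixModes_period h0 h1]
  obtain ⟨K, hK, h⟩ := amp_le_iSup_modes h0 h1 j
  exact asympTo_of_le (leadCoef_ne_zero h0 h1 j) hK (Eventually.of_forall h)
    fun ε hε => asymp_sixSolutions h0 h1 j hε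

lemma AsympTo.reversal {θ : ℂ} {v m : ℝ → ℝ → ℂ} (h : AsympTo atTop θ v m) {r : ℝ}
    (hr : |r| = 1) (hv : ∀ x t, v x t = r * conj (v x (-t))) :
    AsympTo atBot (conj θ) v (timeReversal m) := by
  obtain ⟨c, hc, h⟩ := h
  have hr0 : r ≠ 0 := fun h => by simp [h] at hr
  refine ⟨r * c, mul_ne_zero hr0 hc, fun ε hε => ?_⟩
  filter_upwards [tendsto_neg_atBot_atTop.eventually (h ε hε)] with t ht x
  have e : v x t - ((r * c : ℝ) : ℂ) * conj θ * timeReversal m x t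
      = r * conj (v x (-t) - c * θ * m x (-t)) := by
    rw [hv, timeReversal, map_sub, map_mul, map_mul, Complex.conj_ofReal]
    push_cast; ring
  rw [e, norm_mul, Complex.norm_real, Real.norm_eq_abs, hr, one_mul, Complex.norm_conj]
  simp only [timeReversal, Complex.norm_conj]
  exact ht x

lemma abs_revSign (j : Fin 6) : |revSign j| = 1 := by
  fin_cases j <;> simp [revSign]

lemma asympTo_atBot_sixSolutions (h0 : 0 < lam) (h1 : lam < 1) (j : Fin 6) :
    AsympTo atBot (phaseMinus lam) (sixSolutions lam j)
      (timeReversal (sixModes (period lam) j)) := by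
  rw [phaseMinus_eq_conj]
  exact (asympTo_atTop_sixSolutions h0 h1 j).reversal (abs_revSign j)
    (sixSolutions_reversal h0 h1 j)

/-! ### Linear independence -/

/-- The spatial profiles of the six modes. -/
def profile (lam : ℝ) : Fin 6 → ℝ → ℂ :=
  ![fun x => (2 * Complex.I * lam - kOf lam) * snX lam x, fun _ => 2 * Complex.I,
    fun x => (2 * Complex.I * lam - kOf lam) * csX lam x, fun _ => 2 * Complex.I,
    fun x => (2 * Complex.I * lam + kOf lam) * csX lam x,
    fun x => -(2 * Complex.I * lam + kOf lam) * snX lam x]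

lemma amp_pos (lam : ℝ) (j : Fin 6) : ∀ᶠ t in atTop, 0 < amp lam j t := by
  fin_cases j
  · exact Eventually.of_forall fun t => Real.exp_pos _
  · exact Eventually.of_forall fun t => one_pos
  · exact Eventually.of_forall fun t => Real.exp_pos _
  · exact eventually_gt_atTop 0
  · exact Eventually.of_forall fun t => Real.exp_pos _
  · exact Eventually.of_forall fun t => Real.exp_pos _

lemma tendsto_modes_div_amp (lam : ℝ) (j : Fin 6) (x : ℝ) :
    Tendsto (fun t => modes lam j x t / amp lam j t) atTop (𝓝 (profile lam j x)) := by
  have key : (∀ᶠ t in atTop, modes lam j x t = amp lam j t * profile lam j x) →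
      Tendsto (fun t => modes lam j x t / amp lam j t) atTop (𝓝 (profile lam j x)) := fun h => by
    refine tendsto_const_nhds.congr' ?_
    filter_upwards [h, amp_pos lam j] with t ht hp
    have hp' : (amp lam j t : ℂ) ≠ 0 := Complex.ofReal_ne_zero.2 hp.ne'
    rw [ht]; field_simp
  fin_cases j
  · refine key (Eventually.of_forall fun t => ?_)
    change modeSinMinus lam x t = (Real.exp (-(lam * kOf lam * t)) : ℂ)
      * ((2 * Complex.I * lam - kOf lam) * snX lam x)
    rw [modeSinMinus, snX]; ring
  · refine key (Eventually.of_forall fun t => ?_)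
    change 2 * Complex.I = ((1 : ℝ) : ℂ) * (2 * Complex.I)
    simp
  · refine key (Eventually.of_forall fun t => ?_)
    change modeCosMinus lam x t = (Real.exp (-(lam * kOf lam * t)) : ℂ)
      * ((2 * Complex.I * lam - kOf lam) * csX lam x)
    rw [modeCosMinus, csX]; ring
  · change Tendsto (fun t : ℝ => (1 + 2 * Complex.I * t) / (t : ℂ)) atTop (𝓝 (2 * Complex.I))
    have h := tendsto_ofReal_inv.add_const (2 * Complex.I)
    rw [zero_add] at h
    refine h.congr' ?_
    filter_upwards [eventually_gt_atTop 0] with t ht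
    have ht' : (t : ℂ) ≠ 0 := Complex.ofReal_ne_zero.2 ht.ne'
    field_simp
  · refine key (Eventually.of_forall fun t => ?_)
    change modeCosPlus lam x t = (Real.exp (lam * kOf lam * t) : ℂ)
      * ((2 * Complex.I * lam + kOf lam) * csX lam x)
    rw [modeCosPlus, csX]; ring
  · refine key (Eventually.of_forall fun t => ?_)
    change modeSinPlus lam x t = (Real.exp (lam * kOf lam * t) : ℂ)
      * (-(2 * Complex.I * lam + kOf lam) * snX lam x)
    rw [modeSinPlus, snX]; ring

lemma tendsto_sixSolutions_div_amp (h0 : 0 < lam) (h1 : lam < 1) (j : Fin 6) (x : ℝ) :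
    Tendsto (fun t => sixSolutions lam j x t / amp lam j t) atTop
      (𝓝 (leadCoef lam j * phasePlus lam * profile lam j x)) := by
  have h := (tendsto_modes_div_amp lam j x).const_mul (leadCoef lam j * phasePlus lam)
  have h2 : Tendsto (fun t => (sixSolutions lam j x t
      - leadCoef lam j * phasePlus lam * modes lam j x t) / amp lam j t) atTop (𝓝 0) := by
    rw [Metric.tendsto_nhds]
    intro ε hε
    filter_upwards [asymp_sixSolutions h0 h1 j (half_pos hε), amp_pos lam j] with t ht hp
    rw [dist_zero_right, norm_div, Complex.norm_real, Real.norm_of_nonneg hp.le,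
      div_lt_iff₀ hp]
    exact (ht x).trans_lt (mul_lt_mul_of_pos_right (half_lt_self hε) hp)
  have h3 := h2.add h
  rw [zero_add] at h3
  refine h3.congr fun t => ?_
  ring

/-- Dividing a vanishing combination by a comparison rate `B` and letting `t → ∞` leaves a relation
among the profiles. The ratios are required only where `g j ≠ 0`, so faster solutions already
excluded play no role. -/
lemma sum_leading_eq_zero (h0 : 0 < lam) (h1 : lam < 1) {g : Fin 6 → ℝ}
    (hg : ∀ x t, ∑ j, (g j : ℂ) * sixSolutions lam j x t = 0) {B : ℝ → ℝ} {r : Fin 6 → ℝ}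
    (hB : ∀ j, g j ≠ 0 → Tendsto (fun t => amp lam j t / B t) atTop (𝓝 (r j))) (x : ℝ) :
    ∑ j, (g j : ℂ) * (leadCoef lam j * phasePlus lam * profile lam j x * r j) = 0 := by
  have h : Tendsto (fun t => ∑ j, (g j : ℂ) * (sixSolutions lam j x t / B t)) atTop
      (𝓝 (∑ j, (g j : ℂ) * (leadCoef lam j * phasePlus lam * profile lam j x * r j))) := by
    refine tendsto_finsetSum _ fun j _ => ?_
    by_cases hj : g j = 0
    · simp [hj]
    · have h2 := (tendsto_sixSolutions_div_amp h0 h1 j x).mul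
        (Complex.continuous_ofReal.continuousAt.tendsto.comp (hB j hj))
      refine (h2.const_mul (g j : ℂ)).congr' ?_
      filter_upwards [amp_pos lam j] with t hp
      have hp' : (amp lam j t : ℂ) ≠ 0 := Complex.ofReal_ne_zero.2 hp.ne'
      simp only [Function.comp_apply, Complex.ofReal_div]
      field_simp
  refine tendsto_nhds_unique h (tendsto_const_nhds.congr fun t => ?_)
  have := hg x t
  simp only [← mul_div_assoc]
  rw [← Finset.sum_div, this, zero_div]

lemma tendsto_exp_sigma (h0 : 0 < lam) (h1 : lam < 1) :
    Tendsto (fun t => Real.exp (sigmaOf lam * t)) atTop atTop :=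
  Real.tendsto_exp_atTop.comp (tendsto_sigmaOf_mul h0 h1)

lemma tendsto_exp_neg_sigma (h0 : 0 < lam) (h1 : lam < 1) :
    Tendsto (fun t => Real.exp (-(sigmaOf lam * t))) atTop (𝓝 0) :=
  Real.tendsto_exp_neg_atTop_nhds_zero.comp (tendsto_sigmaOf_mul h0 h1)

lemma linearIndependent_sixSolutions (h0 : 0 < lam) (h1 : lam < 1) :
    LinearIndependent ℝ (sixSolutions lam) := by
  rw [Fintype.linearIndependent_iff]
  intro g hg
  have hg' : ∀ x t, ∑ j, (g j : ℂ) * sixSolutions lam j x t = 0 := fun x t => by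
    have := congrFun (congrFun hg x) t
    simpa [Finset.sum_apply] using this
  have hI := Complex.I_ne_zero
  have hth : phasePlus lam ≠ 0 := norm_ne_zero_iff.1 (by rw [norm_phasePlus h0 h1]; simp)
  have hc : ∀ j, (leadCoef lam j : ℂ) ≠ 0 := fun j =>
    Complex.ofReal_ne_zero.2 (leadCoef_ne_zero h0 h1 j)
  have hp := two_I_mul_add_ne_zero h0 h1
  have hm := two_I_mul_sub_ne_zero h0 h1
  have c0 : csX lam 0 = 1 := by simp [csX]
  have n0 : snX lam 0 = 0 := by simp [snX]
  have c1 : csX lam (Real.pi / 2 / kOf lam) = 0 := by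
    rw [csX, kOf_mul_half_pi h0 h1]; simp
  have n1 : snX lam (Real.pi / 2 / kOf lam) = 1 := by
    rw [snX, kOf_mul_half_pi h0 h1]; simp
  have hexp := tendsto_exp_sigma h0 h1
  have hexpn := tendsto_exp_neg_sigma h0 h1
  have hratio : Tendsto (fun t => t / Real.exp (sigmaOf lam * t)) atTop (𝓝 0) := by
    have h := ((Real.tendsto_pow_mul_exp_neg_atTop_nhds_zero 1).comp
      (tendsto_sigmaOf_mul h0 h1)).const_mul (sigmaOf lam)⁻¹
    rw [mul_zero] at h
    refine h.congr fun t => ?_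
    have hs := (sigmaOf_pos h0 h1).ne'
    simp only [Function.comp_apply, Real.exp_neg]
    field_simp
  -- At the fastest rate only the growing cosine and sine solutions survive. The points `x = 0` and
  -- `x = pi / (2 k)` separate them.
  have s1 := sum_leading_eq_zero h0 h1 hg' (B := fun t => Real.exp (sigmaOf lam * t))
    (r := ![0, 0, 0, 0, 1, 1]) (fun j _ => by
      fin_cases j
      · exact hexpn.div_atTop hexp
      · exact tendsto_const_nhds.div_atTop hexp
      · exact hexpn.div_atTop hexp
      · exact hratio
      · exact tendsto_const_nhds.congr fun t => (div_self (Real.exp_ne_zero _)).symm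
      · exact tendsto_const_nhds.congr fun t => (div_self (Real.exp_ne_zero _)).symm)
  have g4 : g 4 = 0 := by
    have h := s1 0
    simp [Fin.sum_univ_six, profile, c0, n0, hc, hth, hp] at h
    exact h
  have g5 : g 5 = 0 := by
    have h := s1 (Real.pi / 2 / kOf lam)
    simp [Fin.sum_univ_six, profile, c1, n1, g4, hc, hth, hp, -neg_add_rev] at h
    exact h
  -- With the exponentially growing pair removed, `vLin` alone has the rate `t`.
  have s2 := sum_leading_eq_zero h0 h1 hg' (B := fun t => t)
    (r := ![0, 0, 0, 1, 0, 0]) (fun j hj => by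
      fin_cases j
      · exact hexpn.div_atTop tendsto_id
      · exact tendsto_const_nhds.div_atTop tendsto_id
      · exact hexpn.div_atTop tendsto_id
      · refine tendsto_const_nhds.congr' ?_
        filter_upwards [eventually_gt_atTop 0] with t ht
        exact (div_self ht.ne').symm
      · exact absurd g4 hj
      · exact absurd g5 hj)
  have g3 : g 3 = 0 := by
    have h := s2 0
    simp [Fin.sum_univ_six, profile, hc, hth] at h
    exact h
  have s3 := sum_leading_eq_zero h0 h1 hg' (B := fun _ => 1)
    (r := ![0, 1, 0, 0, 0, 0]) (fun j hj => by
      fin_cases j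
      · exact hexpn.congr fun t => (div_one _).symm
      · exact tendsto_const_nhds.congr fun t => (div_one _).symm
      · exact hexpn.congr fun t => (div_one _).symm
      · exact absurd g3 hj
      · exact absurd g4 hj
      · exact absurd g5 hj)
  have g1 : g 1 = 0 := by
    have h := s3 0
    simp [Fin.sum_univ_six, profile, hc, hth] at h
    exact h
  -- Only the two decaying solutions are left; the same two points separate their sine and cosine
  -- profiles.
  have s4 := sum_leading_eq_zero h0 h1 hg' (B := fun t => Real.exp (-(sigmaOf lam * t)))
    (r := ![1, 0, 1, 0, 0, 0]) (fun j hj => by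
      fin_cases j
      · exact tendsto_const_nhds.congr fun t => (div_self (Real.exp_ne_zero _)).symm
      · exact absurd g1 hj
      · exact tendsto_const_nhds.congr fun t => (div_self (Real.exp_ne_zero _)).symm
      · exact absurd g3 hj
      · exact absurd g4 hj
      · exact absurd g5 hj)
  have g2 : g 2 = 0 := by
    have h := s4 0
    simp [Fin.sum_univ_six, profile, c0, n0, hc, hth, hm] at h
    exact h
  have g0 : g 0 = 0 := by
    have h := s4 (Real.pi / 2 / kOf lam)
    simp [Fin.sum_univ_six, profile, c1, n1, hc, hth, hm] at h
    exact h
  intro j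
  fin_cases j
  · exact g0
  · exact g1
  · exact g2
  · exact g3
  · exact g4
  · exact g5

/-! ### Growth and instability -/

lemma period_pos (h0 : 0 < lam) (h1 : lam < 1) : 0 < period lam :=
  div_pos Real.two_pi_pos (kOf_pos h0 h1)

lemma integral_cos_sq_period (h0 : 0 < lam) (h1 : lam < 1) :
    ∫ x in (0 : ℝ)..period lam, Real.cos (kOf lam * x) ^ 2 = period lam / 2 := by
  rw [intervalIntegral.integral_comp_mul_left (fun x => Real.cos x ^ 2) (kOf_pos h0 h1).ne',
    kOf_mul_period h0 h1, integral_cos_sq, period]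
  have := (kOf_pos h0 h1).ne'
  simp
  field_simp

lemma integral_sin_sq_period (h0 : 0 < lam) (h1 : lam < 1) :
    ∫ x in (0 : ℝ)..period lam, Real.sin (kOf lam * x) ^ 2 = period lam / 2 := by
  rw [intervalIntegral.integral_comp_mul_left (fun x => Real.sin x ^ 2) (kOf_pos h0 h1).ne',
    kOf_mul_period h0 h1, integral_sin_sq, period]
  have := (kOf_pos h0 h1).ne'
  simp
  field_simp

lemma norm_two_I_mul_add (h0 : 0 < lam) (h1 : lam < 1) :
    ‖2 * Complex.I * (lam : ℂ) + (kOf lam : ℂ)‖ = 2 := by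
  have h : ‖2 * Complex.I * (lam : ℂ) + (kOf lam : ℂ)‖ ^ 2 = 2 ^ 2 := by
    rw [← Complex.normSq_eq_norm_sq, Complex.normSq_apply, kOf_eq]
    simp
    nlinarith [halfK_sq h0 h1]
  exact (sq_eq_sq₀ (norm_nonneg _) zero_le_two).1 h

lemma growsExponentially_of_asymp (h0 : 0 < lam) (h1 : lam < 1) {v m : ℝ → ℝ → ℂ} {c : ℝ}
    {g : ℝ → ℝ} (hc : c ≠ 0) (hg : Continuous g) (hg1 : ∀ x, |g x| ≤ 1)
    (hint : ∫ x in (0 : ℝ)..period lam, g x ^ 2 = period lam / 2)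
    (hv : ∀ t, Continuous fun x => v x t) (hsym : ∀ x t, ‖v x (-t)‖ = ‖v x t‖)
    (hm : ∀ x t, ‖m x t‖ = 2 * Real.exp (sigmaOf lam * t) * |g x|)
    (h : ∀ ε : ℝ, 0 < ε → ∀ᶠ t in atTop, ∀ x,
      ‖v x t - (c : ℂ) * phasePlus lam * m x t‖ ≤ ε * Real.exp (sigmaOf lam * t)) :
    GrowsExponentially (period lam) (sigmaOf lam) v := by
  have hL := period_pos h0 h1
  have hca : 0 < |c| := abs_pos.2 hc
  obtain ⟨T, hT⟩ := eventually_atTop.1 (h (|c| / 2) (half_pos hca))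
  -- The error is at most `|c| e / 2` against a main term of modulus `2 |c| e |g|`. Integrating the
  -- lower bound with mean of `g^2` equal to `1 / 2` gives `1 - 1 / 4 = 3 / 4`; the upper bound uses
  -- `2 + 1 / 2 = 5 / 2`.
  refine ⟨√(3 / 4 * |c| ^ 2 * period lam), √(25 / 4 * |c| ^ 2 * period lam), T,
    Real.sqrt_pos.2 (by positivity), Real.sqrt_pos.2 (by positivity), fun t ht => ?_⟩
  have habs : l2Norm (period lam) (fun x => v x t)
      = l2Norm (period lam) (fun x => v x |t|) := by
    rcases abs_choice t with e | e
    · rw [e]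
    · simp only [l2Norm, e, hsym]
  rw [habs]
  have hb := hT |t| ht
  set e := Real.exp (sigmaOf lam * |t|) with he
  have he0 : 0 < e := Real.exp_pos _
  have hnorm : ∀ x, ‖(c : ℂ) * phasePlus lam * m x |t|‖ = 2 * |c| * e * |g x| := fun x => by
    rw [norm_mul, norm_mul, norm_phasePlus h0 h1, hm, Complex.norm_real, Real.norm_eq_abs]
    ring
  have hlow : ∀ x, 2 * |c| ^ 2 * e ^ 2 * g x ^ 2 - |c| ^ 2 * e ^ 2 / 4 ≤ ‖v x |t|‖ ^ 2 := by
    intro x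
    have h3 : 2 * |c| * e * |g x| ≤ ‖v x |t|‖ + |c| / 2 * e := by
      rw [← hnorm]
      have h4 := norm_sub_norm_le ((c : ℂ) * phasePlus lam * m x |t|) (v x |t|)
      rw [norm_sub_rev] at h4
      linarith [hb x]
    have h5 : (2 * |c| * e * |g x|) ^ 2 ≤ (‖v x |t|‖ + |c| / 2 * e) ^ 2 :=
      pow_le_pow_left₀ (by positivity) h3 2
    have h6 : (2 * |c| * e * |g x|) ^ 2 = 4 * |c| ^ 2 * e ^ 2 * g x ^ 2 := by
      rw [mul_pow, sq_abs]; ring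
    rw [h6] at h5
    -- This is `(a + b)^2 ≤ 2 a^2 + 2 b^2`.
    nlinarith [sq_nonneg (‖v x |t|‖ - |c| / 2 * e)]
  have hup : ∀ x, ‖v x |t|‖ ^ 2 ≤ 25 / 4 * |c| ^ 2 * e ^ 2 := by
    intro x
    have h3 : ‖v x |t|‖ ≤ 5 / 2 * |c| * e := by
      have h4 := norm_sub_norm_le (v x |t|) ((c : ℂ) * phasePlus lam * m x |t|)
      rw [hnorm] at h4
      have h5 : 2 * |c| * e * |g x| ≤ 2 * |c| * e := mul_le_of_le_one_right (by positivity) (hg1 x)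
      linarith [hb x]
    calc ‖v x |t|‖ ^ 2 ≤ (5 / 2 * |c| * e) ^ 2 := pow_le_pow_left₀ (norm_nonneg _) h3 2
      _ = _ := by ring
  have hi : IntervalIntegrable (fun x => ‖v x |t|‖ ^ 2) MeasureTheory.volume 0 (period lam) :=
    ((hv |t|).norm.pow 2).intervalIntegrable _ _
  constructor
  · rw [l2Norm, ← Real.sqrt_sq he0.le, ← Real.sqrt_mul (by positivity)]
    refine Real.sqrt_le_sqrt ?_
    have h3 := intervalIntegral.integral_mono_on (μ := MeasureTheory.volume) hL.le
      (Continuous.intervalIntegrable (by fun_prop) _ _) hi (fun x _ => hlow x)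
    rw [intervalIntegral.integral_sub (Continuous.intervalIntegrable (by fun_prop) _ _)
      (Continuous.intervalIntegrable (by fun_prop) _ _), intervalIntegral.integral_const_mul,
      hint, intervalIntegral.integral_const, smul_eq_mul] at h3
    linarith
  · rw [l2Norm, ← Real.sqrt_sq he0.le, ← Real.sqrt_mul (by positivity)]
    refine Real.sqrt_le_sqrt ?_
    have h3 := intervalIntegral.integral_mono_on (μ := MeasureTheory.volume) hL.le hi
      (Continuous.intervalIntegrable (by fun_prop) _ _) (fun x _ => hup x)
    rw [intervalIntegral.integral_const, smul_eq_mul] at h3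
    linarith

lemma continuous_sixSolutions (h0 : 0 < lam) (h1 : lam < 1) (j : Fin 6) (t : ℝ) :
    Continuous fun x => sixSolutions lam j x t :=
  (contDiff_sixSolutions h0 h1 j).continuous.comp (continuous_id.prodMk continuous_const)

lemma norm_sixSolutions_neg (h0 : 0 < lam) (h1 : lam < 1) (j : Fin 6) (x t : ℝ) :
    ‖sixSolutions lam j x (-t)‖ = ‖sixSolutions lam j x t‖ := by
  rw [sixSolutions_reversal h0 h1 j x t, norm_mul, Complex.norm_real, Real.norm_eq_abs,
    abs_revSign, one_mul, Complex.norm_conj]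

lemma growsExponentially_vNewPlus (h0 : 0 < lam) (h1 : lam < 1) :
    GrowsExponentially (period lam) (sigmaOf lam) (vNewPlus lam) := by
  refine growsExponentially_of_asymp h0 h1 (g := fun x => Real.cos (kOf lam * x))
    (leadCoef_ne_zero h0 h1 4) (by fun_prop) (fun x => Real.abs_cos_le_one _)
    (integral_cos_sq_period h0 h1) (continuous_sixSolutions h0 h1 4)
    (norm_sixSolutions_neg h0 h1 4) (m := modeCosPlus lam) (fun x t => ?_)
    (fun ε hε => asymp_sixSolutions h0 h1 4 hε)
  rw [modeCosPlus, norm_mul, norm_mul, norm_two_I_mul_add h0 h1, Complex.norm_real,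
    Complex.norm_real, Real.norm_eq_abs, Real.norm_eq_abs, Real.abs_exp]
  rfl

lemma growsExponentially_vNewMinus (h0 : 0 < lam) (h1 : lam < 1) :
    GrowsExponentially (period lam) (sigmaOf lam) (vNewMinus lam) := by
  refine growsExponentially_of_asymp h0 h1 (g := fun x => Real.sin (kOf lam * x))
    (leadCoef_ne_zero h0 h1 5) (by fun_prop) (fun x => Real.abs_sin_le_one _)
    (integral_sin_sq_period h0 h1) (continuous_sixSolutions h0 h1 5)
    (norm_sixSolutions_neg h0 h1 5) (m := modeSinPlus lam) (fun x t => ?_)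
    (fun ε hε => asymp_sixSolutions h0 h1 5 hε)
  rw [modeSinPlus, norm_mul, norm_mul, norm_neg, norm_two_I_mul_add h0 h1, Complex.norm_real,
    Complex.norm_real, Real.norm_eq_abs, Real.norm_eq_abs, Real.abs_exp]
  rfl

lemma l2Norm_const_mul (L r : ℝ) (hr : 0 ≤ r) (f : ℝ → ℂ) :
    l2Norm L (fun x => (r : ℂ) * f x) = r * l2Norm L f := by
  simp only [l2Norm, norm_mul, mul_pow, Complex.norm_real, Real.norm_of_nonneg hr]
  rw [intervalIntegral.integral_const_mul, Real.sqrt_mul (sq_nonneg r), Real.sqrt_sq hr]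

lemma not_linearlyStable_breather (h0 : 0 < lam) (h1 : lam < 1) :
    ¬ LinearlyStable (period lam) (breather lam) := by
  intro h
  obtain ⟨δ, hδ, hst⟩ := h 1 one_pos
  obtain ⟨c, C, T, hc, -, hgr⟩ := growsExponentially_vNewPlus h0 h1
  set a := l2Norm (period lam) (fun x => vNewPlus lam x 0) with ha
  have ha0 : 0 ≤ a := Real.sqrt_nonneg _
  -- The factor scales the initial norm below `δ`; the `+ 1` avoids a separate case `a = 0`.
  set r := δ / (a + 1) / 2 with hr
  have hr0 : 0 < r := by positivity
  have hsmall : r * a < δ := by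
    have : r * a = δ * (a / (a + 1)) / 2 := by rw [hr]; field_simp
    rw [this]
    have h2 : a / (a + 1) ≤ 1 := (div_le_one (by positivity)).2 (by linarith)
    nlinarith
  have hsol : IsLinNLSSolution (breather lam) (fun x t => (r : ℂ) * vNewPlus lam x t) :=
    ((solvesLinNLS_sixSolutions h0 h1 4).real_mul r).isLinNLSSolution
      (contDiff_const.mul (contDiff_sixSolutions h0 h1 4))
  have hper : PeriodicInSpace (period lam) (fun x t => (r : ℂ) * vNewPlus lam x t) :=
    fun x t => congrArg ((r : ℂ) * ·) (periodicInSpace_sixSolutions h0 h1 4 x t)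
  have hbound := hst _ hsol hper (by rwa [l2Norm_const_mul _ _ hr0.le])
  -- At a time with `r c exp (sigma t) ≥ 1` the lower growth bound contradicts the stability bound
  -- `1`.
  have hev := ((tendsto_exp_sigma h0 h1).const_mul_atTop (mul_pos hr0 hc)).eventually_ge_atTop 1
  obtain ⟨t, ht1, ht2, ht3⟩ :=
    (hev.and ((eventually_ge_atTop T).and (eventually_ge_atTop 0))).exists
  have h2 := hbound t ht3
  rw [l2Norm_const_mul _ _ hr0.le] at h2
  have h3 := (hgr t (by rwa [abs_of_nonneg ht3])).1
  rw [abs_of_nonneg ht3] at h3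
  have h4 := mul_le_mul_of_nonneg_left h3 hr0.le
  linarith

end

end Akhmediev

end

theorem mainTheorem1 (lam0 : ℝ) (h0 : 0 < lam0) (h1 : lam0 < 1) :
    -- the solutions and generalized solutions of the Lax system at `lam = 1` and `lam = lam0`
    (IsLaxSolution (breather lam0) 1 (eigvecOne lam0) ∧
      (∀ x t : ℝ, eigvecOne lam0 (x + period lam0) t = eigvecOne lam0 x t) ∧
      IsLaxSolution (breather lam0) 1 (secondOne lam0) ∧
      IsLaxSolution (breather lam0) (lam0 : ℂ) (eigvec0 lam0) ∧
      (∀ x t : ℝ, eigvec0 lam0 (x + period lam0) t = -eigvec0 lam0 x t) ∧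
      IsLaxSolution (breather lam0) (lam0 : ℂ) (secondZero lam0) ∧
      IsGeneralizedLaxSolution (breather lam0) (lam0 : ℂ) (eigvec0 lam0) (genEigvec lam0) ∧
      (∀ x t : ℝ, genEigvec lam0 (x + period lam0) t = -genEigvec lam0 x t) ∧
      IsGeneralizedLaxSolution (breather lam0) (lam0 : ℂ) (secondZero lam0) (genSecond lam0)) ∧
    -- they generate `v1`, `v2`, `w2`; the other three solutions are built from them by definition
    (v1 lam0 = pairMinus (eigvecOne lam0) (eigvecOne lam0) ∧
      v2 lam0 = pairPlus (eigvecOne lam0) (eigvecOne lam0) ∧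
      w2 lam0 = pairPlus (eigvec0 lam0) (eigvec0 lam0)) ∧
    -- six linearly independent periodic solutions of the linearized equation
    (∀ j : Fin 6, IsLinNLSSolution (breather lam0) (sixSolutions lam0 j) ∧
      PeriodicInSpace (period lam0) (sixSolutions lam0 j)) ∧
    LinearIndependent ℝ (sixSolutions lam0) ∧
    -- asymptotic behaviour as `t → ±∞`
    (TendstoUniformly (fun t x => breather lam0 x t) (fun _ => phasePlus lam0) atTop ∧
      TendstoUniformly (fun t x => breather lam0 x t) (fun _ => phaseMinus lam0) atBot) ∧
    (∀ j : Fin 6,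
      AsympTo atTop (phasePlus lam0) (sixSolutions lam0 j) (sixModes (period lam0) j) ∧
      AsympTo atBot (phaseMinus lam0) (sixSolutions lam0 j)
        (timeReversal (sixModes (period lam0) j))) ∧
    -- exponential growth and linear instability
    (GrowsExponentially (period lam0) (sigmaOf lam0) (vNewPlus lam0) ∧
      GrowsExponentially (period lam0) (sigmaOf lam0) (vNewMinus lam0)) ∧
    ¬ LinearlyStable (period lam0) (breather lam0) :=
  ⟨⟨isLaxSolution_eigvecOne h0 h1, eigvecOne_add_period h0 h1, isLaxSolution_secondOne h0 h1,
      isLaxSolution_eigvec0 h0 h1, eigvec0_add_period h0 h1, isLaxSolution_secondZero h0 h1,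
      isGeneralizedLaxSolution_genEigvec h0 h1, genEigvec_add_period h0 h1,
      isGeneralizedLaxSolution_genSecond h0 h1⟩,
    ⟨v1_eq_pairMinus h0 h1, v2_eq_pairPlus h0 h1, w2_eq_pairPlus h0 h1⟩,
    fun j => ⟨isLinNLSSolution_sixSolutions h0 h1 j, periodicInSpace_sixSolutions h0 h1 j⟩,
    linearIndependent_sixSolutions h0 h1,
    ⟨tendstoUniformly_breather_atTop h0 h1, tendstoUniformly_breather_atBot h0 h1⟩,
    fun j => ⟨asympTo_atTop_sixSolutions h0 h1 j, asympTo_atBot_sixSolutions h0 h1 j⟩,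
    ⟨growsExponentially_vNewPlus h0 h1, growsExponentially_vNewMinus h0 h1⟩,
    not_linearlyStable_breather h0 h1⟩
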